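/- **Setting.** $\mathcal{RH}_\infty$ is the set of proper, real rational transfer matrices with all poles in the open left half plane, $\|G\|_\infty=\sup_{\omega\in\mathbb R}\|G(i\omega)\|$ (spectral norm) for $G \in \mathcal{RH}_\infty$, and a square $W$ is bistable and biproper if $W,W^{-1}\in\mathcal{RH}_\infty$. For $P=\begin{bmatrix}P_{11}&P_{12}\\P_{21}&P_{22}\end{bmatrix}$ let $\mathcal F_l(P,K)=P_{12}K(I-P_{22}K)^{-1}P_{21}+P_{11}$; it is well-posed if $I-P_{22}K$ has a proper real rational inverse and, for $P\in\mathcal{RH}_\infty$, internally stable if moreover $K(I-P_{22}K)^{-1}\in\mathcal{RH}_\infty$. Let $\Sigma^1,\dots,\Sigma^k$ ($\Sigma^j$ of size $p_j\times m_j$) be subsystems, $\Sigma_B=\mathrm{diag}(\Sigma^1,\dots,\Sigma^k)$, $m_B=\sum_j m_j$, $p_B=\sum_j p_j$, and let $S=\begin{bmatrix}S_{11}&S_{12}\\S_{21}&S_{22}\end{bmatrix}$ be the interconnection dynamics, of size $(p_C+m_B)\times(m_C+p_B)$. For each $j$, superscripts $j$ and $l$ on blocks of $S$ refer to the channels of subsystem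 $j$ and of all subsystems other than $j$; let $\bar S^j=\left[\begin{array}{cc|c}S_{11}&S_{12}^j&S_{12}^l\\S_{21}^j&S_{22}^{j,j}&S_{22}^{j,l}\\\hline S_{21}^l&S_{22}^{l,j}&S_{22}^{l,l}\end{array}\right]$, $\bar\Sigma_B^j=\mathrm{diag}(\Sigma^i)_{i\ne j}$, and let $E^j=\mathcal F_l(\bar S^j,\bar\Sigma^j_B)$ be the environment of $\Sigma^j$. Its partition into blocks $E^j_{11},E^j_{12},E^j_{21},E^j_{22}$ separates the external channel from the channel of subsystem $j$. Assume that $\Sigma^j,S\in\mathcal{RH}_\infty$ and that $\mathcal F_l(S,\Sigma_B)$ and all $E^j$ are well-posed and internally stable. Let $\hat\Sigma^j$ be proper real rational reduced subsystems of the same sizes, $\hat\Sigma_B=\mathrm{diag}(\hat\Sigma^1,\dots,\hat\Sigma^k)$ and $E_C=\mathcal F_l(S,\hat\Sigma_B)-\mathcal F_l(S,\Sigma_B)$. *Errors.* Let $G_y^j\in\mathbb C^{p_j\times p_j}$, $G_u^j\in\mathbb C^{m_j\times m_j}$ be nonsingular. Given proper real rational abstracted environments $\hat E^j$, put $$\hat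 F^j=\left[\begin{array}{cc|c}\hat E^j_{11}&0&\hat E^j_{12}\\0&0&G_y^j\\\hline\hat E^j_{21}&G_u^j&\hat E^j_{22}\end{array}\right],\qquad E_F^j=\mathcal F_l(\hat F^j,\hat\Sigma^j)-\mathcal F_l(\hat F^j,\Sigma^j),\qquad \tilde E_F^j=(G_y^j)^{-1}E^j_{F,22}(G_u^j)^{-1},$$ where both LFTs are assumed well-posed. With *environment abstraction*, the $\hat E^j$ are arbitrary and $E^j_{E,22}=\hat E^j_{22}-E^j_{22}$. With *subsystem abstraction*, $\hat E^j$ is built like $E^j$, by a well-posed LFT, from abstracted subsystems $\tilde\Sigma^i$ instead of $\Sigma^i$, and $E_A^j=\tilde\Sigma^j-\Sigma^j$. The errors $\tilde E^j_F$, and $E^j_{E,22}$ or $E^j_A$, are assumed to be in $\mathcal{RH}_\infty$. *Plants.* Let $M=(I-\Sigma_BS_{22})^{-1}\Sigma_B$, $Z=S_{22}-\mathrm{diag}(E^1_{22},\dots,E^k_{22})$ and $$N_E=\left[\begin{array}{ccc|c}-M&I+MZ&M&MS_{21}\\-ZM-I&Z(I+MZ)&ZM&(I+ZM)S_{21}\\-M&MZ&M&MS_{21}\\\hline-S_{12}M&S_{12}(I+MZ)&S_{12}M&0\end{array}\right].$$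 With $L=(I-S_{22}^{l,l}\bar\Sigma_B^j)^{-1}$ let $$\bar E^j=\begin{bmatrix}S_{22}^{j,j}+S_{22}^{j,l}\bar\Sigma_B^jLS_{22}^{l,j}&S_{22}^{j,l}(I+\bar\Sigma_B^jLS_{22}^{l,l})\\LS_{22}^{l,j}&LS_{22}^{l,l}\end{bmatrix},\qquad \bar E_{ab}=\mathrm{diag}(\bar E^1_{ab},\dots,\bar E^k_{ab}),\qquad Y=S_{22}-\bar E_{11},$$ $$N_\Sigma=\left[\begin{array}{ccc|c}\bar E_{22}-\bar E_{21}M\bar E_{12}&\bar E_{21}(I+MY)&\bar E_{21}M\bar E_{12}&\bar E_{21}MS_{21}\\-YM\bar E_{12}-\bar E_{12}&Y(I+MY)&YM\bar E_{12}&(I+YM)S_{21}\\-\bar E_{21}M\bar E_{12}&\bar E_{21}MY&\bar E_{22}+\bar E_{21}M\bar E_{12}&\bar E_{21}MS_{21}\\\hline-S_{12}M\bar E_{12}&S_{12}(I+MY)&S_{12}M\bar E_{12}&0\end{array}\right].$$ *Weights.* Let $V_C,W_C,\mathcal V_F^j,W_F^j$, and $\mathcal V_E^j,W_E^j$ (environment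 abstraction) or $\mathcal V_A^j,W_A^j$ (subsystem abstraction), be bistable, biproper weights of appropriate sizes. For environment abstraction put $$\mathcal V=\mathrm{diag}(\mathcal V_E^1,\dots,\mathcal V_E^k,\mathcal V_F^1,\dots,\mathcal V_F^k,\mathcal V_E^1,\dots,\mathcal V_E^k,V_C),$$ define $W$ likewise from $W_E^j,W_F^j,W_C$, and let $\varepsilon=\mathrm{diag}(\varepsilon_E^1I,\dots,\varepsilon_E^kI,\varepsilon_F^1I,\dots,\varepsilon_F^kI,\varepsilon_E^1I,\dots,\varepsilon_E^kI,I)$ with $\varepsilon_E^j,\varepsilon_F^j>0$. For subsystem abstraction replace, for each $j$, the $j$-th block with index $E$ by $\mathrm{diag}(\mathcal V_A^i)_{i\ne j}$, $\mathrm{diag}(W_A^i)_{i\neq j}$ and $\mathrm{diag}(\varepsilon_A^iI)_{i\ne j}$, respectively, with $\varepsilon_A^i>0$. Let $V=\varepsilon\mathcal V$, so $V_X^j=\varepsilon_X^j\mathcal V_X^j$ for $X\in\{E,A,F\}$, and $P=\mathcal VNW$ with $N=N_E$ or $N=N_\Sigma$. *Scalings.* $\mathbb D$ is the set of all pairs $(D_\ell,D_r)$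 that, after sorting the channels so that all copies of the same abstraction error are adjacent, read $\mathrm{diag}(R^1\otimes I,\dots,R^k\otimes I,d^1I,\dots,d^kI,I)$ with the same Hermitian $R^j\succ0$ and real $d^j>0$ in $D_\ell$ and $D_r$, and with identity matrices of the sizes that fit the rows of $N$ (for $D_\ell$) and its columns (for $D_r$). Here $R^j\in\mathbb C^{2\times2}$ for environment abstraction and $R^j\in\mathbb C^{2(k-1)\times2(k-1)}$ for subsystem abstraction. **Theorem.** Consider, for either kind of abstraction, the problem of maximizing $\|\varepsilon\|$ subject to $$\varepsilon\,P(i\omega)D_rP(i\omega)^H\varepsilon\preceq D_\ell\quad\forall\,\omega\in\mathbb R,\qquad(D_\ell,D_r)\in\mathbb D,\tag{1}$$ and let $\varepsilon$ be any feasible solution (not necessarily a maximizer). Suppose that for all $j$ the low-level specifications $$\|(W_F^j)^{-1}\tilde E_F^j(V_F^j)^{-1}\|_\infty\le1\quad\text{and}\quad\|(W_E^j)^{-1}E_{E,22}^j(V_E^j)^{-1}\|_\infty\le1\ \text{ (environment abstraction), or }\ \|(W_A^j)^{-1}E_A^j(V_A^j)^{-1}\|_\infty\le1\ \text{ (subsystem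 abstraction)}$$ hold and that (1) and these specifications are not both tight: either all these low-level norms are $<1$, or, for some $\eta>0$ and some $(D_\ell,D_r)\in\mathbb D$, $\varepsilon P(i\omega)D_rP(i\omega)^H\varepsilon\preceq(1-\eta)D_\ell$ for all $\omega\in\mathbb R$. Then $\mathcal F_l(S,\hat\Sigma_B)$ is well-posed and internally stable, in particular in $\mathcal{RH}_\infty$, and $E_C\in\mathcal{RH}_\infty$ with $\|V_CE_CW_C\|_\infty<1$. -/

import Mathlib

open Matrix
open scoped Matrix.Norms.L2Operator Kronecker ComplexOrder

noncomputable section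

/-! ### Rational transfer function matrices -/

/-- Matrices of rational functions of the Laplace variable. Complex coefficients are allowed
because the augmentation weights `G_u`, `G_y` are complex; every system, weight and error is
required to be real rational by the predicates below. -/
abbrev TF (α β : Type) : Type := Matrix α β (RatFunc ℂ)

/-- `f` is a quotient of two polynomials with real coefficients. -/
def IsRealRational (f : RatFunc ℂ) : Prop :=
  ∃ a b : Polynomial ℝ, b ≠ 0 ∧
    f = algebraMap (Polynomial ℂ) (RatFunc ℂ) (a.map Complex.ofRealHom) /
      algebraMap (Polynomial ℂ) (RatFunc ℂ) (b.map Complex.ofRealHom)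

/-- Proper: the degree of the numerator does not exceed the degree of the denominator. -/
def IsProperRat (f : RatFunc ℂ) : Prop := f.num.natDegree ≤ f.denom.natDegree

/-- Stable: all poles lie in the open left half plane. -/
def IsStableRat (f : RatFunc ℂ) : Prop := ∀ z : ℂ, f.denom.eval z = 0 → z.re < 0

/-- Proper, real rational transfer function matrices. -/
def ProperRR {α β : Type} (G : TF α β) : Prop :=
  ∀ i j, IsRealRational (G i j) ∧ IsProperRat (G i j)

/-- Proper, real rational, stable transfer function matrices (the space `RH∞`). -/
def RHinf {α β : Type} (G : TF α β) : Prop :=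
  ∀ i j, IsRealRational (G i j) ∧ IsProperRat (G i j) ∧ IsStableRat (G i j)

/-- Bistable and biproper square weighting function: it and its inverse are in `RH∞`. -/
def Bistable {α : Type} [Fintype α] [DecidableEq α] (W : TF α α) : Prop :=
  RHinf W ∧ IsUnit W.det ∧ RHinf W⁻¹

/-- The frequency response `G(iω)`. -/
def freqResp {α β : Type} (G : TF α β) (ω : ℝ) : Matrix α β ℂ :=
  G.map (RatFunc.eval (RingHom.id ℂ) (Complex.I * (ω : ℂ)))

/-- The `H∞` norm of a transfer function matrix in `RH∞`: the supremum over all frequencies of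
the spectral norm of the frequency response. -/
def hinfNorm {α β : Type} [Fintype α] [Fintype β] [DecidableEq β] (G : TF α β) : ENNReal :=
  ⨆ ω : ℝ, ENNReal.ofReal ‖freqResp G ω‖

/-- A complex matrix as a constant transfer function matrix. -/
def constTF {α β : Type} (A : Matrix α β ℂ) : TF α β := A.map RatFunc.C

/-! ### Linear fractional transformations -/

section LFT

variable {α β γ δ : Type} [Fintype β] [DecidableEq β] [Fintype δ]

/-- Lower linear fractional transformation. -/
def llft (P : TF (α ⊕ β) (γ ⊕ δ)) (M : TF δ β) : TF α γ :=
  P.toBlocks₁₂ * M * (1 - P.toBlocks₂₂ * M)⁻¹ * P.toBlocks₂₁ + P.toBlocks₁₁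

/-- The lower LFT is well-posed: `I - P₂₂ M` has a proper real rational inverse. -/
def LftWellPosed (P : TF (α ⊕ β) (γ ⊕ δ)) (M : TF δ β) : Prop :=
  IsUnit (1 - P.toBlocks₂₂ * M).det ∧ ProperRR (1 - P.toBlocks₂₂ * M)⁻¹

/-- The lower LFT of `P ∈ RH∞` and `M` is internally stable: `M (I - P₂₂ M)⁻¹ ∈ RH∞`. -/
def LftInternallyStable (P : TF (α ⊕ β) (γ ⊕ δ)) (M : TF δ β) : Prop :=
  RHinf (M * (1 - P.toBlocks₂₂ * M)⁻¹)

end LFT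

/-! ### Index types -/

/-- Index type of the stacked signal with blocks of sizes `n 1, …, n k`. -/
abbrev Idx {k : ℕ} (n : Fin k → ℕ) : Type := (j : Fin k) × Fin (n j)

/-- Index type of the stacked signal in which block `j` is left out. -/
abbrev IdxOff {k : ℕ} (n : Fin k → ℕ) (j : Fin k) : Type := (l : {l : Fin k // l ≠ j}) × Fin (n l)

/-- Index type of the stacked signal over all `j` of the stacked signals without block `j`. -/
abbrev IdxOffs {k : ℕ} (n : Fin k → ℕ) : Type := (j : Fin k) × IdxOff n j

/-- Index type for the three groups of error channels and the external channel. -/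
abbrev Chan (A F C : Type) : Type := (A ⊕ (F ⊕ A)) ⊕ C

/-- Block diagonal matrix over the three groups of error channels and the external channel. -/
def diagChan {R A A' F F' C C' : Type} [Zero R] (X : Matrix A A' R) (Y : Matrix F F' R)
    (Z : Matrix C C' R) : Matrix (Chan A F C) (Chan A' F' C') R :=
  fromBlocks (fromBlocks X 0 0 (fromBlocks Y 0 0 X)) 0 0 Z

/-- A `4 × 4` block matrix, partitioned as (abstraction, reduction, abstraction | external). -/
def blocksChan {R A A' F F' C C' : Type}
    (X₁₁ : Matrix A A' R) (X₁₂ : Matrix A F' R) (X₁₃ : Matrix A A' R) (X₁₄ : Matrix A C' R)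
    (X₂₁ : Matrix F A' R) (X₂₂ : Matrix F F' R) (X₂₃ : Matrix F A' R) (X₂₄ : Matrix F C' R)
    (X₃₁ : Matrix A A' R) (X₃₂ : Matrix A F' R) (X₃₃ : Matrix A A' R) (X₃₄ : Matrix A C' R)
    (X₄₁ : Matrix C A' R) (X₄₂ : Matrix C F' R) (X₄₃ : Matrix C A' R) (X₄₄ : Matrix C C' R) :
    Matrix (Chan A F C) (Chan A' F' C') R :=
  fromBlocks
    (fromBlocks X₁₁ (fromCols X₁₂ X₁₃) (fromRows X₂₁ X₃₁) (fromBlocks X₂₂ X₂₃ X₃₂ X₃₃))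
    (fromRows X₁₄ (fromRows X₂₄ X₃₄)) (fromCols X₄₁ (fromCols X₄₂ X₄₃)) X₄₄

section Systems

variable {k pC mC : ℕ} {m p : Fin k → ℕ}

/-! ### Interconnected systems and environments -/

/-- Parallel connection of all subsystems. -/
def parB (Sig : ∀ j, TF (Fin (p j)) (Fin (m j))) : TF (Idx p) (Idx m) := blockDiagonal' Sig

/-- Parallel connection of all subsystems except the `j`-th. -/
def parOff (Sig : ∀ j, TF (Fin (p j)) (Fin (m j))) (j : Fin k) : TF (IdxOff p j) (IdxOff m j) :=
  blockDiagonal' fun l : {l : Fin k // l ≠ j} => Sig l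

/-- The reordering that puts the external block and block `j` first, then all other blocks. -/
def splitIdx {n : Fin k → ℕ} {c : ℕ} (j : Fin k) :
    (Fin c ⊕ Fin (n j)) ⊕ IdxOff n j → Fin c ⊕ Idx n :=
  Sum.elim (Sum.map id fun i => (⟨j, i⟩ : Idx n)) fun x => Sum.inr ⟨x.1, x.2⟩

/-- The interconnection dynamics with rows and columns permuted for subsystem `j`. -/
def permS (S : TF (Fin pC ⊕ Idx m) (Fin mC ⊕ Idx p)) (j : Fin k) :
    TF ((Fin pC ⊕ Fin (m j)) ⊕ IdxOff m j) ((Fin mC ⊕ Fin (p j)) ⊕ IdxOff p j) :=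
  S.submatrix (splitIdx j) (splitIdx j)

/-- The environment of subsystem `j`. -/
def env (S : TF (Fin pC ⊕ Idx m) (Fin mC ⊕ Idx p)) (Sig : ∀ j, TF (Fin (p j)) (Fin (m j)))
    (j : Fin k) : TF (Fin pC ⊕ Fin (m j)) (Fin mC ⊕ Fin (p j)) :=
  llft (permS S j) (parOff Sig j)

/-- Subsystems and interconnection are in `RH∞`, and all environments and the interconnected
system are well-posed and internally stable. -/
def StandingAssumption (S : TF (Fin pC ⊕ Idx m) (Fin mC ⊕ Idx p))
    (Sig : ∀ j, TF (Fin (p j)) (Fin (m j))) : Prop :=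
  (∀ j, RHinf (Sig j)) ∧ RHinf S ∧
    (∀ j, LftWellPosed (permS S j) (parOff Sig j) ∧
      LftInternallyStable (permS S j) (parOff Sig j)) ∧
    LftWellPosed S (parB Sig) ∧ LftInternallyStable S (parB Sig)

/-! ### Errors -/

/-- The reduction error of the interconnected system. -/
def errC (S : TF (Fin pC ⊕ Idx m) (Fin mC ⊕ Idx p)) (Sig SigR : ∀ j, TF (Fin (p j)) (Fin (m j))) :
    TF (Fin pC) (Fin mC) :=
  llft S (parB SigR) - llft S (parB Sig)

/-- A single environment augmented with the weights `G_y`, `G_u`. -/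
def augEnv {a b : ℕ} (E : TF (Fin pC ⊕ Fin a) (Fin mC ⊕ Fin b)) (Gy : Matrix (Fin b) (Fin b) ℂ)
    (Gu : Matrix (Fin a) (Fin a) ℂ) :
    TF ((Fin pC ⊕ Fin b) ⊕ Fin a) ((Fin mC ⊕ Fin a) ⊕ Fin b) :=
  fromBlocks (fromBlocks E.toBlocks₁₁ 0 0 0) (fromRows E.toBlocks₁₂ (constTF Gy))
    (fromCols E.toBlocks₂₁ (constTF Gu)) E.toBlocks₂₂

/-- The error caused by reducing `Sj` to `SjR` within the augmented environment. -/
def errF {a b : ℕ} (E : TF (Fin pC ⊕ Fin a) (Fin mC ⊕ Fin b)) (Gy : Matrix (Fin b) (Fin b) ℂ)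
    (Gu : Matrix (Fin a) (Fin a) ℂ) (Sj SjR : TF (Fin b) (Fin a)) :
    TF (Fin pC ⊕ Fin b) (Fin mC ⊕ Fin a) :=
  llft (augEnv E Gy Gu) SjR - llft (augEnv E Gy Gu) Sj

/-- The normalized reduction error: the `22`-block of `errF` with the weights removed. -/
def errFtilde {a b : ℕ} (E : TF (Fin pC ⊕ Fin a) (Fin mC ⊕ Fin b)) (Gy : Matrix (Fin b) (Fin b) ℂ)
    (Gu : Matrix (Fin a) (Fin a) ℂ) (Sj SjR : TF (Fin b) (Fin a)) : TF (Fin b) (Fin a) :=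
  (constTF Gy)⁻¹ * (errF E Gy Gu Sj SjR).toBlocks₂₂ * (constTF Gu)⁻¹

/-! ### The generalized plants -/

/-- `M = (I - Σ_B S₂₂)⁻¹ Σ_B`. -/
def plantM (S : TF (Fin pC ⊕ Idx m) (Fin mC ⊕ Idx p)) (Sig : ∀ j, TF (Fin (p j)) (Fin (m j))) :
    TF (Idx p) (Idx m) :=
  (1 - parB Sig * S.toBlocks₂₂)⁻¹ * parB Sig

/-- The generalized plant relating abstraction and reduction errors to the interconnected error,
for environment abstraction. -/
def plantEnv (S : TF (Fin pC ⊕ Idx m) (Fin mC ⊕ Idx p)) (Sig : ∀ j, TF (Fin (p j)) (Fin (m j))) :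
    TF (Chan (Idx p) (Idx m) (Fin pC)) (Chan (Idx m) (Idx p) (Fin mC)) :=
  let M := plantM S Sig
  let Z := S.toBlocks₂₂ - blockDiagonal' fun j => (env S Sig j).toBlocks₂₂
  let S₁₂ := S.toBlocks₁₂
  let S₂₁ := S.toBlocks₂₁
  blocksChan
    (-M)            (1 + M * Z)         M            (M * S₂₁)
    (-(Z * M) - 1)  (Z * (1 + M * Z))   (Z * M)      ((1 + Z * M) * S₂₁)
    (-M)            (M * Z)             M            (M * S₂₁)
    (-(S₁₂ * M))    (S₁₂ * (1 + M * Z)) (S₁₂ * M)    0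

/-- The extended environment of subsystem `j`, with the errors on the other subsystems pulled
out. -/
def extEnv (S : TF (Fin pC ⊕ Idx m) (Fin mC ⊕ Idx p)) (Sig : ∀ j, TF (Fin (p j)) (Fin (m j)))
    (j : Fin k) : TF (Fin (m j) ⊕ IdxOff m j) (Fin (p j) ⊕ IdxOff p j) :=
  let Sjj := (permS S j).toBlocks₁₁.toBlocks₂₂
  let Sjl := (permS S j).toBlocks₁₂.toRows₂
  let Slj := (permS S j).toBlocks₂₁.toCols₂
  let Sll := (permS S j).toBlocks₂₂
  let L := (1 - Sll * parOff Sig j)⁻¹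
  fromBlocks (Sjj + Sjl * parOff Sig j * L * Slj) (Sjl * (1 + parOff Sig j * L * Sll))
    (L * Slj) (L * Sll)

/-- The generalized plant relating abstraction and reduction errors to the interconnected error,
for subsystem abstraction. -/
def plantSys (S : TF (Fin pC ⊕ Idx m) (Fin mC ⊕ Idx p)) (Sig : ∀ j, TF (Fin (p j)) (Fin (m j))) :
    TF (Chan (IdxOffs m) (Idx m) (Fin pC)) (Chan (IdxOffs p) (Idx p) (Fin mC)) :=
  let M := plantM S Sig
  let E₁₁ : TF (Idx m) (Idx p) := blockDiagonal' fun j => (extEnv S Sig j).toBlocks₁₁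
  let E₁₂ : TF (Idx m) (IdxOffs p) := blockDiagonal' fun j => (extEnv S Sig j).toBlocks₁₂
  let E₂₁ : TF (IdxOffs m) (Idx p) := blockDiagonal' fun j => (extEnv S Sig j).toBlocks₂₁
  let E₂₂ : TF (IdxOffs m) (IdxOffs p) := blockDiagonal' fun j => (extEnv S Sig j).toBlocks₂₂
  let Y := S.toBlocks₂₂ - E₁₁
  let S₁₂ := S.toBlocks₁₂
  let S₂₁ := S.toBlocks₂₁
  blocksChan
    (E₂₂ - E₂₁ * M * E₁₂)     (E₂₁ * (1 + M * Y)) (E₂₁ * M * E₁₂)         (E₂₁ * M * S₂₁)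
    (-(Y * M * E₁₂) - E₁₂)    (Y * (1 + M * Y))   (Y * M * E₁₂)           ((1 + Y * M) * S₂₁)
    (-(E₂₁ * M * E₁₂))        (E₂₁ * M * Y)       (E₂₂ + E₂₁ * M * E₁₂)   (E₂₁ * M * S₂₁)
    (-(S₁₂ * M * E₁₂))        (S₁₂ * (1 + M * Y)) (S₁₂ * M * E₁₂)         0

/-! ### Block diagonal weights -/

/-- `diag(X¹, …, Xᵏ, Y¹, …, Yᵏ, X¹, …, Xᵏ, Z)`. -/
def boldEnv {R : Type} [Zero R] {n q : Fin k → ℕ} {c : ℕ} (X : ∀ j, Matrix (Fin (n j)) (Fin (n j)) R)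
    (Y : ∀ j, Matrix (Fin (q j)) (Fin (q j)) R) (Z : Matrix (Fin c) (Fin c) R) :
    Matrix (Chan (Idx n) (Idx q) (Fin c)) (Chan (Idx n) (Idx q) (Fin c)) R :=
  diagChan (blockDiagonal' X) (blockDiagonal' Y) Z

/-- `diag(X̄¹, …, X̄ᵏ, Y¹, …, Yᵏ, X̄¹, …, X̄ᵏ, Z)`, where `X̄ʲ` is the block diagonal matrix of all
`Xˡ` with `l ≠ j`. -/
def boldSys {R : Type} [Zero R] {n q : Fin k → ℕ} {c : ℕ} (X : ∀ j, Matrix (Fin (n j)) (Fin (n j)) R)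
    (Y : ∀ j, Matrix (Fin (q j)) (Fin (q j)) R) (Z : Matrix (Fin c) (Fin c) R) :
    Matrix (Chan (IdxOffs n) (Idx q) (Fin c)) (Chan (IdxOffs n) (Idx q) (Fin c)) R :=
  diagChan (blockDiagonal' fun j => blockDiagonal' fun l : {l : Fin k // l ≠ j} => X l)
    (blockDiagonal' Y) Z

/-- The family of scalar matrices `ε j • I`. -/
def scalarBlocks (n : Fin k → ℕ) (ε : Fin k → ℝ) (j : Fin k) : Matrix (Fin (n j)) (Fin (n j)) ℂ :=
  (ε j : ℂ) • 1

/-- The weighted plant `P = 𝒱 N W` for environment abstraction. -/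
def weightedPlantEnv (S : TF (Fin pC ⊕ Idx m) (Fin mC ⊕ Idx p))
    (Sig : ∀ j, TF (Fin (p j)) (Fin (m j)))
    (VcE : ∀ j, TF (Fin (p j)) (Fin (p j))) (VcF : ∀ j, TF (Fin (m j)) (Fin (m j)))
    (VC : TF (Fin pC) (Fin pC))
    (WE : ∀ j, TF (Fin (m j)) (Fin (m j))) (WF : ∀ j, TF (Fin (p j)) (Fin (p j)))
    (WC : TF (Fin mC) (Fin mC)) :
    TF (Chan (Idx p) (Idx m) (Fin pC)) (Chan (Idx m) (Idx p) (Fin mC)) :=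
  boldEnv VcE VcF VC * plantEnv S Sig * boldEnv WE WF WC

/-- The weighted plant `P = 𝒱 N W` for subsystem abstraction. -/
def weightedPlantSys (S : TF (Fin pC ⊕ Idx m) (Fin mC ⊕ Idx p))
    (Sig : ∀ j, TF (Fin (p j)) (Fin (m j)))
    (VcA : ∀ j, TF (Fin (m j)) (Fin (m j))) (VcF : ∀ j, TF (Fin (m j)) (Fin (m j)))
    (VC : TF (Fin pC) (Fin pC))
    (WA : ∀ j, TF (Fin (p j)) (Fin (p j))) (WF : ∀ j, TF (Fin (p j)) (Fin (p j)))
    (WC : TF (Fin mC) (Fin mC)) :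
    TF (Chan (IdxOffs m) (Idx m) (Fin pC)) (Chan (IdxOffs p) (Idx p) (Fin mC)) :=
  boldSys VcA VcF VC * plantSys S Sig * boldSys WA WF WC

/-- The weight `V = ε 𝒱`. -/
def scaleTF {α β : Type} (ε : ℝ) (V : TF α β) : TF α β := (RatFunc.C (ε : ℂ)) • V

/-! ### Scaling matrices -/

/-- Index type of the sorted error channels: for every `j`, the copies (indexed by `c j`) of the
`j`-th abstraction error, then the reduction errors, then the external channel. -/
abbrev SortedIdx (c : Fin k → Type) (n q : Fin k → ℕ) (C : Type) : Type :=
  (((j : Fin k) × (c j × Fin (n j))) ⊕ Idx q) ⊕ C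

/-- `diag(S¹ ⊗ I, …, Sᵏ ⊗ I, d¹ I, …, dᵏ I, I)` on the sorted error channels. -/
def sortedScaling {c : Fin k → Type} {n q : Fin k → ℕ} {e : ℕ}
    (T : ∀ j, Matrix (c j) (c j) ℂ) (d : Fin k → ℝ) :
    Matrix (SortedIdx c n q (Fin e)) (SortedIdx c n q (Fin e)) ℂ :=
  fromBlocks
    (fromBlocks (blockDiagonal' fun j => T j ⊗ₖ (1 : Matrix (Fin (n j)) (Fin (n j)) ℂ)) 0 0
      (blockDiagonal' (scalarBlocks q d))) 0 0 1

/-- The sorting of the channels for environment abstraction: each abstraction error has two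
copies. -/
def sortEnv {n q : Fin k → ℕ} {e : ℕ} :
    Chan (Idx n) (Idx q) (Fin e) → SortedIdx (fun _ : Fin k => Fin 2) n q (Fin e) :=
  Sum.map
    (Sum.elim (fun x => Sum.inl ⟨x.1, (0, x.2)⟩)
      (Sum.elim Sum.inr fun x => Sum.inl ⟨x.1, (1, x.2)⟩)) id

/-- The sorting of the channels for subsystem abstraction: the abstraction error of subsystem `l`
has `2 (k - 1)` copies, two for each `j ≠ l`. -/
def sortSys {n q : Fin k → ℕ} {e : ℕ} :
    Chan (IdxOffs n) (Idx q) (Fin e) →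
      SortedIdx (fun l : Fin k => Fin 2 × {j : Fin k // j ≠ l}) n q (Fin e) :=
  Sum.map
    (Sum.elim (fun x => Sum.inl ⟨x.2.1.1, ((0, ⟨x.1, x.2.1.2.symm⟩), x.2.2)⟩)
      (Sum.elim Sum.inr fun x => Sum.inl ⟨x.2.1.1, ((1, ⟨x.1, x.2.1.2.symm⟩), x.2.2)⟩)) id

/-- The set of pairs of scaling matrices for environment abstraction. -/
def scalEnv (k pC mC : ℕ) (m p : Fin k → ℕ) :
    Set (Matrix (Chan (Idx p) (Idx m) (Fin pC)) (Chan (Idx p) (Idx m) (Fin pC)) ℂ ×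
      Matrix (Chan (Idx m) (Idx p) (Fin mC)) (Chan (Idx m) (Idx p) (Fin mC)) ℂ) :=
  {D | ∃ (T : Fin k → Matrix (Fin 2) (Fin 2) ℂ) (d : Fin k → ℝ),
    (∀ j, (T j).PosDef) ∧ (∀ j, 0 < d j) ∧
    D.1 = (sortedScaling T d).submatrix sortEnv sortEnv ∧
    D.2 = (sortedScaling T d).submatrix sortEnv sortEnv}

/-- The set of pairs of scaling matrices for subsystem abstraction. -/
def scalSys (k pC mC : ℕ) (m p : Fin k → ℕ) :
    Set (Matrix (Chan (IdxOffs m) (Idx m) (Fin pC)) (Chan (IdxOffs m) (Idx m) (Fin pC)) ℂ ×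
      Matrix (Chan (IdxOffs p) (Idx p) (Fin mC)) (Chan (IdxOffs p) (Idx p) (Fin mC)) ℂ) :=
  {D | ∃ (T : ∀ l : Fin k, Matrix (Fin 2 × {j : Fin k // j ≠ l}) (Fin 2 × {j : Fin k // j ≠ l}) ℂ)
      (d : Fin k → ℝ),
    (∀ l, (T l).PosDef) ∧ (∀ j, 0 < d j) ∧
    D.1 = (sortedScaling T d).submatrix sortSys sortSys ∧
    D.2 = (sortedScaling T d).submatrix sortSys sortSys}

/-! ### The optimization problem -/

/-- `ε P(iω) D_r P(iω)ᴴ ε ⪯ (1 - η) D_ℓ` for all real `ω`. -/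
def ScaledLMI {α β : Type} [Fintype α] [Fintype β] (η : ℝ) (ε : Matrix α α ℂ) (P : TF α β)
    (D : Matrix α α ℂ × Matrix β β ℂ) : Prop :=
  ∀ ω : ℝ,
    (((1 - η : ℝ) : ℂ) • D.1 - ε * freqResp P ω * D.2 * (freqResp P ω)ᴴ * ε).PosSemidef

/-- `ε` satisfies the constraints of the optimization problem (environment abstraction); `εE`,
`εF` are the diagonal entries of `ε`. -/
def FeasibleEnv (P : TF (Chan (Idx p) (Idx m) (Fin pC)) (Chan (Idx m) (Idx p) (Fin mC)))
    (εE εF : Fin k → ℝ) : Prop :=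
  (∀ j, 0 < εE j) ∧ (∀ j, 0 < εF j) ∧
    ∃ D ∈ scalEnv k pC mC m p, ScaledLMI 0 (boldEnv (scalarBlocks p εE) (scalarBlocks m εF) 1) P D

/-- `ε` satisfies the matrix inequality with a positive relative margin, uniform in the
frequency (environment abstraction). -/
def StrictlyFeasibleEnv (P : TF (Chan (Idx p) (Idx m) (Fin pC)) (Chan (Idx m) (Idx p) (Fin mC)))
    (εE εF : Fin k → ℝ) : Prop :=
  (∀ j, 0 < εE j) ∧ (∀ j, 0 < εF j) ∧
    ∃ D ∈ scalEnv k pC mC m p, ∃ η > 0,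
      ScaledLMI η (boldEnv (scalarBlocks p εE) (scalarBlocks m εF) 1) P D

/-- `ε` satisfies the constraints of the optimization problem (subsystem abstraction); `εA`,
`εF` are the diagonal entries of `ε`. -/
def FeasibleSys (P : TF (Chan (IdxOffs m) (Idx m) (Fin pC)) (Chan (IdxOffs p) (Idx p) (Fin mC)))
    (εA εF : Fin k → ℝ) : Prop :=
  (∀ j, 0 < εA j) ∧ (∀ j, 0 < εF j) ∧
    ∃ D ∈ scalSys k pC mC m p, ScaledLMI 0 (boldSys (scalarBlocks m εA) (scalarBlocks m εF) 1) P D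

/-- `ε` satisfies the matrix inequality with a positive relative margin, uniform in the
frequency (subsystem abstraction). -/
def StrictlyFeasibleSys
    (P : TF (Chan (IdxOffs m) (Idx m) (Fin pC)) (Chan (IdxOffs p) (Idx p) (Fin mC)))
    (εA εF : Fin k → ℝ) : Prop :=
  (∀ j, 0 < εA j) ∧ (∀ j, 0 < εF j) ∧
    ∃ D ∈ scalSys k pC mC m p, ∃ η > 0,
      ScaledLMI η (boldSys (scalarBlocks m εA) (scalarBlocks m εF) 1) P D

/-! ### Accuracy specifications -/

/-- The weighted error norm `‖W⁻¹ Δ V⁻¹‖_∞`. -/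
def weightedNorm {a b : ℕ} (W : TF (Fin a) (Fin a)) (V : TF (Fin b) (Fin b))
    (Δ : TF (Fin a) (Fin b)) : ENNReal :=
  hinfNorm (W⁻¹ * Δ * V⁻¹)

/-- The high-level specification `E_C ∈ RH∞`, `‖V_C E_C W_C‖_∞ < 1`. -/
def HighLevelSpec (VC : TF (Fin pC) (Fin pC)) (WC : TF (Fin mC) (Fin mC))
    (E : TF (Fin pC) (Fin mC)) : Prop :=
  RHinf E ∧ hinfNorm (VC * E * WC) < 1

/-- The reduced interconnected model is well-posed and internally stable, in particular in
`RH∞`, and its error satisfies the high-level specification. -/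
def ReducedModelCertified (S : TF (Fin pC ⊕ Idx m) (Fin mC ⊕ Idx p))
    (Sig SigR : ∀ j, TF (Fin (p j)) (Fin (m j)))
    (VC : TF (Fin pC) (Fin pC)) (WC : TF (Fin mC) (Fin mC)) : Prop :=
  LftWellPosed S (parB SigR) ∧ LftInternallyStable S (parB SigR) ∧ RHinf (llft S (parB SigR)) ∧
    HighLevelSpec VC WC (errC S Sig SigR)

end Systems

end

noncomputable section

/-! ### Stable proper rational functions -/

/-! The error `E_C` is the upper feedback of the plant `N` with the block diagonal uncertainty `Δ =
diag(Δ_A, Δ_F, Δ_A)`, where `Δ_F` is the normalized reduction error and `Δ_A` the abstraction error.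
The theorem is thus a scaled small gain theorem for this loop, plus an algebraic argument that the
loop really describes the reduced interconnection.

Small gain: factor the scalings as `D_ℓ = Q_ℓ Q_ℓᴴ`, `D_r = Q_r Q_rᴴ`. At every frequency the matrix
inequality says `‖Q_ℓ⁻¹ V N W Q_r‖ ≤ √(1 - η)`. The factors inherit the Kronecker structure of the
scalings, so they intertwine with the weighted repeated uncertainty, `Q_r Δ = Δ Q_ℓ`
(`exists_scaling_factors`), whose norm therefore stays at most `d`. The non-tightness assumption
supplies `√(1 - η) d < 1` (`exists_margin`). Phragmén–Lindelöf carries both bounds from the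
imaginary axis to the closed right half plane (`opNorm_evalMat_le_of_imaginary`). There `I - N₁₁Δ`
is nonsingular with uniformly bounded inverse, so the inverse is stable and proper (`smallGain`).
Because the external block of `N` vanishes, the performance channel has norm at most `√(1 - η) d`,
strictly below one even when the matrix inequality is tight (`opNorm_performance_le`).

Algebra: well-posedness of the reduced interconnection is not assumed, so it cannot be used to
derive the loop equations. The argument runs backwards: a solution of the loop equations is shown to
produce a matrix `ζ` with `(I - S₂₂Σ̂)(I + S₂₂ζ) = I` and `Σ̂(I - S₂₂Σ̂)⁻¹ = ζ`
(`reduced_loop_of_solution`). Small gain provides such a solution, with `ζ` in `RH∞`;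
well-posedness, internal stability and the formula for `E_C` follow (`certified_of_plant`).
Subsystem abstraction reduces to the same statement by eliminating the inner loops through the
subsystem errors (`solution_of_extended_solution`, `env_sub_env`). -/

lemma isProperRat_iff_intDegree (f : RatFunc ℂ) : IsProperRat f ↔ f.intDegree ≤ 0 := by
  unfold IsProperRat RatFunc.intDegree
  omega

/-- The ring of stable rational functions. -/
def stableSubring : Subring (RatFunc ℂ) where
  carrier := {f | IsStableRat f}
  mul_mem' {f g} hf hg z hz := by
    have h := Polynomial.eval_eq_zero_of_dvd_of_eval_eq_zero (RatFunc.denom_mul_dvd f g) hz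
    rw [Polynomial.eval_mul, mul_eq_zero] at h
    exact h.elim (hf z) (hg z)
  one_mem' z hz := by simp at hz
  add_mem' {f g} hf hg z hz := by
    have h := Polynomial.eval_eq_zero_of_dvd_of_eval_eq_zero (RatFunc.denom_add_dvd f g) hz
    rw [Polynomial.eval_mul, mul_eq_zero] at h
    exact h.elim (hf z) (hg z)
  zero_mem' z hz := by simp at hz
  neg_mem' {f} hf z hz := by
    rw [← neg_one_mul, ← map_one (RatFunc.C (K := ℂ)), ← map_neg] at hz
    have h := Polynomial.eval_eq_zero_of_dvd_of_eval_eq_zero (RatFunc.denom_mul_dvd _ f) hz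
    rw [Polynomial.eval_mul, mul_eq_zero, RatFunc.denom_C] at h
    exact h.elim (fun h => by simp at h) (hf z)

/-- The ring of proper rational functions. -/
def properSubring : Subring (RatFunc ℂ) where
  carrier := {f | IsProperRat f}
  mul_mem' {f g} hf hg := by
    simp only [Set.mem_ofPred_eq, isProperRat_iff_intDegree] at *
    by_cases h0 : f = 0
    · simp [h0]
    by_cases h1 : g = 0
    · simp [h1]
    rw [RatFunc.intDegree_mul h0 h1]
    omega
  one_mem' := by simp [isProperRat_iff_intDegree]
  add_mem' {f g} hf hg := by
    simp only [Set.mem_ofPred_eq, isProperRat_iff_intDegree] at *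
    by_cases h1 : g = 0
    · simpa [h1] using hf
    by_cases h0 : f + g = 0
    · simp [h0]
    exact (RatFunc.intDegree_add_le h1 h0).trans (max_le hf hg)
  zero_mem' := by simp [isProperRat_iff_intDegree]
  neg_mem' {f} hf := by
    simpa [isProperRat_iff_intDegree] using hf

/-- The ring of stable and proper rational functions with complex coefficients. -/
def stableProper : Subring (RatFunc ℂ) := stableSubring ⊓ properSubring

/-- Complex constants are admitted because test vectors and scaling factors are complex. The
analysis runs over this ring, and real rationality is recovered separately by algebra. -/
lemma C_mem_stableProper (c : ℂ) : RatFunc.C c ∈ stableProper :=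
  ⟨fun z hz => by simp at hz, (isProperRat_iff_intDegree _).2 (by simp)⟩

/-- Evaluation of a rational function at a complex number. -/
abbrev evalAt (z : ℂ) (f : RatFunc ℂ) : ℂ := RatFunc.eval (RingHom.id ℂ) z f

lemma evalAt_eq (z : ℂ) (f : RatFunc ℂ) : evalAt z f = f.num.eval z / f.denom.eval z := rfl

lemma denom_eval_ne_zero {f : RatFunc ℂ} (hf : f ∈ stableSubring) {z : ℂ} (hz : 0 ≤ z.re) :
    f.denom.eval z ≠ 0 := fun h => absurd (hf z h) (not_lt.2 hz)

/-- Evaluation of stable rational functions at a point of the closed right half plane. -/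
def stableEval {z : ℂ} (hz : 0 ≤ z.re) : stableSubring →+* ℂ where
  toFun f := evalAt z f
  map_one' := RatFunc.eval_one _ _
  map_mul' f g := RatFunc.eval_mul _ _ (denom_eval_ne_zero f.2 hz) (denom_eval_ne_zero g.2 hz)
  map_zero' := RatFunc.eval_zero _ _
  map_add' f g := RatFunc.eval_add _ _ (denom_eval_ne_zero f.2 hz) (denom_eval_ne_zero g.2 hz)

/-- A pole of the inverse is a zero of the numerator of `f`. -/
lemma inv_mem_stableSubring {f : RatFunc ℂ}
    (h : ∀ z : ℂ, 0 ≤ z.re → evalAt z f ≠ 0) : f⁻¹ ∈ stableSubring := by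
  intro z hz
  by_contra hre
  have h1 := h z (not_lt.1 hre)
  by_cases h0 : f = 0
  · simp [h0] at h1
  have h2 := Polynomial.eval_eq_zero_of_dvd_of_eval_eq_zero (RatFunc.denom_inv_dvd h0) hz
  exact h1 (by rw [evalAt_eq, h2, zero_div])

open Filter Bornology Topology in
-- The quotient is the reversed polynomial evaluated at `z⁻¹`, which is continuous at `0`.
lemma Polynomial.tendsto_eval_div_pow_cobounded (p : Polynomial ℂ) :
    Tendsto (fun z => p.eval z / z ^ p.natDegree) (cobounded ℂ) (𝓝 p.leadingCoeff) := by
  have h1 : Tendsto (fun z : ℂ => p.reverse.eval z⁻¹) (cobounded ℂ) (𝓝 (p.reverse.eval 0)) :=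
    (p.reverse.continuous.tendsto 0).comp tendsto_inv₀_cobounded
  rw [← Polynomial.coeff_zero_eq_eval_zero, Polynomial.coeff_zero_reverse] at h1
  refine h1.congr' ?_
  have h0 : ∀ᶠ z : ℂ in cobounded ℂ, z ≠ 0 := isBounded_singleton (x := (0 : ℂ))
  filter_upwards [h0] with z hz
  have : Invertible z := invertibleOfNonzero hz
  have h2 := Polynomial.eval₂_reverse_mul_pow (RingHom.id ℂ) z p
  rw [invOf_eq_inv] at h2
  rw [eq_div_iff (pow_ne_zero _ hz)]
  exact h2

open Filter Bornology Topology in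
-- The limit is nonzero for `f ≠ 0`, so `intDegree` is the exact growth order at infinity. This
-- links properness to boundedness in both directions.
lemma tendsto_evalAt_mul_zpow (f : RatFunc ℂ) :
    Tendsto (fun z => evalAt z f * z ^ (-f.intDegree)) (cobounded ℂ)
      (𝓝 (f.num.leadingCoeff / f.denom.leadingCoeff)) := by
  have h1 := f.num.tendsto_eval_div_pow_cobounded.div f.denom.tendsto_eval_div_pow_cobounded
    (by simp [RatFunc.denom_ne_zero])
  refine h1.congr' ?_
  have h0 : ∀ᶠ z : ℂ in cobounded ℂ, z ≠ 0 := isBounded_singleton (x := (0 : ℂ))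
  filter_upwards [h0] with z hz
  simp only [Pi.div_apply]
  rw [evalAt_eq, RatFunc.intDegree, neg_sub, zpow_sub₀ hz, zpow_natCast, zpow_natCast]
  have := pow_ne_zero f.num.natDegree hz
  have := pow_ne_zero f.denom.natDegree hz
  by_cases hd : f.denom.eval z = 0
  · simp [hd]
  · field_simp

open Filter Bornology Topology in
lemma isBigO_evalAt_of_isProperRat {f : RatFunc ℂ} (hf : IsProperRat f) :
    (fun z => evalAt z f) =O[cobounded ℂ] (fun _ => (1 : ℝ)) := by
  rw [isProperRat_iff_intDegree] at hf
  have h1 := (tendsto_evalAt_mul_zpow f).isBigO_one ℝ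
  refine Asymptotics.IsBigO.trans ?_ h1
  rw [Asymptotics.isBigO_iff]
  refine ⟨1, ?_⟩
  have h0 : ∀ᶠ z : ℂ in cobounded ℂ, 1 ≤ ‖z‖ :=
    tendsto_norm_cobounded_atTop.eventually_ge_atTop 1
  filter_upwards [h0] with z hz
  rw [norm_mul, norm_zpow, one_mul]
  exact le_mul_of_one_le_right (norm_nonneg _) (one_le_zpow₀ hz (by omega))

open Filter Bornology Topology in
lemma tendsto_ofReal_cobounded : Tendsto (fun x : ℝ => (x : ℂ)) atTop (cobounded ℂ) := by
  rw [← tendsto_norm_atTop_iff_cobounded]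
  simpa using tendsto_abs_atTop_atTop

open Filter Bornology Topology in
-- With positive degree, boundedness would force `f(x) x^(-deg f)` to tend to `0`, against its
-- nonzero limit.
lemma isProperRat_of_bounded {f : RatFunc ℂ} {C : ℝ}
    (h : ∀ x : ℝ, 0 ≤ x → ‖evalAt x f‖ ≤ C) : IsProperRat f := by
  rw [isProperRat_iff_intDegree]
  by_contra hd
  push Not at hd
  have hf : f ≠ 0 := by rintro rfl; simp at hd
  have h1 := ((tendsto_evalAt_mul_zpow f).comp tendsto_ofReal_cobounded).norm
  have h2 : Tendsto (fun x : ℝ => C * ‖(x : ℂ)‖⁻¹) atTop (𝓝 (C * 0)) := by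
    refine Tendsto.const_mul _ ?_
    refine tendsto_inv_atTop_zero.comp ?_
    exact tendsto_norm_cobounded_atTop.comp tendsto_ofReal_cobounded
  have h3 := le_of_tendsto_of_tendsto h1 h2 (by
    filter_upwards [eventually_ge_atTop 1] with x hx
    simp only [Function.comp, norm_mul, norm_zpow]
    have hC := h x (by linarith)
    have hx' : 1 ≤ ‖(x : ℂ)‖ := by simpa using hx.trans (le_abs_self x)
    have : ‖(x : ℂ)‖ ^ (-f.intDegree) ≤ ‖(x : ℂ)‖⁻¹ := by
      rw [← _root_.zpow_neg_one]
      exact zpow_le_zpow_right₀ hx' (by omega)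
    exact mul_le_mul hC this (by positivity) ((norm_nonneg _).trans hC))
  rw [mul_zero] at h3
  have h4 := norm_le_zero_iff.1 h3
  rw [div_eq_zero_iff] at h4
  simp [hf, RatFunc.denom_ne_zero] at h4

open Filter Bornology Topology in
/-- The maximum principle for stable proper rational functions on the right half plane. -/
lemma norm_evalAt_le_of_imaginary {f : RatFunc ℂ} (hf : f ∈ stableProper) {C : ℝ}
    (h : ∀ ω : ℝ, ‖evalAt (Complex.I * ω) f‖ ≤ C) {z : ℂ} (hz : 0 ≤ z.re) : ‖evalAt z f‖ ≤ C := by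
  have hO := isBigO_evalAt_of_isProperRat hf.2
  -- Properness makes `f` bounded near infinity, so the growth condition holds with exponent `0` and
  -- constant `0`, the comparison function being `exp 0 = 1`.
  refine PhragmenLindelof.right_half_plane_of_bounded_on_real (f := fun z => evalAt z f)
    ?_ ⟨0, by norm_num, 0, ?_⟩ ?_ (fun x => by simpa [mul_comm] using h x) hz
  · have hd : DifferentiableOn ℂ (fun z => evalAt z f) {z | 0 ≤ z.re} := by
      intro w hw
      simp only [evalAt_eq]
      exact (f.num.differentiable.differentiableAt.div f.denom.differentiable.differentiableAt
        (denom_eval_ne_zero hf.1 hw)).differentiableWithinAt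
    refine DifferentiableOn.diffContOnCl ?_
    rwa [Complex.closure_setOfPred_lt_re]
  · simpa using hO.mono inf_le_left
  · have h1 := hO.comp_tendsto tendsto_ofReal_cobounded
    exact ((Asymptotics.isBigO_one_iff ℝ).1 h1)

/-! ### Real rational functions -/

/-- The field of rational functions with real coefficients. -/
def realRational : Subfield (RatFunc ℂ) where
  carrier := {f | IsRealRational f}
  mul_mem' := by
    rintro _ _ ⟨a, b, hb, rfl⟩ ⟨c, d, hd, rfl⟩
    refine ⟨a * c, b * d, mul_ne_zero hb hd, ?_⟩
    simp only [Polynomial.map_mul, map_mul]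
    rw [div_mul_div_comm]
  one_mem' := ⟨1, 1, one_ne_zero, by simp⟩
  add_mem' := by
    rintro _ _ ⟨a, b, hb, rfl⟩ ⟨c, d, hd, rfl⟩
    refine ⟨a * d + b * c, b * d, mul_ne_zero hb hd, ?_⟩
    have inj : ∀ q : Polynomial ℝ, q ≠ 0 →
        algebraMap (Polynomial ℂ) (RatFunc ℂ) (q.map Complex.ofRealHom) ≠ 0 := fun q hq => by
      simpa [Polynomial.map_eq_zero] using hq
    simp only [Polynomial.map_mul, Polynomial.map_add, map_mul, map_add]
    rw [div_add_div _ _ (inj b hb) (inj d hd)]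
  zero_mem' := ⟨0, 1, one_ne_zero, by simp⟩
  neg_mem' := by
    rintro _ ⟨a, b, hb, rfl⟩
    exact ⟨-a, b, hb, by rw [Polynomial.map_neg, map_neg]; exact (_root_.neg_div _ _).symm⟩
  inv_mem' := by
    rintro _ ⟨a, b, hb, rfl⟩
    by_cases ha : a = 0
    · exact ⟨0, 1, one_ne_zero, by simp [ha]⟩
    · exact ⟨b, a, ha, by rw [inv_div]⟩

/-- The ring of scalar `RH∞` functions. -/
def rhSubring : Subring (RatFunc ℂ) := realRational.toSubring ⊓ stableProper

/-! ### Matrices with entries in a subring -/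

/-- All entries of `G` lie in the subring `R`. -/
def EntriesIn {K : Type*} [Ring K] {α β : Type*} (R : Subring K) (G : Matrix α β K) : Prop :=
  ∀ i j, G i j ∈ R

namespace EntriesIn

variable {K : Type*} [CommRing K] {α β γ δ : Type*} {R R' : Subring K}

lemma mono (h : R ≤ R') {G : Matrix α β K} (hG : EntriesIn R G) : EntriesIn R' G :=
  fun i j => h (hG i j)

lemma zero : EntriesIn R (0 : Matrix α β K) := fun _ _ => R.zero_mem

lemma one [DecidableEq α] : EntriesIn R (1 : Matrix α α K) := fun i j => by
  rw [Matrix.one_apply]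
  split_ifs
  exacts [R.one_mem, R.zero_mem]

lemma add {G H : Matrix α β K} (hG : EntriesIn R G) (hH : EntriesIn R H) : EntriesIn R (G + H) :=
  fun i j => R.add_mem (hG i j) (hH i j)

lemma sub {G H : Matrix α β K} (hG : EntriesIn R G) (hH : EntriesIn R H) : EntriesIn R (G - H) :=
  fun i j => R.sub_mem (hG i j) (hH i j)

lemma neg {G : Matrix α β K} (hG : EntriesIn R G) : EntriesIn R (-G) :=
  fun i j => R.neg_mem (hG i j)

lemma mul [Fintype β] {G : Matrix α β K} {H : Matrix β γ K} (hG : EntriesIn R G)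
    (hH : EntriesIn R H) : EntriesIn R (G * H) :=
  fun i j => R.sum_mem fun l _ => R.mul_mem (hG i l) (hH l j)

lemma submatrix {G : Matrix α β K} (hG : EntriesIn R G) (f : γ → α) (g : δ → β) :
    EntriesIn R (G.submatrix f g) := fun i j => hG (f i) (g j)

lemma fromBlocks {A : Matrix α γ K} {B : Matrix α δ K} {C : Matrix β γ K} {D : Matrix β δ K}
    (hA : EntriesIn R A) (hB : EntriesIn R B) (hC : EntriesIn R C) (hD : EntriesIn R D) :
    EntriesIn R (Matrix.fromBlocks A B C D) := by
  rintro (i | i) (j | j)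
  exacts [hA i j, hB i j, hC i j, hD i j]

lemma fromRows {A : Matrix α γ K} {B : Matrix β γ K} (hA : EntriesIn R A) (hB : EntriesIn R B) :
    EntriesIn R (Matrix.fromRows A B) := by
  rintro (i | i) j
  exacts [hA i j, hB i j]

lemma fromCols {A : Matrix α γ K} {B : Matrix α δ K} (hA : EntriesIn R A) (hB : EntriesIn R B) :
    EntriesIn R (Matrix.fromCols A B) := by
  rintro i (j | j)
  exacts [hA i j, hB i j]

lemma blockDiagonal' {ι : Type*} [DecidableEq ι] {a b : ι → Type*} {G : ∀ i, Matrix (a i) (b i) K}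
    (hG : ∀ i, EntriesIn R (G i)) : EntriesIn R (Matrix.blockDiagonal' G) := by
  rintro ⟨i, x⟩ ⟨j, y⟩
  rw [Matrix.blockDiagonal'_apply]
  split_ifs with h
  exacts [hG _ _ _, R.zero_mem]

lemma toBlocks₁₁ {G : Matrix (α ⊕ β) (γ ⊕ δ) K} (hG : EntriesIn R G) : EntriesIn R G.toBlocks₁₁ :=
  fun _ _ => hG _ _

lemma toBlocks₁₂ {G : Matrix (α ⊕ β) (γ ⊕ δ) K} (hG : EntriesIn R G) : EntriesIn R G.toBlocks₁₂ :=
  fun _ _ => hG _ _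

lemma toBlocks₂₁ {G : Matrix (α ⊕ β) (γ ⊕ δ) K} (hG : EntriesIn R G) : EntriesIn R G.toBlocks₂₁ :=
  fun _ _ => hG _ _

lemma toBlocks₂₂ {G : Matrix (α ⊕ β) (γ ⊕ δ) K} (hG : EntriesIn R G) : EntriesIn R G.toBlocks₂₂ :=
  fun _ _ => hG _ _

lemma det [Fintype α] [DecidableEq α] {G : Matrix α α K} (hG : EntriesIn R G) : G.det ∈ R := by
  rw [Matrix.det_apply]
  exact R.sum_mem fun σ _ => R.toAddSubgroup.zsmul_mem (R.prod_mem fun i _ => hG _ _) _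

lemma adjugate [Fintype α] [DecidableEq α] {G : Matrix α α K} (hG : EntriesIn R G) :
    EntriesIn R G.adjugate := by
  intro i j
  rw [Matrix.adjugate_apply]
  refine det fun a b => ?_
  rw [Matrix.updateRow_apply]
  split_ifs
  · rw [Pi.single_apply]
    split_ifs
    exacts [R.one_mem, R.zero_mem]
  · exact hG a b

end EntriesIn

/-- Cramer's rule stays inside a subfield, so real rationality of a closed loop needs no analysis.
-/
lemma EntriesIn.inv {K : Type*} [Field K] {α : Type*} [Fintype α] [DecidableEq α] {F : Subfield K}
    {G : Matrix α α K} (hG : EntriesIn F.toSubring G) : EntriesIn F.toSubring G⁻¹ := by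
  intro i j
  rw [Matrix.inv_def, Ring.inverse_eq_inv', Matrix.smul_apply, smul_eq_mul]
  exact F.mul_mem (F.inv_mem hG.det) (hG.adjugate i j)

lemma rhInf_iff {α β : Type} {G : TF α β} : RHinf G ↔ EntriesIn rhSubring G := by
  refine forall₂_congr fun i j => ?_
  exact ⟨fun h => ⟨h.1, h.2.2, h.2.1⟩, fun h => ⟨h.1, h.2.2, h.2.1⟩⟩

lemma EntriesIn.properRR {α β : Type} {G : TF α β} (hG : EntriesIn rhSubring G) : ProperRR G :=
  fun i j => ⟨(hG i j).1, (hG i j).2.2⟩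

lemma rhSubring_le_stableProper : rhSubring ≤ stableProper := inf_le_right

lemma rhSubring_le_realRational : rhSubring ≤ realRational.toSubring := inf_le_left

lemma entriesIn_constTF {α β : Type} (A : Matrix α β ℂ) : EntriesIn stableProper (constTF A) :=
  fun _ _ => C_mem_stableProper _

/-! ### Evaluation of transfer function matrices -/

/-- The value of a transfer function matrix at a complex number. -/
def evalMat {α β : Type} (z : ℂ) (G : TF α β) : Matrix α β ℂ := G.map (evalAt z)

lemma freqResp_eq_evalMat {α β : Type} (G : TF α β) (ω : ℝ) :
    freqResp G ω = evalMat (Complex.I * ω) G := rfl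

section evalMat

variable {α β γ δ : Type} {z : ℂ}

lemma evalMat_mul [Fintype β] (hz : 0 ≤ z.re) {G : TF α β} {H : TF β γ}
    (hG : EntriesIn stableSubring G) (hH : EntriesIn stableSubring H) :
    evalMat z (G * H) = evalMat z G * evalMat z H := by
  ext i j
  have h := map_sum (stableEval hz)
    (fun l => (⟨G i l, hG i l⟩ * ⟨H l j, hH l j⟩ : stableSubring)) Finset.univ
  simp only [map_mul] at h
  have h1 : (G * H) i j =
      ((∑ l, (⟨G i l, hG i l⟩ * ⟨H l j, hH l j⟩ : stableSubring) : stableSubring) : RatFunc ℂ) := by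
    simp [Matrix.mul_apply]
  rw [evalMat, Matrix.map_apply, h1, Matrix.mul_apply]
  exact h

lemma evalMat_sub (hz : 0 ≤ z.re) {G H : TF α β}
    (hG : EntriesIn stableSubring G) (hH : EntriesIn stableSubring H) :
    evalMat z (G - H) = evalMat z G - evalMat z H := by
  ext i j
  exact map_sub (stableEval hz) ⟨G i j, hG i j⟩ ⟨H i j, hH i j⟩

@[simp] lemma evalMat_one [DecidableEq α] : evalMat z (1 : TF α α) = 1 := by
  simp [evalMat, Matrix.map_one]

@[simp] lemma evalMat_zero : evalMat z (0 : TF α β) = 0 := by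
  simp [evalMat, Matrix.map_zero]

@[simp] lemma evalMat_constTF (A : Matrix α β ℂ) : evalMat z (constTF A) = A := by
  ext i j
  simp [evalMat, constTF]

lemma evalMat_fromBlocks {A : TF α γ} {B : TF α δ} {C : TF β γ} {D : TF β δ} :
    evalMat z (fromBlocks A B C D) =
      fromBlocks (evalMat z A) (evalMat z B) (evalMat z C) (evalMat z D) :=
  fromBlocks_map ..

lemma evalMat_blockDiagonal' {ι : Type} [DecidableEq ι] {a b : ι → Type}
    {G : ∀ i, TF (a i) (b i)} :
    evalMat z (blockDiagonal' G) = blockDiagonal' fun i => evalMat z (G i) :=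
  blockDiagonal'_map _ _ (RatFunc.eval_zero _ _)

/-- Evaluation is a ring homomorphism only on stable functions, so the matrix is first lifted to
that subring. -/
lemma evalMat_det [Fintype α] [DecidableEq α] (hz : 0 ≤ z.re) {G : TF α α}
    (hG : EntriesIn stableSubring G) : evalAt z G.det = (evalMat z G).det := by
  let G' : Matrix α α stableSubring := fun i j => ⟨G i j, hG i j⟩
  have h1 : G = G'.map stableSubring.subtype := rfl
  have h2 : G.det = (G'.det : RatFunc ℂ) := by
    conv_lhs => rw [h1]
    exact (RingHom.map_det stableSubring.subtype G').symm
  rw [h2]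
  exact RingHom.map_det (stableEval hz) G'

end evalMat

/-! ### Spectral norm estimates -/

/-- The Euclidean norm of a vector. -/
abbrev eNorm {α : Type*} [Fintype α] (x : α → ℂ) : ℝ := ‖WithLp.toLp 2 x‖

section Norms

variable {α β γ δ : Type*} [Fintype α] [Fintype β] [Fintype γ] [Fintype δ]

lemma eNorm_sq (x : α → ℂ) : eNorm x ^ 2 = ∑ i, ‖x i‖ ^ 2 := EuclideanSpace.norm_sq_eq _

lemma norm_star_dotProduct_le (x y : α → ℂ) : ‖star x ⬝ᵥ y‖ ≤ eNorm x * eNorm y := by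
  have h := norm_inner_le_norm (𝕜 := ℂ) (WithLp.toLp 2 x) (WithLp.toLp 2 y)
  rwa [EuclideanSpace.inner_toLp_toLp, dotProduct_comm] at h

lemma star_dotProduct_self (x : α → ℂ) : star x ⬝ᵥ x = ((eNorm x ^ 2 : ℝ) : ℂ) := by
  rw [eNorm_sq, dotProduct, Complex.ofReal_sum]
  refine Finset.sum_congr rfl fun i _ => ?_
  rw [Pi.star_apply, RCLike.star_def, Complex.conj_mul', Complex.ofReal_pow]

lemma eNorm_add_le (x y : α → ℂ) : eNorm (x + y) ≤ eNorm x + eNorm y := by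
  rw [eNorm, WithLp.toLp_add]
  exact norm_add_le _ _

lemma eNorm_sumElim_sq (x : α → ℂ) (y : β → ℂ) :
    eNorm (Sum.elim x y) ^ 2 = eNorm x ^ 2 + eNorm y ^ 2 := by
  simp [eNorm_sq]

lemma eNorm_mulVec_le [DecidableEq β] (A : Matrix α β ℂ) (x : β → ℂ) :
    eNorm (A *ᵥ x) ≤ ‖A‖ * eNorm x :=
  A.l2_opNorm_mulVec (WithLp.toLp 2 x)

lemma opNorm_le_of_eNorm [DecidableEq β] {A : Matrix α β ℂ} {c : ℝ} (hc : 0 ≤ c)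
    (h : ∀ x, eNorm (A *ᵥ x) ≤ c * eNorm x) : ‖A‖ ≤ c := by
  rw [l2_opNorm_def]
  exact ContinuousLinearMap.opNorm_le_bound _ hc fun x => h x.ofLp

lemma norm_entry_le_opNorm [DecidableEq β] (A : Matrix α β ℂ) (i : α) (j : β) :
    ‖A i j‖ ≤ ‖A‖ := by
  have h := eNorm_mulVec_le A (Pi.single j 1)
  have h1 : eNorm (Pi.single j 1 : β → ℂ) = 1 := by
    change ‖EuclideanSpace.single j (1 : ℂ)‖ = 1
    simp
  rw [h1, mul_one] at h
  refine le_trans ?_ h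
  have h2 := PiLp.norm_apply_le (WithLp.toLp 2 (A *ᵥ Pi.single j 1)) i
  simpa using h2

lemma opNorm_fromBlocks_diag_le [DecidableEq β] [DecidableEq δ] {A : Matrix α β ℂ}
    {B : Matrix γ δ ℂ} {c : ℝ} (hA : ‖A‖ ≤ c) (hB : ‖B‖ ≤ c) : ‖fromBlocks A 0 0 B‖ ≤ c := by
  have hc : 0 ≤ c := (norm_nonneg _).trans hA
  refine opNorm_le_of_eNorm hc fun x => ?_
  rw [← sq_le_sq₀ (by positivity) (by positivity), mul_pow]
  obtain ⟨y, z, rfl⟩ : ∃ y z, x = Sum.elim y z := ⟨x ∘ Sum.inl, x ∘ Sum.inr, by simp⟩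
  rw [fromBlocks_mulVec, eNorm_sumElim_sq, eNorm_sumElim_sq]
  simp only [Sum.elim_comp_inl, Sum.elim_comp_inr, zero_mulVec, add_zero, zero_add]
  have h1 := (eNorm_mulVec_le A y).trans (mul_le_mul_of_nonneg_right hA (norm_nonneg _))
  have h2 := (eNorm_mulVec_le B z).trans (mul_le_mul_of_nonneg_right hB (norm_nonneg _))
  have h3 := pow_le_pow_left₀ (norm_nonneg _) h1 2
  have h4 := pow_le_pow_left₀ (norm_nonneg _) h2 2
  rw [mul_pow] at h3 h4
  linarith

lemma opNorm_blockDiagonal'_le {ι : Type*} [Fintype ι] [DecidableEq ι] {a b : ι → Type*}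
    [∀ i, Fintype (a i)] [∀ i, Fintype (b i)] [∀ i, DecidableEq (b i)]
    {A : ∀ i, Matrix (a i) (b i) ℂ} {c : ℝ} (hc : 0 ≤ c) (hA : ∀ i, ‖A i‖ ≤ c) :
    ‖blockDiagonal' A‖ ≤ c := by
  refine opNorm_le_of_eNorm hc fun x => ?_
  rw [← sq_le_sq₀ (by positivity) (by positivity), mul_pow]
  have h0 : ∀ i s, (blockDiagonal' A *ᵥ x) ⟨i, s⟩ = (A i *ᵥ fun t => x ⟨i, t⟩) s := by
    intro i s
    simp only [mulVec, dotProduct, Fintype.sum_sigma]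
    rw [Finset.sum_eq_single i]
    · simp
    · intro j _ hj
      refine Finset.sum_eq_zero fun t _ => ?_
      rw [blockDiagonal'_apply_ne _ _ _ hj.symm, zero_mul]
    · simp
  rw [eNorm_sq, eNorm_sq, Fintype.sum_sigma, Fintype.sum_sigma, Finset.mul_sum]
  refine Finset.sum_le_sum fun i _ => ?_
  simp only [h0]
  rw [← eNorm_sq, ← eNorm_sq (fun t => x ⟨i, t⟩), ← mul_pow]
  refine pow_le_pow_left₀ (norm_nonneg _) ?_ 2
  exact (eNorm_mulVec_le _ _).trans (mul_le_mul_of_nonneg_right (hA i) (norm_nonneg _))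

end Norms

/-- The maximum principle for stable proper transfer function matrices. -/
lemma opNorm_evalMat_le_of_imaginary {α β : Type} [Fintype α] [Fintype β] [DecidableEq β]
    {G : TF α β} (hG : EntriesIn stableProper G) {C : ℝ} (h : ∀ ω, ‖freqResp G ω‖ ≤ C)
    {z : ℂ} (hz : 0 ≤ z.re) : ‖evalMat z G‖ ≤ C := by
  have hC : 0 ≤ C := (norm_nonneg _).trans (h 0)
  refine opNorm_le_of_eNorm hC fun x => ?_
  set y := evalMat z G *ᵥ x with hy
  -- The scalar maximum principle is applied to `w ↦ yᴴ G(w) x` with `y = G(z) x` frozen; at `w = z`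
  -- its value is `‖y‖²`.
  let f : TF Unit Unit := constTF (replicateRow Unit (star y)) * G * constTF (replicateCol Unit x)
  have hGs : EntriesIn stableSubring G := hG.mono inf_le_left
  have hf : EntriesIn stableProper f := ((entriesIn_constTF _).mul hG).mul (entriesIn_constTF _)
  have hfe : ∀ w : ℂ, 0 ≤ w.re → evalAt w (f () ()) = star y ⬝ᵥ (evalMat w G *ᵥ x) := by
    intro w hw
    have h1 : evalMat w f = replicateRow Unit (star y) * evalMat w G * replicateCol Unit x := by
      rw [evalMat_mul hw (((entriesIn_constTF _).mono inf_le_left).mul hGs)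
        ((entriesIn_constTF _).mono inf_le_left), evalMat_mul hw
        ((entriesIn_constTF _).mono inf_le_left) hGs, evalMat_constTF, evalMat_constTF]
    have h2 := congrFun (congrFun h1 ()) ()
    rw [Matrix.mul_assoc, ← replicateCol_mulVec] at h2
    exact h2
  have hb := norm_evalAt_le_of_imaginary (hf () ()) (C := C * eNorm x * eNorm y) (fun ω => by
    rw [hfe _ (by simp)]
    refine (norm_star_dotProduct_le _ _).trans ?_
    rw [mul_comm]
    refine mul_le_mul_of_nonneg_right ?_ (norm_nonneg _)
    exact (eNorm_mulVec_le _ _).trans (mul_le_mul_of_nonneg_right (h ω) (norm_nonneg _))) hz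
  rw [hfe z hz, ← hy, star_dotProduct_self, Complex.norm_real, Real.norm_of_nonneg (sq_nonneg _),
    sq] at hb
  rcases (show 0 ≤ eNorm y from norm_nonneg _).eq_or_lt with h0 | h0
  · rw [← h0]
    positivity
  · exact le_of_mul_le_mul_right hb h0

/-! ### The small gain theorem with performance channel -/

section PointwiseGain

variable {α β γ δ : Type*} [Fintype α] [Fintype β] [Fintype γ] [Fintype δ]
  [DecidableEq α] [DecidableEq β] [DecidableEq δ]
  {G : Matrix (α ⊕ γ) (β ⊕ δ) ℂ} {D : Matrix β α ℂ} {a d : ℝ}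

omit [DecidableEq α] in
-- The energy balance of the plant: total output energy is at most `a²` times total input energy.
lemma eNorm_loop_le (hG : ‖G‖ ≤ a) (w : β → ℂ) (u : δ → ℂ) :
    eNorm (G.toBlocks₁₁ *ᵥ w + G.toBlocks₁₂ *ᵥ u) ^ 2 +
      eNorm (G.toBlocks₂₁ *ᵥ w + G.toBlocks₂₂ *ᵥ u) ^ 2 ≤ a ^ 2 * (eNorm w ^ 2 + eNorm u ^ 2) := by
  have ha : 0 ≤ a := (norm_nonneg _).trans hG
  have h := (eNorm_mulVec_le G (Sum.elim w u)).trans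
    (mul_le_mul_of_nonneg_right hG (norm_nonneg _))
  have h2 := pow_le_pow_left₀ (norm_nonneg _) h 2
  rw [mul_pow, eNorm_sumElim_sq] at h2
  rw [← eNorm_sumElim_sq]
  have h3 : G *ᵥ Sum.elim w u = Sum.elim (G.toBlocks₁₁ *ᵥ w + G.toBlocks₁₂ *ᵥ u)
      (G.toBlocks₂₁ *ᵥ w + G.toBlocks₂₂ *ᵥ u) := by
    conv_lhs => rw [← fromBlocks_toBlocks G, fromBlocks_mulVec]
    simp
  rwa [h3] at h2

lemma eNorm_toBlocks₁₁_le (hG : ‖G‖ ≤ a) (hD : ‖D‖ ≤ d) (x : α → ℂ) :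
    eNorm ((G.toBlocks₁₁ * D) *ᵥ x) ≤ a * d * eNorm x := by
  have ha : 0 ≤ a := (norm_nonneg _).trans hG
  have h := eNorm_loop_le hG (D *ᵥ x) 0
  have h1 := (eNorm_mulVec_le D x).trans (mul_le_mul_of_nonneg_right hD (norm_nonneg _))
  simp only [mulVec_zero, add_zero, mulVec_mulVec] at h
  have h0 : eNorm (0 : δ → ℂ) = 0 := by simp [eNorm]
  rw [h0] at h
  refine le_trans (abs_le_of_sq_le_sq' ?_ (by positivity)).2
    ((mul_le_mul_of_nonneg_left h1 ha).trans_eq (mul_assoc _ _ _).symm)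
  rw [mul_pow]
  nlinarith [sq_nonneg (eNorm ((G.toBlocks₂₁ * D) *ᵥ x))]

/-- A kernel vector would be a nonzero fixed point of a map that shrinks norms by `a * d < 1`. -/
lemma det_one_sub_loop_ne_zero (hG : ‖G‖ ≤ a) (hD : ‖D‖ ≤ d) (had : a * d < 1) :
    (1 - G.toBlocks₁₁ * D).det ≠ 0 := by
  intro h0
  obtain ⟨v, hv, h⟩ := exists_mulVec_eq_zero_iff.2 h0
  rw [sub_mulVec, one_mulVec, sub_eq_zero] at h
  have h1 := eNorm_toBlocks₁₁_le hG hD v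
  rw [← h] at h1
  have h2 : 0 < eNorm v := by
    rw [norm_pos_iff]
    exact fun h => hv (by simpa using h)
  nlinarith

/-- The Neumann series bound. Its independence of the evaluation point later yields properness of
the inverse. -/
lemma opNorm_loop_inv_le (hG : ‖G‖ ≤ a) (hD : ‖D‖ ≤ d) (had : a * d < 1) {H : Matrix α α ℂ}
    (hH : (1 - G.toBlocks₁₁ * D) * H = 1) : ‖H‖ ≤ (1 - a * d)⁻¹ := by
  have hp : 0 < 1 - a * d := by linarith
  refine opNorm_le_of_eNorm (by positivity) fun x => ?_
  have h1 := eNorm_toBlocks₁₁_le hG hD (H *ᵥ x)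
  have h2 : H *ᵥ x = x + (G.toBlocks₁₁ * D) *ᵥ (H *ᵥ x) := by
    have := congrArg (· *ᵥ x) hH
    simp only [← mulVec_mulVec, sub_mulVec, one_mulVec] at this ⊢
    exact sub_eq_iff_eq_add.1 this
  have h3 : eNorm (H *ᵥ x) ≤ eNorm x + eNorm ((G.toBlocks₁₁ * D) *ᵥ (H *ᵥ x)) := by
    conv_lhs => rw [h2]
    exact eNorm_add_le _ _
  have key : ∀ s t r : ℝ, s ≤ t + r → r ≤ a * d * s → s ≤ (1 - a * d)⁻¹ * t := by
    intro s t r h h'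
    rw [inv_mul_eq_div, le_div_iff₀ hp]
    linarith
  exact key _ _ _ h3 h1

/-- With `h22` the performance output is driven by the uncertainty output `w` alone, so its energy
is controlled both by `‖z‖²` and by the energy balance. This gives the factor `d` in the bound,
which a plain energy balance would not. -/
lemma opNorm_performance_le (hG : ‖G‖ ≤ a) (hD : ‖D‖ ≤ d) (ha : a ≤ 1) (had : a * d < 1)
    (h22 : G.toBlocks₂₂ = 0) {H : Matrix α α ℂ} (hH : (1 - G.toBlocks₁₁ * D) * H = 1) :
    ‖G.toBlocks₂₁ * D * H * G.toBlocks₁₂‖ ≤ a * d := by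
  have ha0 : 0 ≤ a := (norm_nonneg _).trans hG
  have hd0 : 0 ≤ d := (norm_nonneg _).trans hD
  refine opNorm_le_of_eNorm (by positivity) fun u => ?_
  set z := H *ᵥ (G.toBlocks₁₂ *ᵥ u) with hz
  set w := D *ᵥ z with hw
  have hy : (G.toBlocks₂₁ * D * H * G.toBlocks₁₂) *ᵥ u = G.toBlocks₂₁ *ᵥ w := by
    simp only [hw, hz, mulVec_mulVec, Matrix.mul_assoc]
  have hzw : G.toBlocks₁₁ *ᵥ w + G.toBlocks₁₂ *ᵥ u = z := by
    have := congrArg (· *ᵥ (G.toBlocks₁₂ *ᵥ u)) hH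
    simp only [← mulVec_mulVec, sub_mulVec, one_mulVec, ← hz, ← hw] at this
    rw [← this]
    abel
  have h1 := eNorm_loop_le hG w u
  have h2 := eNorm_loop_le hG w 0
  have h0 : eNorm (0 : δ → ℂ) = 0 := by simp [eNorm]
  rw [hzw, h22, zero_mulVec, add_zero] at h1
  rw [h0, h22, zero_mulVec, add_zero] at h2
  have h3 := (eNorm_mulVec_le D z).trans (mul_le_mul_of_nonneg_right hD (norm_nonneg _))
  have h4 := pow_le_pow_left₀ (norm_nonneg _) h3 2
  rw [mul_pow] at h4
  rw [hy]
  refine (abs_le_of_sq_le_sq' ?_ (by positivity)).2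
  change eNorm w ^ 2 ≤ d ^ 2 * eNorm z ^ 2 at h4
  set Y := eNorm (G.toBlocks₂₁ *ᵥ w) ^ 2
  set U := eNorm u ^ 2
  have hY : Y ≤ a ^ 2 * eNorm w ^ 2 := by
    nlinarith [sq_nonneg (eNorm (G.toBlocks₁₁ *ᵥ w + G.toBlocks₁₂ *ᵥ 0))]
  have hY2 : Y ≤ (a * d) ^ 2 * eNorm z ^ 2 := by
    refine hY.trans ?_
    rw [mul_pow, mul_assoc]
    gcongr
  have hq : (a * d) ^ 2 ≤ 1 := pow_le_one₀ (by positivity) had.le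
  have hU : Y + (1 - (a * d) ^ 2) * eNorm z ^ 2 ≤ a ^ 2 * U := by
    have : a ^ 2 * eNorm w ^ 2 ≤ a ^ 2 * (d ^ 2 * eNorm z ^ 2) := by gcongr
    nlinarith
  have hU0 : 0 ≤ U := sq_nonneg _
  have hU2 : a ^ 2 * U ≤ U := mul_le_of_le_one_left hU0 (pow_le_one₀ ha0 ha)
  rw [mul_pow (a * d)]
  -- With `q = (a d)²`, a fraction `1 - q` of `Y` is bounded through `hY2`, so that `q` factors out
  -- and the energy balance `hU` applies to the rest.
  calc Y = (a * d) ^ 2 * Y + (1 - (a * d) ^ 2) * Y := by ring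
    _ ≤ (a * d) ^ 2 * Y + (1 - (a * d) ^ 2) * ((a * d) ^ 2 * eNorm z ^ 2) := by
      gcongr
    _ = (a * d) ^ 2 * (Y + (1 - (a * d) ^ 2) * eNorm z ^ 2) := by ring
    _ ≤ (a * d) ^ 2 * U := by gcongr; linarith

end PointwiseGain

section SmallGain

variable {α β γ δ : Type} [Fintype α] [Fintype β] [Fintype γ] [Fintype δ]
  [DecidableEq α] [DecidableEq β] [DecidableEq δ]

/-- The small gain theorem for stable proper systems with a performance channel. -/
theorem smallGain {G : TF (α ⊕ γ) (β ⊕ δ)} {D : TF β α} {a d : ℝ}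
    (hGs : EntriesIn stableProper G) (hDs : EntriesIn stableProper D)
    (hG : ∀ ω, ‖freqResp G ω‖ ≤ a) (hD : ∀ ω, ‖freqResp D ω‖ ≤ d)
    (ha : a ≤ 1) (had : a * d < 1) (h22 : G.toBlocks₂₂ = 0) :
    IsUnit (1 - G.toBlocks₁₁ * D).det ∧ EntriesIn stableProper (1 - G.toBlocks₁₁ * D)⁻¹ ∧
      ∀ ω, ‖freqResp (G.toBlocks₂₁ * D * (1 - G.toBlocks₁₁ * D)⁻¹ * G.toBlocks₁₂) ω‖ ≤ a * d := by
  have hle : stableProper ≤ stableSubring := inf_le_left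
  have hX : EntriesIn stableProper (1 - G.toBlocks₁₁ * D) :=
    EntriesIn.one.sub (hGs.toBlocks₁₁.mul hDs)
  have hXe : ∀ z : ℂ, 0 ≤ z.re → evalMat z (1 - G.toBlocks₁₁ * D) =
      1 - (evalMat z G).toBlocks₁₁ * evalMat z D := by
    intro z hz
    rw [evalMat_sub hz EntriesIn.one ((hGs.toBlocks₁₁.mul hDs).mono hle),
      evalMat_mul hz (hGs.toBlocks₁₁.mono hle) (hDs.mono hle), evalMat_one]
    rfl
  have hGz : ∀ z : ℂ, 0 ≤ z.re → ‖evalMat z G‖ ≤ a := fun z hz =>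
    opNorm_evalMat_le_of_imaginary hGs hG hz
  have hDz : ∀ z : ℂ, 0 ≤ z.re → ‖evalMat z D‖ ≤ d := fun z hz =>
    opNorm_evalMat_le_of_imaginary hDs hD hz
  have hdet : ∀ z : ℂ, 0 ≤ z.re → evalAt z (1 - G.toBlocks₁₁ * D).det ≠ 0 := by
    intro z hz
    rw [evalMat_det hz (hX.mono hle), hXe z hz]
    exact det_one_sub_loop_ne_zero (hGz z hz) (hDz z hz) had
  have hu : IsUnit (1 - G.toBlocks₁₁ * D).det := by
    rw [isUnit_iff_ne_zero]
    intro h0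
    refine hdet 0 le_rfl ?_
    rw [h0]
    exact RatFunc.eval_zero _ _
  -- The inverse is the adjugate over the determinant, and the determinant has no zeros in the
  -- closed right half plane.
  have hinvs : EntriesIn stableSubring (1 - G.toBlocks₁₁ * D)⁻¹ := by
    intro i j
    rw [Matrix.inv_def, Ring.inverse_eq_inv', Matrix.smul_apply, smul_eq_mul]
    exact stableSubring.mul_mem (inv_mem_stableSubring hdet) ((hX.mono hle).adjugate i j)
  have hH : ∀ z : ℂ, 0 ≤ z.re → (1 - (evalMat z G).toBlocks₁₁ * evalMat z D) *
      evalMat z (1 - G.toBlocks₁₁ * D)⁻¹ = 1 := by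
    intro z hz
    rw [← hXe z hz, ← evalMat_mul hz (hX.mono hle) hinvs, mul_nonsing_inv _ hu, evalMat_one]
  have hinv : EntriesIn stableProper (1 - G.toBlocks₁₁ * D)⁻¹ := by
    -- Properness is boundedness along the positive real axis, where the uniform bound on the
    -- inverse applies.
    refine fun i j => ⟨hinvs i j, isProperRat_of_bounded (C := (1 - a * d)⁻¹) fun x hx => ?_⟩
    have hx' : 0 ≤ (x : ℂ).re := by simpa using hx
    exact (norm_entry_le_opNorm (evalMat x (1 - G.toBlocks₁₁ * D)⁻¹) i j).trans
      (opNorm_loop_inv_le (hGz _ hx') (hDz _ hx') had (hH _ hx'))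
  refine ⟨hu, hinv, fun ω => ?_⟩
  have hω : 0 ≤ (Complex.I * (ω : ℂ)).re := by simp
  rw [freqResp_eq_evalMat, evalMat_mul hω, evalMat_mul hω, evalMat_mul hω]
  · exact opNorm_performance_le (hGz _ hω) (hDz _ hω) ha had
      (by rw [← evalMat_zero (z := Complex.I * ω), ← h22]; rfl) (hH _ hω)
  · exact hGs.toBlocks₂₁.mono hle
  · exact hDs.mono hle
  · exact (hGs.toBlocks₂₁.mul hDs).mono hle
  · exact hinvs
  · exact ((hGs.toBlocks₂₁.mul hDs).mul hinv).mono hle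
  · exact hGs.toBlocks₁₂.mono hle

/-- The small gain theorem for a plant `N` and an uncertainty `D` with weights `Ll`, `Lr` on the
uncertainty channels and `V`, `W` on the performance channel. -/
theorem smallGain_weighted [DecidableEq γ] {N : TF (α ⊕ γ) (β ⊕ δ)} {D : TF β α} {Ll : TF α α} {Lr : TF β β}
    {V : TF γ γ} {W : TF δ δ} {a d : ℝ}
    (hN : EntriesIn stableProper N) (hDs : EntriesIn stableProper (Lr⁻¹ * D * Ll⁻¹))
    (hLl : EntriesIn stableProper Ll) (hLl' : EntriesIn stableProper Ll⁻¹) (hul : IsUnit Ll.det)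
    (hLr : EntriesIn stableProper Lr) (hur : IsUnit Lr.det)
    (hV : EntriesIn stableProper V) (hW : EntriesIn stableProper W)
    (hG : ∀ ω, ‖freqResp (fromBlocks Ll 0 0 V * N * fromBlocks Lr 0 0 W) ω‖ ≤ a)
    (hD : ∀ ω, ‖freqResp (Lr⁻¹ * D * Ll⁻¹) ω‖ ≤ d)
    (ha : a ≤ 1) (had : a * d < 1) (h22 : N.toBlocks₂₂ = 0) :
    IsUnit (1 - N.toBlocks₁₁ * D).det ∧ EntriesIn stableProper (1 - N.toBlocks₁₁ * D)⁻¹ ∧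
      ∀ ω, ‖freqResp (V * (N.toBlocks₂₁ * D * (1 - N.toBlocks₁₁ * D)⁻¹ * N.toBlocks₁₂) * W) ω‖
        ≤ a * d := by
  set G := fromBlocks Ll 0 0 V * N * fromBlocks Lr 0 0 W with hGdef
  have hGb : G = fromBlocks (Ll * N.toBlocks₁₁ * Lr) (Ll * N.toBlocks₁₂ * W)
      (V * N.toBlocks₂₁ * Lr) 0 := by
    rw [hGdef]
    conv_lhs => rw [← fromBlocks_toBlocks N]
    simp [fromBlocks_multiply, h22]
  have hGs : EntriesIn stableProper G :=
    ((EntriesIn.fromBlocks hLl .zero .zero hV).mul hN).mul (.fromBlocks hLr .zero .zero hW)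
  obtain ⟨h1, h2, h3⟩ := smallGain hGs hDs hG hD ha had (by rw [hGb, toBlocks_fromBlocks₂₂])
  rw [hGb] at h1 h2 h3
  simp only [toBlocks_fromBlocks₁₁, toBlocks_fromBlocks₁₂, toBlocks_fromBlocks₂₁] at h1 h2 h3
  -- The weighted return difference is similar to the unweighted one, so invertibility and stability
  -- pass between them.
  have hX : 1 - Ll * N.toBlocks₁₁ * Lr * (Lr⁻¹ * D * Ll⁻¹) =
      Ll * (1 - N.toBlocks₁₁ * D) * Ll⁻¹ := by
    have : Lr * (Lr⁻¹ * D * Ll⁻¹) = D * Ll⁻¹ := by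
      rw [Matrix.mul_assoc, mul_nonsing_inv_cancel_left _ _ hur]
    rw [Matrix.mul_assoc _ Lr, this, Matrix.mul_sub, Matrix.sub_mul, Matrix.mul_one,
      mul_nonsing_inv _ hul]
    simp only [Matrix.mul_assoc]
  rw [hX] at h1 h2 h3
  rw [det_mul, det_mul] at h1
  have hu : IsUnit (1 - N.toBlocks₁₁ * D).det := by
    rw [isUnit_iff_ne_zero] at h1 ⊢
    exact right_ne_zero_of_mul (left_ne_zero_of_mul h1)
  have hinv : (Ll * (1 - N.toBlocks₁₁ * D) * Ll⁻¹)⁻¹ = Ll * (1 - N.toBlocks₁₁ * D)⁻¹ * Ll⁻¹ := by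
    rw [Matrix.mul_inv_rev, Matrix.mul_inv_rev, nonsing_inv_nonsing_inv _ hul, Matrix.mul_assoc]
  rw [hinv] at h2 h3
  refine ⟨hu, ?_, ?_⟩
  · have h4 := (hLl'.mul h2).mul hLl
    rwa [Matrix.mul_assoc Ll, nonsing_inv_mul_cancel_left _ _ hul,
      nonsing_inv_mul_cancel_right _ _ hul] at h4
  · convert h3 using 4
    have e1 : V * N.toBlocks₂₁ * Lr * (Lr⁻¹ * D * Ll⁻¹) = V * N.toBlocks₂₁ * D * Ll⁻¹ := by
      simp only [Matrix.mul_assoc, mul_nonsing_inv_cancel_left _ _ hur]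
    rw [e1]
    simp only [Matrix.mul_assoc, nonsing_inv_mul_cancel_left _ _ hul]

end SmallGain

/-! ### The scaled small gain theorem -/

/-- The quadratic form gives `‖Aᴴ x‖² ≤ c ‖x‖²`, and `A` and `Aᴴ` have the same norm. -/
lemma opNorm_le_of_posSemidef {α β : Type*} [Fintype α] [Fintype β] [DecidableEq α]
    [DecidableEq β] {A : Matrix α β ℂ} {c : ℝ} (h : ((c : ℂ) • 1 - A * Aᴴ).PosSemidef) :
    ‖A‖ ≤ √c := by
  rw [← l2_opNorm_conjTranspose]
  refine opNorm_le_of_eNorm (Real.sqrt_nonneg _) fun x => ?_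
  have h1 := h.dotProduct_mulVec_nonneg x
  have h0 : star x ᵥ* A = star (Aᴴ *ᵥ x) := by rw [star_mulVec, conjTranspose_conjTranspose]
  rw [sub_mulVec, smul_mulVec, one_mulVec, dotProduct_sub, dotProduct_smul, star_dotProduct_self,
    ← mulVec_mulVec, dotProduct_mulVec, h0, star_dotProduct_self,
    smul_eq_mul, ← Complex.ofReal_mul, ← Complex.ofReal_sub, Complex.zero_le_real, sub_nonneg] at h1
  have h2 := Real.sqrt_le_sqrt h1
  rwa [Real.sqrt_sq (norm_nonneg _), Real.sqrt_mul' _ (sq_nonneg _),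
    Real.sqrt_sq (norm_nonneg _)] at h2

/-- Congruence with `L⁻¹` turns the scaled inequality into an unscaled one. -/
lemma opNorm_scaled_le {α β : Type*} [Fintype α] [Fintype β] [DecidableEq α] [DecidableEq β]
    {X : Matrix α β ℂ} {L : Matrix α α ℂ} {R : Matrix β β ℂ} {c : ℝ} (hL : IsUnit L.det)
    (h : ((c : ℂ) • (L * Lᴴ) - X * (R * Rᴴ) * Xᴴ).PosSemidef) : ‖L⁻¹ * X * R‖ ≤ √c := by
  refine opNorm_le_of_posSemidef ?_
  convert h.mul_mul_conjTranspose_same L⁻¹ using 1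
  have h1 : Lᴴ * (L⁻¹)ᴴ = 1 := by
    rw [← conjTranspose_mul, nonsing_inv_mul _ hL, conjTranspose_one]
  rw [Matrix.mul_sub, Matrix.sub_mul, Matrix.mul_smul, Matrix.smul_mul,
    nonsing_inv_mul_cancel_left _ _ hL, h1]
  simp only [conjTranspose_mul, Matrix.mul_assoc]

section Certificate

variable {α β γ δ : Type} [Fintype α] [Fintype β] [Fintype γ] [Fintype δ]
  [DecidableEq α] [DecidableEq β] [DecidableEq γ] [DecidableEq δ]

omit [Fintype α] [Fintype γ] [DecidableEq α] [DecidableEq β] [DecidableEq γ] in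
lemma constTF_mul {A : Matrix α β ℂ} {B : Matrix β γ ℂ} :
    constTF (A * B) = constTF A * constTF B := Matrix.map_mul

omit [Fintype α] in
lemma constTF_one : constTF (1 : Matrix α α ℂ) = 1 := Matrix.map_one _ (map_zero _) (map_one _)

lemma constTF_mul_inv {A : Matrix α α ℂ} (hA : IsUnit A.det) : constTF A * constTF A⁻¹ = 1 := by
  rw [← constTF_mul, mul_nonsing_inv _ hA, constTF_one]

/-- The scaled small gain theorem with weights: `Vs`, `Ws` are the weights of the uncertainty
channels, with inverses `Vi`, `Wi`, and `Ql`, `Qr` are factors of the scalings. -/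
theorem smallGain_scaled {N : TF (α ⊕ γ) (β ⊕ δ)} {D : TF β α} {Vs Vi : TF α α} {Ws Wi : TF β β}
    {V : TF γ γ} {W : TF δ δ} {Ql : Matrix α α ℂ} {Qr : Matrix β β ℂ} {η d : ℝ}
    (hN : EntriesIn stableProper N) (h22 : N.toBlocks₂₂ = 0) (hDs : EntriesIn stableProper D)
    (hVs : EntriesIn stableProper Vs) (hVi : EntriesIn stableProper Vi) (hVV : Vs * Vi = 1)
    (hWs : EntriesIn stableProper Ws) (hWi : EntriesIn stableProper Wi) (hWW : Ws * Wi = 1)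
    (hV : EntriesIn stableProper V) (hW : EntriesIn stableProper W)
    (hQl : IsUnit Ql.det) (hQr : IsUnit Qr.det)
    (hlmi : ∀ ω, (((1 - η : ℝ) : ℂ) • (fromBlocks (Ql * Qlᴴ) 0 0 1 : Matrix (α ⊕ γ) (α ⊕ γ) ℂ) -
      freqResp (fromBlocks Vs 0 0 V * N * fromBlocks Ws 0 0 W) ω *
        (fromBlocks (Qr * Qrᴴ) 0 0 1 : Matrix (β ⊕ δ) (β ⊕ δ) ℂ) *
        (freqResp (fromBlocks Vs 0 0 V * N * fromBlocks Ws 0 0 W) ω)ᴴ).PosSemidef)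
    (hcomm : ∀ ω, Qr * freqResp (Wi * D * Vi) ω = freqResp (Wi * D * Vi) ω * Ql)
    (hD : ∀ ω, ‖freqResp (Wi * D * Vi) ω‖ ≤ d) (hη : 0 ≤ η) (hηd : √(1 - η) * d < 1) :
    IsUnit (1 - N.toBlocks₁₁ * D).det ∧ EntriesIn stableProper (1 - N.toBlocks₁₁ * D)⁻¹ ∧
      ∀ ω, ‖freqResp (V * (N.toBlocks₂₁ * D * (1 - N.toBlocks₁₁ * D)⁻¹ * N.toBlocks₁₂) * W) ω‖
        ≤ √(1 - η) * d := by
  have hle : stableProper ≤ stableSubring := inf_le_left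
  have hc : ∀ {a b : Type} (A : Matrix a b ℂ), EntriesIn stableSubring (constTF A) :=
    fun A => (entriesIn_constTF A).mono hle
  have e1 : (constTF Ql⁻¹ * Vs) * (Vi * constTF Ql) = 1 := by
    rw [Matrix.mul_assoc, ← Matrix.mul_assoc Vs, hVV, Matrix.one_mul, ← constTF_mul,
      nonsing_inv_mul _ hQl, constTF_one]
  have e2 : (Ws * constTF Qr) * (constTF Qr⁻¹ * Wi) = 1 := by
    rw [Matrix.mul_assoc, ← Matrix.mul_assoc (constTF Qr), constTF_mul_inv hQr, Matrix.one_mul, hWW]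
  have i1 := inv_eq_right_inv e1
  have i2 := inv_eq_right_inv e2
  have hWDV : EntriesIn stableProper (Wi * D * Vi) := (hWi.mul hDs).mul hVi
  have eD : (Ws * constTF Qr)⁻¹ * D * (constTF Ql⁻¹ * Vs)⁻¹ =
      constTF Qr⁻¹ * (Wi * D * Vi) * constTF Ql := by
    rw [i1, i2]
    simp only [Matrix.mul_assoc]
  have eG : fromBlocks (constTF Ql⁻¹ * Vs) 0 0 V * N * fromBlocks (Ws * constTF Qr) 0 0 W =
      constTF (fromBlocks Ql 0 0 (1 : Matrix γ γ ℂ))⁻¹ *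
        (fromBlocks Vs 0 0 V * N * fromBlocks Ws 0 0 W) *
        constTF (fromBlocks Qr 0 0 (1 : Matrix δ δ ℂ)) := by
    have h1 : (fromBlocks Ql 0 0 (1 : Matrix γ γ ℂ))⁻¹ = fromBlocks Ql⁻¹ 0 0 1 :=
      inv_eq_right_inv (by simp [fromBlocks_multiply, mul_nonsing_inv _ hQl])
    have h2 : constTF (fromBlocks Ql⁻¹ 0 0 (1 : Matrix γ γ ℂ)) =
        fromBlocks (constTF Ql⁻¹) 0 0 1 := by
      simp [constTF, fromBlocks_map]
    have h3 : constTF (fromBlocks Qr 0 0 (1 : Matrix δ δ ℂ)) = fromBlocks (constTF Qr) 0 0 1 := by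
      simp [constTF, fromBlocks_map]
    have h4 : fromBlocks (constTF Ql⁻¹ * Vs) 0 0 V =
        fromBlocks (constTF Ql⁻¹) 0 0 1 * fromBlocks Vs 0 0 V := by simp [fromBlocks_multiply]
    have h5 : fromBlocks (Ws * constTF Qr) 0 0 W =
        fromBlocks Ws 0 0 W * fromBlocks (constTF Qr) 0 0 1 := by simp [fromBlocks_multiply]
    rw [h1, h2, h3, h4, h5]
    simp only [Matrix.mul_assoc]
  have hP : EntriesIn stableProper (fromBlocks Vs 0 0 V * N * fromBlocks Ws 0 0 W) :=
    ((EntriesIn.fromBlocks hVs .zero .zero hV).mul hN).mul (.fromBlocks hWs .zero .zero hW)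
  -- The constant scaling factors are absorbed into the dynamic weights of the uncertainty channels.
  refine smallGain_weighted (Ll := constTF Ql⁻¹ * Vs) (Lr := Ws * constTF Qr) hN ?_
    ((entriesIn_constTF _).mul hVs) (by rw [i1]; exact hVi.mul (entriesIn_constTF _)) ?_
    (hWs.mul (entriesIn_constTF _)) ?_ hV hW ?_ ?_ ?_ hηd h22
  · rw [eD]
    exact ((entriesIn_constTF _).mul hWDV).mul (entriesIn_constTF _)
  · exact (Matrix.isUnit_iff_isUnit_det _).1 (IsUnit.of_mul_eq_one _ e1)
  · exact (Matrix.isUnit_iff_isUnit_det _).1 (IsUnit.of_mul_eq_one _ e2)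
  · intro ω
    have hω : 0 ≤ (Complex.I * (ω : ℂ)).re := by simp
    rw [eG, freqResp_eq_evalMat, evalMat_mul hω ((hc _).mul (hP.mono hle)) (hc _),
      evalMat_mul hω (hc _) (hP.mono hle), evalMat_constTF, evalMat_constTF]
    refine opNorm_scaled_le ?_ ?_
    · rw [det_fromBlocks_zero₂₁, det_one, mul_one]
      exact hQl
    · have h := hlmi ω
      simpa [fromBlocks_conjTranspose, fromBlocks_multiply, freqResp_eq_evalMat] using h
  · intro ω
    have hω : 0 ≤ (Complex.I * (ω : ℂ)).re := by simp
    -- Here the scalings disappear: `hcomm` gives `Qr⁻¹ Δ Ql = Δ` for the weighted uncertainty.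
    rw [eD, freqResp_eq_evalMat, evalMat_mul hω ((hc _).mul (hWDV.mono hle)) (hc _),
      evalMat_mul hω (hc _) (hWDV.mono hle), evalMat_constTF, evalMat_constTF,
      ← freqResp_eq_evalMat, Matrix.mul_assoc, ← hcomm ω, nonsing_inv_mul_cancel_left _ _ hQr]
    exact hD ω
  · rw [Real.sqrt_le_one]
    linarith

end Certificate

/-! ### Scaling matrices and repeated uncertainties -/

section Scalings

variable {k : ℕ} {c : Fin k → Type} {n n' q q' : Fin k → ℕ}

/-- The error channels of `sortedScaling`. -/
def errScaling (n q : Fin k → ℕ) (T : ∀ j, Matrix (c j) (c j) ℂ) (d : Fin k → ℝ) :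
    Matrix (((j : Fin k) × (c j × Fin (n j))) ⊕ Idx q) (((j : Fin k) × (c j × Fin (n j))) ⊕ Idx q)
      ℂ :=
  fromBlocks (blockDiagonal' fun j => T j ⊗ₖ (1 : Matrix (Fin (n j)) (Fin (n j)) ℂ)) 0 0
      (blockDiagonal' (scalarBlocks q d))

/-- The uncertainty with repeated blocks `X j` and unrepeated blocks `Y j`. -/
def repeatedUnc (c : Fin k → Type) [∀ j, DecidableEq (c j)] (X : ∀ j, Matrix (Fin (n j)) (Fin (n' j)) ℂ)
    (Y : ∀ j, Matrix (Fin (q j)) (Fin (q' j)) ℂ) :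
    Matrix (((j : Fin k) × (c j × Fin (n j))) ⊕ Idx q)
      (((j : Fin k) × (c j × Fin (n' j))) ⊕ Idx q') ℂ :=
  fromBlocks (blockDiagonal' fun j => (1 : Matrix (c j) (c j) ℂ) ⊗ₖ X j) 0 0 (blockDiagonal' Y)

lemma sortedScaling_submatrix {e : ℕ} {α : Type} (T : ∀ j, Matrix (c j) (c j) ℂ)
    (d : Fin k → ℝ) (s : α → ((j : Fin k) × (c j × Fin (n j))) ⊕ Idx q) :
    (sortedScaling T d : Matrix (SortedIdx c n q (Fin e)) _ ℂ).submatrix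
      (Sum.map s id) (Sum.map s id) = fromBlocks ((errScaling n q T d).submatrix s s) 0 0 1 := by
  ext (i | i) (j | j) <;> rfl

variable [∀ j, Fintype (c j)] [∀ j, DecidableEq (c j)]

omit [∀ j, DecidableEq (c j)] in
lemma errScaling_mul (T T' : ∀ j, Matrix (c j) (c j) ℂ) (d d' : Fin k → ℝ) :
    errScaling n q T d * errScaling n q T' d' =
      errScaling n q (fun j => T j * T' j) (fun j => d j * d' j) := by
  simp only [errScaling, fromBlocks_multiply, ← blockDiagonal'_mul, Matrix.mul_zero,
    Matrix.zero_mul, add_zero, zero_add, ← mul_kronecker_mul, Matrix.mul_one]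
  congr 2
  ext j : 1
  simp only [scalarBlocks, Matrix.mul_smul, Matrix.mul_one, smul_smul, Complex.ofReal_mul,
    mul_comm]

omit [∀ j, Fintype (c j)] in
lemma errScaling_one : errScaling n q (fun j => (1 : Matrix (c j) (c j) ℂ)) (fun _ => 1) = 1 := by
  have h : scalarBlocks q (fun _ => 1) = 1 := by
    ext j : 1
    simp [scalarBlocks]
  have h' : (fun j => (1 : Matrix (c j × Fin (n j)) (c j × Fin (n j)) ℂ)) = 1 := rfl
  simp only [errScaling, one_kronecker_one]
  rw [h, h', blockDiagonal'_one, blockDiagonal'_one, fromBlocks_one]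

omit [∀ j, Fintype (c j)] [∀ j, DecidableEq (c j)] in
lemma errScaling_conjTranspose (T : ∀ j, Matrix (c j) (c j) ℂ) (d : Fin k → ℝ) :
    (errScaling n q T d)ᴴ = errScaling n q (fun j => (T j)ᴴ) d := by
  simp only [errScaling, fromBlocks_conjTranspose, blockDiagonal'_conjTranspose,
    conjTranspose_kronecker, conjTranspose_one, conjTranspose_zero]
  congr 2
  ext j : 1
  simp [scalarBlocks]

/-- `T ⊗ I` and `I ⊗ X` act on different tensor factors, both products being `T ⊗ X`. Only the size
of the identity changes between the two sides, since `X` need not be square. -/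
lemma errScaling_mul_repeatedUnc (T : ∀ j, Matrix (c j) (c j) ℂ) (d : Fin k → ℝ)
    (X : ∀ j, Matrix (Fin (n j)) (Fin (n' j)) ℂ) (Y : ∀ j, Matrix (Fin (q j)) (Fin (q' j)) ℂ) :
    errScaling n q T d * repeatedUnc c X Y = repeatedUnc c X Y * errScaling n' q' T d := by
  simp only [errScaling, repeatedUnc, fromBlocks_multiply, ← blockDiagonal'_mul, Matrix.mul_zero,
    Matrix.zero_mul, add_zero, zero_add, ← mul_kronecker_mul, Matrix.mul_one, Matrix.one_mul,
    scalarBlocks, Matrix.smul_mul, Matrix.mul_smul]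

open scoped MatrixOrder in
-- Each positive definite `T j` factors as `B Bᴴ`, and each `d j` as a square. Using the same `B` on
-- both sides keeps the structure `diag(B ⊗ I, √d I)`, so the factors intertwine with the repeated
-- uncertainty. Bijectivity of the sortings lets reindexing commute with products.
lemma exists_scaling_factors {α β : Type} [Fintype α] [Fintype β] [DecidableEq α] [DecidableEq β]
    {T : ∀ j, Matrix (c j) (c j) ℂ} {d : Fin k → ℝ} (hT : ∀ j, (T j).PosDef) (hd : ∀ j, 0 < d j)
    {sl : α → ((j : Fin k) × (c j × Fin (n' j))) ⊕ Idx q'} (hl : sl.Bijective)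
    {sr : β → ((j : Fin k) × (c j × Fin (n j))) ⊕ Idx q} (hr : sr.Bijective) :
    ∃ (Ql : Matrix α α ℂ) (Qr : Matrix β β ℂ), IsUnit Ql.det ∧ IsUnit Qr.det ∧
      (errScaling n' q' T d).submatrix sl sl = Ql * Qlᴴ ∧
      (errScaling n q T d).submatrix sr sr = Qr * Qrᴴ ∧
      ∀ X Y, Qr * (repeatedUnc c X Y).submatrix sr sl = (repeatedUnc c X Y).submatrix sr sl * Ql := by
  have h1 : ∀ j, ∃ B : Matrix (c j) (c j) ℂ, IsUnit B.det ∧ T j = B * Bᴴ := by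
    intro j
    obtain ⟨B, hB⟩ := CStarAlgebra.nonneg_iff_eq_star_mul_self.1 (hT j).posSemidef.nonneg
    rw [star_eq_conjTranspose] at hB
    refine ⟨Bᴴ, ?_, by rw [hB, conjTranspose_conjTranspose]⟩
    have := (hT j).det_pos.ne'
    rw [hB, det_mul] at this
    exact (left_ne_zero_of_mul this).isUnit
  choose B hB hTB using h1
  have hfac : ∀ n q : Fin k → ℕ, errScaling n q T d =
      errScaling n q B (fun j => √(d j)) * (errScaling n q B (fun j => √(d j)))ᴴ := by
    intro n q
    rw [errScaling_conjTranspose, errScaling_mul]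
    congr
    · ext j : 1
      exact hTB j
    · ext j
      exact (Real.mul_self_sqrt (hd j).le).symm
  have hinv : ∀ n q : Fin k → ℕ, errScaling n q B (fun j => √(d j)) *
      errScaling n q (fun j => (B j)⁻¹) (fun j => (√(d j))⁻¹) = 1 := by
    intro n q
    rw [errScaling_mul, ← errScaling_one]
    congr
    · ext j : 1
      exact mul_nonsing_inv _ (hB j)
    · ext j
      exact mul_inv_cancel₀ (Real.sqrt_pos.2 (hd j)).ne'
  refine ⟨(errScaling n' q' B fun j => √(d j)).submatrix sl sl,
    (errScaling n q B fun j => √(d j)).submatrix sr sr, ?_, ?_, ?_, ?_, ?_⟩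
  · rw [← Matrix.isUnit_iff_isUnit_det]
    refine IsUnit.of_mul_eq_one
      ((errScaling n' q' (fun j => (B j)⁻¹) (fun j => (√(d j))⁻¹)).submatrix sl sl) ?_
    rw [← submatrix_mul _ _ _ _ _ hl, hinv, submatrix_one _ hl.1]
  · rw [← Matrix.isUnit_iff_isUnit_det]
    refine IsUnit.of_mul_eq_one
      ((errScaling n q (fun j => (B j)⁻¹) (fun j => (√(d j))⁻¹)).submatrix sr sr) ?_
    rw [← submatrix_mul _ _ _ _ _ hr, hinv, submatrix_one _ hr.1]
  · rw [conjTranspose_submatrix, ← submatrix_mul _ _ _ _ _ hl, ← hfac]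
  · rw [conjTranspose_submatrix, ← submatrix_mul _ _ _ _ _ hr, ← hfac]
  · intro X Y
    rw [← submatrix_mul _ _ _ _ _ hr, ← submatrix_mul _ _ _ _ _ hl, errScaling_mul_repeatedUnc]

end Scalings

/-! ### Loop equations -/

section Algebra

variable {K : Type*} [Field K] {μ π α β : Type*} [Fintype μ] [Fintype π] [Fintype α] [Fintype β]
  [DecidableEq μ] [DecidableEq π] [DecidableEq α] [DecidableEq β]

/-- Push-through identity: both sides solve `(1 - Sg * s) * x = Sg`. -/
lemma inv_one_sub_mul_push {s : Matrix μ π K} {Sg : Matrix π μ K} (h : IsUnit (1 - s * Sg).det) :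
    (1 - Sg * s)⁻¹ * Sg = Sg * (1 - s * Sg)⁻¹ := by
  have h' : IsUnit (1 - Sg * s).det := by rwa [det_one_sub_mul_comm]
  have e : (1 - Sg * s) * (Sg * (1 - s * Sg)⁻¹) = Sg := by
    rw [← Matrix.mul_assoc, Matrix.sub_mul, Matrix.one_mul, Matrix.mul_assoc,
      show Sg - Sg * (s * Sg) = Sg * (1 - s * Sg) by rw [Matrix.mul_sub, Matrix.mul_one],
      mul_nonsing_inv_cancel_right _ _ h]
  exact (congrArg ((1 - Sg * s)⁻¹ * ·) e.symm).trans (nonsing_inv_mul_cancel_left _ _ h')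

/-- If the loop equations of environment abstraction have a solution, then the loop of `s` with
the reduced subsystems `Sh` is well-posed, and the solution determines its closed-loop map. -/
lemma reduced_loop_of_solution {s E Eh : Matrix μ π K} {Sg Sh : Matrix π μ K}
    {M : Matrix π μ K} {DE Z : Matrix μ π K} {DF : Matrix π μ K}
    (h1 : IsUnit (1 - s * Sg).det) (h2 : IsUnit (1 - Eh * Sg).det) (h3 : IsUnit (1 - Eh * Sh).det)
    (hM : M = (1 - Sg * s)⁻¹ * Sg) (hZ : Z = s - E) (hDE : DE = Eh - E)
    (hDF : DF = Sh * (1 - Eh * Sh)⁻¹ - Sg * (1 - Eh * Sg)⁻¹)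
    {T₁ T₃ : Matrix π μ K} {T₂ : Matrix μ μ K}
    (e1 : T₁ = -(M * (DE * T₁)) + (1 + M * Z) * (DF * T₂) + M * (DE * T₃) + M)
    (e2 : T₂ = (-(Z * M) - 1) * (DE * T₁) + Z * (1 + M * Z) * (DF * T₂) + Z * M * (DE * T₃) +
      (1 + Z * M))
    (e3 : T₃ = -(M * (DE * T₁)) + M * Z * (DF * T₂) + M * (DE * T₃) + M) :
    IsUnit (1 - s * Sh).det ∧ (1 - s * Sh)⁻¹ = 1 + s * T₁ ∧ Sh * (1 - s * Sh)⁻¹ = T₁ := by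
  have hX : Z - DE = s - Eh := by rw [hZ, hDE]; abel
  set X := Z - DE with hXdef
  set W := DF * T₂ with hW
  -- Rows one and three differ only by an identity in the reduction channel. The two copies of the
  -- abstraction error therefore see signals that differ by the reduction output `W`.
  have hd : T₁ - T₃ = W := by
    refine (congrArg₂ (· - ·) e1 e3).trans ?_
    simp only [Matrix.add_mul, Matrix.one_mul]
    abel
  have hdE : DE * T₁ - DE * T₃ = DE * W := by rw [← Matrix.mul_sub, hd]
  -- Row two is `Z` times row one, minus `DE * T₁`, plus `1`.
  have f2 : T₂ = X * T₁ + 1 := by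
    have : Z * T₁ = Z * (-(M * (DE * T₁)) + (1 + M * Z) * W + M * (DE * T₃) + M) := by rw [← e1]
    rw [hXdef, Matrix.sub_mul, this, e2]
    simp only [Matrix.mul_add, Matrix.add_mul, Matrix.sub_mul, Matrix.neg_mul, Matrix.mul_neg,
      Matrix.mul_assoc, Matrix.one_mul]
    abel
  -- Cancelling the two copies replaces `Z` by `X = Z - DE = s - Eh`, so the exact environment drops
  -- out.
  have f1 : T₁ = (1 + M * X) * W + M := by
    have : M * (DE * T₁) = M * (DE * W) + M * (DE * T₃) := by
      rw [← Matrix.mul_add, ← hdE]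
      congr 1
      abel
    conv_lhs => rw [e1, this]
    rw [hXdef]
    simp only [Matrix.mul_sub, Matrix.add_mul, Matrix.sub_mul, Matrix.mul_assoc, Matrix.one_mul]
    abel
  rw [inv_one_sub_mul_push h1] at hM
  set Q := Sg * (1 - Eh * Sg)⁻¹ with hQ
  set R := (1 - Eh * Sh)⁻¹ with hR
  -- Closing `Sg` through `s = Eh + X` can be done in two stages, first through `Eh` (giving `Q`),
  -- then through `X`.
  have hMQ : M = Q + M * X * Q := by
    have e : (1 - s * Sg) * (1 - Eh * Sg)⁻¹ = 1 - X * Q := by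
      have : 1 - s * Sg = (1 - Eh * Sg) - X * Sg := by
        rw [hX, Matrix.sub_mul]
        abel
      rw [this, Matrix.sub_mul, mul_nonsing_inv _ h2, Matrix.mul_assoc]
    have e' : M * (1 - X * Q) = Q := by
      rw [← e, hM, ← Matrix.mul_assoc, nonsing_inv_mul_cancel_right _ _ h1]
    rw [Matrix.mul_sub, Matrix.mul_one, ← Matrix.mul_assoc] at e'
    rw [← sub_eq_iff_eq_add]
    exact e'
  have hu : (1 - Q * X) * (1 + M * X) = 1 := by
    rw [mul_eq_one_comm]
    have : M * X = Q * X + M * X * Q * X := by rw [← Matrix.add_mul, ← hMQ]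
    rw [Matrix.mul_sub, Matrix.mul_one, Matrix.add_mul, Matrix.one_mul, ← Matrix.mul_assoc]
    conv_lhs => enter [1, 2]; rw [this]
    abel
  -- Since `(1 + M * X) * Q = M`, the nominal part `Q` of `DF` cancels against the source term `M`.
  -- What remains is multiplied by the invertible `1 + M * X`.
  have f3 : T₁ = Sh * R * T₂ := by
    have h0 : (1 + M * X) * (T₁ - Sh * R * T₂) = 0 := by
      have hm : (1 + M * X) * Q = M := by
        rw [Matrix.add_mul, Matrix.one_mul]
        exact hMQ.symm
      have h5 : (1 + M * X) * W = (1 + M * X) * (Sh * R * T₂) - M * T₂ := by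
        rw [hW, hDF, Matrix.sub_mul, Matrix.mul_sub, ← Matrix.mul_assoc _ Q, hm]
      have h6 : M * T₂ = M * X * T₁ + M := by
        conv_lhs => rw [f2]
        rw [Matrix.mul_add, Matrix.mul_one, Matrix.mul_assoc]
      have h8 : (1 + M * X) * W = T₁ - M := (sub_eq_iff_eq_add.2 f1).symm
      rw [Matrix.mul_sub, sub_eq_iff_eq_add.1 h5.symm, h6, h8,
        Matrix.add_mul, Matrix.one_mul]
      abel
    have h7 := congrArg ((1 - Q * X) * ·) h0
    simp only [← Matrix.mul_assoc, hu, Matrix.one_mul, Matrix.mul_zero] at h7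
    exact sub_eq_zero.1 (by simpa only [Matrix.mul_assoc] using h7)
  have f4 : R * T₂ = 1 + s * T₁ := by
    have h8 : (1 - Eh * Sh) * (R * T₂) = T₂ := by
      rw [hR, mul_nonsing_inv_cancel_left _ _ h3]
    rw [Matrix.sub_mul, Matrix.one_mul, Matrix.mul_assoc, ← Matrix.mul_assoc Sh, ← f3,
      sub_eq_iff_eq_add] at h8
    rw [h8, f2, hX, Matrix.sub_mul]
    abel
  have f5 : Sh * (1 + s * T₁) = T₁ := by
    rw [← f4, ← Matrix.mul_assoc]
    exact f3.symm
  -- An explicit right inverse of a square matrix, so well-posedness is a conclusion here.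
  have f6 : (1 - s * Sh) * (1 + s * T₁) = 1 := by
    rw [Matrix.sub_mul, Matrix.one_mul, Matrix.mul_assoc, f5]
    abel
  have f7 := inv_eq_right_inv f6
  exact ⟨(Matrix.isUnit_iff_isUnit_det _).1 (IsUnit.of_mul_eq_one _ f6), f7, by rw [f7, f5]⟩

omit [DecidableEq β] in
/-- A solution of the loop equations of subsystem abstraction yields one of the loop equations of
environment abstraction. -/
lemma solution_of_extended_solution {M : Matrix π μ K} {Y : Matrix μ π K} {W : Matrix π μ K}
    {E₁₂ : Matrix μ β K} {E₂₁ : Matrix α π K} {E₂₂ : Matrix α β K} {DA : Matrix β α K}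
    {DE : Matrix μ π K} (hu : IsUnit (1 - E₂₂ * DA).det)
    (hDE : DE = E₁₂ * DA * (1 - E₂₂ * DA)⁻¹ * E₂₁) {t₁ t₃ : Matrix α μ K} {t₂ : Matrix μ μ K}
    (e1 : t₁ = (E₂₂ - E₂₁ * M * E₁₂) * (DA * t₁) + E₂₁ * (1 + M * Y) * W +
      E₂₁ * M * E₁₂ * (DA * t₃) + E₂₁ * M)
    (e2 : t₂ = (-(Y * M * E₁₂) - E₁₂) * (DA * t₁) + Y * (1 + M * Y) * W +
      Y * M * E₁₂ * (DA * t₃) + (1 + Y * M))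
    (e3 : t₃ = -(E₂₁ * M * E₁₂) * (DA * t₁) + E₂₁ * M * Y * W +
      (E₂₂ + E₂₁ * M * E₁₂) * (DA * t₃) + E₂₁ * M) :
    ∃ T₁ T₃ : Matrix π μ K,
      T₁ = M + (-(M * E₁₂) * (DA * t₁) + (1 + M * Y) * W + M * E₁₂ * (DA * t₃)) ∧
      T₁ = -(M * (DE * T₁)) + (1 + M * Y) * W + M * (DE * T₃) + M ∧
      t₂ = (-(Y * M) - 1) * (DE * T₁) + Y * (1 + M * Y) * W + Y * M * (DE * T₃) +
        (1 + Y * M) ∧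
      T₃ = -(M * (DE * T₁)) + M * Y * W + M * (DE * T₃) + M := by
  set T₁ := M + (-(M * E₁₂) * (DA * t₁) + (1 + M * Y) * W + M * E₁₂ * (DA * t₃)) with hT₁
  set T₃ := M + (-(M * E₁₂) * (DA * t₁) + M * Y * W + M * E₁₂ * (DA * t₃)) with hT₃
  -- `T` enters the extended environment and `t` is the signal into `DA`. Eliminating `t` from the
  -- inner loop leaves the environment error `DE` acting on `T`.
  have key : ∀ t : Matrix α μ K, ∀ T : Matrix π μ K, t = E₂₂ * (DA * t) + E₂₁ * T →
      E₁₂ * (DA * t) = DE * T := by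
    intro t T h
    have h1 : (1 - E₂₂ * DA) * t = E₂₁ * T := by
      rw [Matrix.sub_mul, Matrix.one_mul, Matrix.mul_assoc, sub_eq_iff_eq_add']
      exact h
    rw [hDE, Matrix.mul_assoc _ E₂₁, ← h1, Matrix.mul_assoc (E₁₂ * DA),
      nonsing_inv_mul_cancel_left _ _ hu, Matrix.mul_assoc]
  have k1 : E₁₂ * (DA * t₁) = DE * T₁ := by
    refine key _ _ (e1.trans ?_)
    rw [hT₁]
    simp only [Matrix.mul_add, Matrix.add_mul, Matrix.sub_mul, Matrix.neg_mul, Matrix.mul_neg,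
      Matrix.mul_assoc]
    abel
  have k3 : E₁₂ * (DA * t₃) = DE * T₃ := by
    refine key _ _ (e3.trans ?_)
    rw [hT₃]
    simp only [Matrix.mul_add, Matrix.add_mul, Matrix.neg_mul, Matrix.mul_neg, Matrix.mul_assoc]
    abel
  refine ⟨T₁, T₃, rfl, ?_, ?_, ?_⟩
  · rw [← k1, ← k3, hT₁]
    simp only [Matrix.neg_mul, Matrix.mul_assoc]
    abel
  · rw [← k1, ← k3]
    refine e2.trans ?_
    simp only [Matrix.sub_mul, Matrix.neg_mul, Matrix.mul_assoc, Matrix.one_mul]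
  · rw [← k1, ← k3, hT₃]
    simp only [Matrix.neg_mul, Matrix.mul_assoc]
    abel

omit [Fintype μ] [Fintype π] [DecidableEq μ] [DecidableEq π] in
/-- The effect of perturbing the feedback part of a linear fractional transformation. -/
lemma lft_perturbation {Sjl : Matrix μ β K} {Slj : Matrix α π K} {Sll : Matrix α β K}
    {Sb Sa : Matrix β α K} (h : IsUnit (1 - Sll * Sb).det) (ha : IsUnit (1 - Sll * Sa).det) :
    IsUnit (1 - (1 - Sll * Sb)⁻¹ * Sll * (Sa - Sb)).det ∧
    Sjl * Sa * (1 - Sll * Sa)⁻¹ * Slj - Sjl * Sb * (1 - Sll * Sb)⁻¹ * Slj =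
      Sjl * (1 + Sb * (1 - Sll * Sb)⁻¹ * Sll) * (Sa - Sb) *
        (1 - (1 - Sll * Sb)⁻¹ * Sll * (Sa - Sb))⁻¹ * ((1 - Sll * Sb)⁻¹ * Slj) := by
  set L := (1 - Sll * Sb)⁻¹ with hL
  set R := (1 - Sll * Sa)⁻¹ with hR
  have hdiff : Sll * (Sa - Sb) = (1 - Sll * Sb) - (1 - Sll * Sa) := by
    rw [Matrix.mul_sub]
    abel
  -- The perturbed loop factors through the nominal one, so its inverse cancels `L`.
  have e : 1 - L * Sll * (Sa - Sb) = L * (1 - Sll * Sa) := by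
    rw [Matrix.mul_assoc, hdiff, Matrix.mul_sub, hL, nonsing_inv_mul _ h]
    abel
  have hLu : IsUnit L.det := by
    rw [hL, det_nonsing_inv]
    exact h.ringInverse
  refine ⟨?_, ?_⟩
  · rw [e, det_mul]
    exact hLu.mul ha
  · have e2 : (1 - L * Sll * (Sa - Sb))⁻¹ * (L * Slj) = R * Slj := by
      rw [e, Matrix.mul_inv_rev, Matrix.mul_assoc, nonsing_inv_mul_cancel_left _ _ hLu]
    -- The resolvent identity.
    have e3 : L * (Sll * (Sa - Sb)) * R = R - L := by
      rw [hdiff, Matrix.mul_sub, Matrix.sub_mul, hL, nonsing_inv_mul _ h, Matrix.one_mul, hR,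
        Matrix.mul_assoc, mul_nonsing_inv _ ha, Matrix.mul_one]
    have e4 : Sb * L * Sll * ((Sa - Sb) * (R * Slj)) = Sb * (R * Slj) - Sb * (L * Slj) := by
      rw [← Matrix.mul_sub, ← Matrix.sub_mul, ← e3]
      simp only [Matrix.mul_assoc]
    rw [Matrix.mul_assoc _ _ (L * Slj), e2]
    simp only [Matrix.mul_assoc] at e4 ⊢
    rw [Matrix.add_mul, Matrix.one_mul, Matrix.mul_assoc, Matrix.mul_assoc, e4, ← Matrix.mul_sub,
      Matrix.sub_mul]
    congr 1
    abel

end Algebra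

/-! ### Block diagonal matrices over the error channels -/

lemma blockDiagonal'_mul_eq_one {R ι : Type*} [CommRing R] [Fintype ι] [DecidableEq ι]
    {n : ι → Type*} [∀ i, Fintype (n i)] [∀ i, DecidableEq (n i)] {A B : ∀ i, Matrix (n i) (n i) R}
    (h : ∀ i, A i * B i = 1) : blockDiagonal' A * blockDiagonal' B = 1 := by
  rw [← blockDiagonal'_mul, ← blockDiagonal'_one]
  congr 1
  exact funext h

lemma blockDiagonal'_inv_eq {R ι : Type*} [CommRing R] [Fintype ι] [DecidableEq ι]
    {n : ι → Type*} [∀ i, Fintype (n i)] [∀ i, DecidableEq (n i)] {A : ∀ i, Matrix (n i) (n i) R}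
    (h : ∀ i, IsUnit (A i).det) :
    IsUnit (blockDiagonal' A).det ∧ (blockDiagonal' A)⁻¹ = blockDiagonal' fun i => (A i)⁻¹ := by
  have h1 : blockDiagonal' A * (blockDiagonal' fun i => (A i)⁻¹) = 1 :=
    blockDiagonal'_mul_eq_one fun i => mul_nonsing_inv _ (h i)
  exact ⟨(Matrix.isUnit_iff_isUnit_det _).1 (IsUnit.of_mul_eq_one _ h1), inv_eq_right_inv h1⟩

lemma one_sub_blockDiagonal'_mul {R ι : Type*} [CommRing R] [Fintype ι] [DecidableEq ι]
    {n n' : ι → Type*} [∀ i, Fintype (n' i)] [∀ i, DecidableEq (n i)]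
    {A : ∀ i, Matrix (n i) (n' i) R} {B : ∀ i, Matrix (n' i) (n i) R} :
    1 - blockDiagonal' A * blockDiagonal' B = blockDiagonal' fun i => 1 - A i * B i := by
  rw [← blockDiagonal'_mul, ← blockDiagonal'_one, ← blockDiagonal'_sub]
  rfl

/-- The error part `diag(X, Y, X)` of `diagChan`. -/
def errDiag {R A A' F F' : Type} [Zero R] (X : Matrix A A' R) (Y : Matrix F F' R) :
    Matrix (A ⊕ (F ⊕ A)) (A' ⊕ (F' ⊕ A')) R :=
  fromBlocks X 0 0 (fromBlocks Y 0 0 X)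

section ErrDiag

variable {A A' A'' F F' F'' : Type}

lemma errDiag_mul {R : Type} [CommRing R] [Fintype A'] [Fintype F'] (X : Matrix A A' R)
    (Y : Matrix F F' R) (X' : Matrix A' A'' R) (Y' : Matrix F' F'' R) :
    errDiag X Y * errDiag X' Y' = errDiag (X * X') (Y * Y') := by
  simp [errDiag, fromBlocks_multiply]

lemma errDiag_one {R : Type} [CommRing R] [DecidableEq A] [DecidableEq F] :
    errDiag (1 : Matrix A A R) (1 : Matrix F F R) = 1 := by
  simp [errDiag]

lemma errDiag_mul_fromRows {R γ : Type} [CommRing R] [Fintype A'] [Fintype F'] (X : Matrix A A' R)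
    (Y : Matrix F F' R) (T₁ T₃ : Matrix A' γ R) (T₂ : Matrix F' γ R) :
    errDiag X Y * fromRows T₁ (fromRows T₂ T₃) =
      fromRows (X * T₁) (fromRows (Y * T₂) (X * T₃)) := by
  simp [errDiag, fromBlocks_mul_fromRows]

lemma EntriesIn.errDiag {R : Subring (RatFunc ℂ)} {X : TF A A'} {Y : TF F F'}
    (hX : EntriesIn R X) (hY : EntriesIn R Y) : EntriesIn R (errDiag X Y) :=
  .fromBlocks hX .zero .zero (.fromBlocks hY .zero .zero hX)

lemma evalMat_errDiag {z : ℂ} {X : TF A A'} {Y : TF F F'} :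
    evalMat z (errDiag X Y) = errDiag (evalMat z X) (evalMat z Y) := by
  simp [errDiag, evalMat_fromBlocks]

lemma opNorm_errDiag_le [Fintype A] [Fintype A'] [Fintype F] [Fintype F'] [DecidableEq A']
    [DecidableEq F'] {X : Matrix A A' ℂ} {Y : Matrix F F' ℂ} {d : ℝ} (hX : ‖X‖ ≤ d)
    (hY : ‖Y‖ ≤ d) : ‖errDiag X Y‖ ≤ d :=
  opNorm_fromBlocks_diag_le hX (opNorm_fromBlocks_diag_le hY hX)

/-- Solutions of a `3 × 3` block loop equation with a block diagonal uncertainty. -/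
lemma loop_blocks {R γ : Type} [CommRing R] [Fintype A] [Fintype A'] [Fintype F] [Fintype F']
    {N₁₁ N₁₃ N₃₁ N₃₃ : Matrix A A' R} {N₁₂ N₃₂ : Matrix A F' R} {N₂₁ N₂₃ : Matrix F A' R}
    {N₂₂ : Matrix F F' R} {X : Matrix A' A R} {Y : Matrix F' F R}
    {B₁ B₃ T₁ T₃ : Matrix A γ R} {B₂ T₂ : Matrix F γ R}
    (h : fromRows T₁ (fromRows T₂ T₃) =
      fromBlocks N₁₁ (fromCols N₁₂ N₁₃) (fromRows N₂₁ N₃₁) (fromBlocks N₂₂ N₂₃ N₃₂ N₃₃) *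
        (errDiag X Y * fromRows T₁ (fromRows T₂ T₃)) + fromRows B₁ (fromRows B₂ B₃)) :
    T₁ = N₁₁ * (X * T₁) + N₁₂ * (Y * T₂) + N₁₃ * (X * T₃) + B₁ ∧
    T₂ = N₂₁ * (X * T₁) + N₂₂ * (Y * T₂) + N₂₃ * (X * T₃) + B₂ ∧
    T₃ = N₃₁ * (X * T₁) + N₃₂ * (Y * T₂) + N₃₃ * (X * T₃) + B₃ := by
  rw [errDiag_mul_fromRows, fromBlocks_mul_fromRows, fromCols_mul_fromRows, fromRows_mul,
    fromBlocks_mul_fromRows] at h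
  refine ⟨?_, ?_, ?_⟩
  · ext i j
    have := congrFun (congrFun h (Sum.inl i)) j
    simpa [add_assoc] using this
  · ext i j
    have := congrFun (congrFun h (Sum.inr (Sum.inl i))) j
    simpa [add_assoc] using this
  · ext i j
    have := congrFun (congrFun h (Sum.inr (Sum.inr i))) j
    simpa [add_assoc] using this

end ErrDiag

/-! ### Weights -/

section Weights

variable {a b : ℕ}

lemma scaleTF_eq_mul {ε : ℝ} {V : TF (Fin a) (Fin a)} :
    scaleTF ε V = constTF ((ε : ℂ) • 1) * V := by
  have : constTF ((ε : ℂ) • (1 : Matrix (Fin a) (Fin a) ℂ)) = RatFunc.C (ε : ℂ) • 1 := by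
    ext i j : 2
    simp only [constTF, Matrix.map_apply, Matrix.smul_apply, Matrix.one_apply, smul_eq_mul, map_mul]
    split_ifs <;> simp
  rw [this, Matrix.smul_mul, Matrix.one_mul]
  rfl

lemma bistable_entriesIn {V : TF (Fin a) (Fin a)} (hV : Bistable V) :
    EntriesIn stableProper V ∧ EntriesIn stableProper V⁻¹ :=
  ⟨(rhInf_iff.1 hV.1).mono rhSubring_le_stableProper,
    (rhInf_iff.1 hV.2.2).mono rhSubring_le_stableProper⟩

lemma scaleTF_spec {ε : ℝ} (hε : 0 < ε) {V : TF (Fin a) (Fin a)} (hV : Bistable V) :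
    EntriesIn stableProper (scaleTF ε V) ∧ EntriesIn stableProper (scaleTF ε V)⁻¹ ∧
      scaleTF ε V * (scaleTF ε V)⁻¹ = 1 := by
  have hu : IsUnit ((ε : ℂ) • (1 : Matrix (Fin a) (Fin a) ℂ)).det := by
    rw [det_smul, det_one, mul_one]
    exact (pow_ne_zero _ (Complex.ofReal_ne_zero.2 hε.ne')).isUnit
  have e : scaleTF ε V * (V⁻¹ * constTF ((ε : ℂ) • 1)⁻¹) = 1 := by
    rw [scaleTF_eq_mul, Matrix.mul_assoc, mul_nonsing_inv_cancel_left _ _ hV.2.1,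
      constTF_mul_inv hu]
  have hb := bistable_entriesIn hV
  rw [inv_eq_right_inv e]
  refine ⟨?_, hb.2.mul (entriesIn_constTF _), e⟩
  rw [scaleTF_eq_mul]
  exact (entriesIn_constTF _).mul hb.1

/-- There are finitely many subsystems, so strict bounds have a common strict bound: the maximum,
read as `0` if `k = 0`. -/
lemma exists_common_bound {k : ℕ} {x y : Fin k → ENNReal} (hx : ∀ j, x j < 1)
    (hy : ∀ j, y j < 1) :
    ∃ d : ℝ, 0 ≤ d ∧ d < 1 ∧ (∀ j, x j ≤ ENNReal.ofReal d) ∧ ∀ j, y j ≤ ENNReal.ofReal d := by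
  have h : (Finset.univ.sup fun j => max (x j) (y j)) < 1 := by
    rw [Finset.sup_lt_iff (by simp)]
    exact fun j _ => max_lt (hx j) (hy j)
  refine ⟨(Finset.univ.sup fun j => max (x j) (y j)).toReal, ENNReal.toReal_nonneg, ?_, ?_, ?_⟩
  · rw [← ENNReal.toReal_one]
    exact (ENNReal.toReal_lt_toReal h.ne_top ENNReal.one_ne_top).2 h
  all_goals
    intro j
    rw [ENNReal.ofReal_toReal h.ne_top]
    refine le_trans ?_ (Finset.le_sup (Finset.mem_univ j))
  exacts [le_max_left _ _, le_max_right _ _]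

lemma freqResp_le_of_weightedNorm {W : TF (Fin a) (Fin a)} {V : TF (Fin b) (Fin b)}
    {Δ : TF (Fin a) (Fin b)} {d : ℝ} (hd : 0 ≤ d) (h : weightedNorm W V Δ ≤ ENNReal.ofReal d)
    (ω : ℝ) : ‖freqResp (W⁻¹ * Δ * V⁻¹) ω‖ ≤ d := by
  rw [← ENNReal.ofReal_le_ofReal_iff hd]
  exact (le_iSup (fun ω => ENNReal.ofReal ‖freqResp (W⁻¹ * Δ * V⁻¹) ω‖) ω).trans h

/-- Since `ε` is Hermitian, both outer factors can be moved into the transfer matrix, where they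
turn `𝒱` into `V = ε𝒱`. -/
lemma ScaledLMI.posSemidef {α β : Type} [Fintype α] [Fintype β] {η : ℝ}
    {ε : Matrix α α ℂ} (hε : εᴴ = ε) {P : TF α β} (hP : EntriesIn stableProper P)
    {D : Matrix α α ℂ × Matrix β β ℂ} (h : ScaledLMI η ε P D) (ω : ℝ) :
    (((1 - η : ℝ) : ℂ) • D.1 - freqResp (constTF ε * P) ω * D.2 *
      (freqResp (constTF ε * P) ω)ᴴ).PosSemidef := by
  have hle : stableProper ≤ stableSubring := inf_le_left
  have h1 : freqResp (constTF ε * P) ω = ε * freqResp P ω := by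
    rw [freqResp_eq_evalMat, evalMat_mul (by simp) ((entriesIn_constTF _).mono hle) (hP.mono hle),
      evalMat_constTF]
    rfl
  rw [h1, conjTranspose_mul, hε]
  have h2 := h ω
  simpa only [Matrix.mul_assoc] using h2

end Weights

/-! ### The interconnected reduced system -/

section Systems

variable {k pC mC : ℕ} {m p : Fin k → ℕ} {S : TF (Fin pC ⊕ Idx m) (Fin mC ⊕ Idx p)}
  {Sig SigR : ∀ j, TF (Fin (p j)) (Fin (m j))}

/-- In this form `M` is precisely the map whose stability is the internal stability assumption. -/
lemma StandingAssumption.plantM_eq (hS : StandingAssumption S Sig) :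
    plantM S Sig = parB Sig * (1 - S.toBlocks₂₂ * parB Sig)⁻¹ :=
  inv_one_sub_mul_push hS.2.2.2.1.1

lemma StandingAssumption.entriesIn_plantM (hS : StandingAssumption S Sig) :
    EntriesIn rhSubring (plantM S Sig) := by
  rw [hS.plantM_eq]
  exact rhInf_iff.1 hS.2.2.2.2

/-- A plant whose uncertain loop is stable, and whose solutions give the closed-loop map of the
reduced subsystems, certifies the reduced interconnected system. -/
theorem certified_of_plant {α β : Type} [Fintype α] [Fintype β] [DecidableEq α]
    (hS : StandingAssumption S Sig) {VC : TF (Fin pC) (Fin pC)} {WC : TF (Fin mC) (Fin mC)}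
    {N : TF (α ⊕ Fin pC) (β ⊕ Fin mC)} {D : TF β α} {B : TF α (Idx m)} {C : TF (Idx p) β} {c : ℝ}
    (hN12 : N.toBlocks₁₂ = B * S.toBlocks₂₁) (hN21 : N.toBlocks₂₁ = S.toBlocks₁₂ * C)
    (hN : EntriesIn rhSubring N) (hD : EntriesIn rhSubring D) (hB : EntriesIn rhSubring B)
    (hC : EntriesIn rhSubring C)
    (hloop : IsUnit (1 - N.toBlocks₁₁ * D).det ∧ EntriesIn stableProper (1 - N.toBlocks₁₁ * D)⁻¹ ∧
      ∀ ω, ‖freqResp (VC * (N.toBlocks₂₁ * D * (1 - N.toBlocks₁₁ * D)⁻¹ * N.toBlocks₁₂) * WC) ω‖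
        ≤ c) (hc : c < 1)
    (hsol : ∀ T : TF α (Idx m), T = N.toBlocks₁₁ * (D * T) + B →
      ∃ ζ : TF (Idx p) (Idx m), ζ = plantM S Sig + C * (D * T) ∧
        IsUnit (1 - S.toBlocks₂₂ * parB SigR).det ∧
        (1 - S.toBlocks₂₂ * parB SigR)⁻¹ = 1 + S.toBlocks₂₂ * ζ ∧
        parB SigR * (1 - S.toBlocks₂₂ * parB SigR)⁻¹ = ζ) :
    ReducedModelCertified S Sig SigR VC WC := by
  obtain ⟨hu, hinv, hperf⟩ := hloop
  have hSr := rhInf_iff.1 hS.2.1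
  -- Stability and properness come from small gain, real rationality from inversion over the
  -- subfield.
  have hinvR : EntriesIn rhSubring (1 - N.toBlocks₁₁ * D)⁻¹ := by
    have h1 : EntriesIn realRational.toSubring (1 - N.toBlocks₁₁ * D) :=
      (EntriesIn.one.sub (hN.toBlocks₁₁.mul hD)).mono rhSubring_le_realRational
    exact fun i j => ⟨h1.inv i j, hinv i j⟩
  set T := (1 - N.toBlocks₁₁ * D)⁻¹ * B with hT
  have hTeq : T = N.toBlocks₁₁ * (D * T) + B := by
    have h1 : (1 - N.toBlocks₁₁ * D) * T = B := mul_nonsing_inv_cancel_left _ _ hu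
    rw [Matrix.sub_mul, Matrix.one_mul, sub_eq_iff_eq_add', Matrix.mul_assoc] at h1
    exact h1
  obtain ⟨ζ, hζ, hur, hinvr, hζr⟩ := hsol T hTeq
  have hζR : EntriesIn rhSubring ζ := by
    rw [hζ]
    exact hS.entriesIn_plantM.add (hC.mul (hD.mul (hinvR.mul hB)))
  have hllft : llft S (parB SigR) = S.toBlocks₁₂ * ζ * S.toBlocks₂₁ + S.toBlocks₁₁ := by
    rw [llft, Matrix.mul_assoc S.toBlocks₁₂, hζr]
  -- The error is `S₁₂ (ζ - M) S₂₁`, and `ζ - M = C D T`; the outer factors recombine into the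
  -- off-diagonal blocks of `N`.
  have herr : errC S Sig SigR =
      N.toBlocks₂₁ * D * (1 - N.toBlocks₁₁ * D)⁻¹ * N.toBlocks₁₂ := by
    rw [errC, hllft, llft, Matrix.mul_assoc S.toBlocks₁₂ (parB Sig), ← hS.plantM_eq, hζ, hN12, hN21,
      hT, Matrix.mul_add, Matrix.add_mul]
    simp only [Matrix.mul_assoc]
    abel
  have hRlft : RHinf (llft S (parB SigR)) := by
    rw [rhInf_iff, hllft]
    exact ((hSr.toBlocks₁₂.mul hζR).mul hSr.toBlocks₂₁).add hSr.toBlocks₁₁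
  refine ⟨⟨hur, ?_⟩, ?_, hRlft, ?_, ?_⟩
  · rw [hinvr]
    exact (EntriesIn.one.add (hSr.toBlocks₂₂.mul hζR)).properRR
  · rw [LftInternallyStable, hζr]
    exact rhInf_iff.2 hζR
  · rw [rhInf_iff, herr, hN12, hN21]
    exact ((((hSr.toBlocks₁₂.mul hC).mul hD).mul hinvR).mul (hB.mul hSr.toBlocks₂₁))
  · rw [herr]
    refine lt_of_le_of_lt (iSup_le fun ω => ENNReal.ofReal_le_ofReal (hperf ω)) ?_
    exact ENNReal.ofReal_lt_one.2 hc

/-- The normalized reduction error is the difference of the local closed-loop maps. -/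
lemma errFtilde_eq {a b : ℕ} {E : TF (Fin pC ⊕ Fin a) (Fin mC ⊕ Fin b)}
    {Gy : Matrix (Fin b) (Fin b) ℂ} {Gu : Matrix (Fin a) (Fin a) ℂ} (hGy : IsUnit Gy.det)
    (hGu : IsUnit Gu.det) (Sj SjR : TF (Fin b) (Fin a)) :
    errFtilde E Gy Gu Sj SjR = SjR * (1 - E.toBlocks₂₂ * SjR)⁻¹ -
      Sj * (1 - E.toBlocks₂₂ * Sj)⁻¹ := by
  have h : ∀ X : TF (Fin b) (Fin a), (llft (augEnv E Gy Gu) X).toBlocks₂₂ =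
      constTF Gy * (X * (1 - E.toBlocks₂₂ * X)⁻¹) * constTF Gu := by
    intro X
    simp only [llft, augEnv, toBlocks_fromBlocks₁₂, toBlocks_fromBlocks₂₂, toBlocks_fromBlocks₂₁,
      toBlocks_fromBlocks₁₁, fromRows_mul, mul_fromCols]
    ext i j
    simp [Matrix.toBlocks₂₂, Matrix.mul_assoc]
  have h2 : (errF E Gy Gu Sj SjR).toBlocks₂₂ = constTF Gy * (SjR * (1 - E.toBlocks₂₂ * SjR)⁻¹ -
      Sj * (1 - E.toBlocks₂₂ * Sj)⁻¹) * constTF Gu := by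
    rw [Matrix.mul_sub, Matrix.sub_mul, ← h, ← h]
    rfl
  have hy : IsUnit (constTF Gy).det :=
    (Matrix.isUnit_iff_isUnit_det _).1 (IsUnit.of_mul_eq_one _ (constTF_mul_inv hGy))
  have hu : IsUnit (constTF Gu).det :=
    (Matrix.isUnit_iff_isUnit_det _).1 (IsUnit.of_mul_eq_one _ (constTF_mul_inv hGu))
  rw [errFtilde, h2, Matrix.mul_assoc, mul_nonsing_inv_cancel_right _ _ hu,
    nonsing_inv_mul_cancel_left _ _ hy]

/-- Augmentation leaves the feedback block of the environment untouched. -/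
lemma lftWellPosed_augEnv {a b : ℕ} {E : TF (Fin pC ⊕ Fin a) (Fin mC ⊕ Fin b)}
    {Gy : Matrix (Fin b) (Fin b) ℂ} {Gu : Matrix (Fin a) (Fin a) ℂ} {Sj : TF (Fin b) (Fin a)}
    (h : LftWellPosed (augEnv E Gy Gu) Sj) : IsUnit (1 - E.toBlocks₂₂ * Sj).det := h.1

/-- The reduction errors of all subsystems, as one difference of closed-loop maps. -/
lemma blockDiagonal'_errF {E : ∀ j, TF (Fin (m j)) (Fin (p j))}
    {ΔF : ∀ j, TF (Fin (p j)) (Fin (m j))} (h2 : ∀ j, IsUnit (1 - E j * Sig j).det)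
    (h3 : ∀ j, IsUnit (1 - E j * SigR j).det)
    (hΔ : ∀ j, ΔF j = SigR j * (1 - E j * SigR j)⁻¹ - Sig j * (1 - E j * Sig j)⁻¹) :
    IsUnit (1 - blockDiagonal' E * parB Sig).det ∧ IsUnit (1 - blockDiagonal' E * parB SigR).det ∧
      blockDiagonal' ΔF = parB SigR * (1 - blockDiagonal' E * parB SigR)⁻¹ -
        parB Sig * (1 - blockDiagonal' E * parB Sig)⁻¹ := by
  have i2 := blockDiagonal'_inv_eq h2
  have i3 := blockDiagonal'_inv_eq h3
  simp only [parB, one_sub_blockDiagonal'_mul]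
  refine ⟨i2.1, i3.1, ?_⟩
  rw [i2.2, i3.2, ← blockDiagonal'_mul, ← blockDiagonal'_mul, ← blockDiagonal'_sub]
  congr 1
  exact funext hΔ

end Systems

/-! ### Certification from the scaled matrix inequality -/

section DiagChan

variable {A A' F F' C C' : Type}

lemma constTF_blockDiagonal' {ι : Type} [DecidableEq ι] {a b : ι → Type}
    {X : ∀ i, Matrix (a i) (b i) ℂ} :
    constTF (blockDiagonal' X) = blockDiagonal' fun i => constTF (X i) :=
  blockDiagonal'_map _ _ (map_zero _)

lemma diagChan_conjTranspose {X : Matrix A A' ℂ} {Y : Matrix F F' ℂ} {Z : Matrix C C' ℂ} :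
    (diagChan X Y Z)ᴴ = diagChan Xᴴ Yᴴ Zᴴ := by
  simp [diagChan, fromBlocks_conjTranspose]

lemma constTF_diagChan_mul [Fintype A] [Fintype F] [Fintype C] [DecidableEq C]
    (X : Matrix A A ℂ) (Y : Matrix F F ℂ) (X' : TF A A') (Y' : TF F F') (Z' : TF C C') :
    constTF (diagChan X Y (1 : Matrix C C ℂ)) * diagChan X' Y' Z' =
      fromBlocks (errDiag (constTF X * X') (constTF Y * Y')) 0 0 Z' := by
  have h : constTF (diagChan X Y (1 : Matrix C C ℂ)) = diagChan (constTF X) (constTF Y) 1 := by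
    simp [diagChan, constTF, fromBlocks_map]
  rw [h]
  simp [diagChan, errDiag, fromBlocks_multiply]

lemma EntriesIn.diagChan {R : Subring (RatFunc ℂ)} {X : TF A A'} {Y : TF F F'} {Z : TF C C'}
    (hX : EntriesIn R X) (hY : EntriesIn R Y) (hZ : EntriesIn R Z) :
    EntriesIn R (diagChan X Y Z) :=
  .fromBlocks (.fromBlocks hX .zero .zero (.fromBlocks hY .zero .zero hX)) .zero .zero hZ

lemma EntriesIn.blocksChan {R : Subring (RatFunc ℂ)}
    {X₁₁ : TF A A'} {X₁₂ : TF A F'} {X₁₃ : TF A A'} {X₁₄ : TF A C'}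
    {X₂₁ : TF F A'} {X₂₂ : TF F F'} {X₂₃ : TF F A'} {X₂₄ : TF F C'}
    {X₃₁ : TF A A'} {X₃₂ : TF A F'} {X₃₃ : TF A A'} {X₃₄ : TF A C'}
    {X₄₁ : TF C A'} {X₄₂ : TF C F'} {X₄₃ : TF C A'} {X₄₄ : TF C C'}
    (h₁₁ : EntriesIn R X₁₁) (h₁₂ : EntriesIn R X₁₂) (h₁₃ : EntriesIn R X₁₃) (h₁₄ : EntriesIn R X₁₄)
    (h₂₁ : EntriesIn R X₂₁) (h₂₂ : EntriesIn R X₂₂) (h₂₃ : EntriesIn R X₂₃) (h₂₄ : EntriesIn R X₂₄)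
    (h₃₁ : EntriesIn R X₃₁) (h₃₂ : EntriesIn R X₃₂) (h₃₃ : EntriesIn R X₃₃) (h₃₄ : EntriesIn R X₃₄)
    (h₄₁ : EntriesIn R X₄₁) (h₄₂ : EntriesIn R X₄₂) (h₄₃ : EntriesIn R X₄₃)
    (h₄₄ : EntriesIn R X₄₄) :
    EntriesIn R (blocksChan X₁₁ X₁₂ X₁₃ X₁₄ X₂₁ X₂₂ X₂₃ X₂₄ X₃₁ X₃₂ X₃₃ X₃₄ X₄₁ X₄₂ X₄₃ X₄₄) :=
  .fromBlocks (.fromBlocks h₁₁ (.fromCols h₁₂ h₁₃) (.fromRows h₂₁ h₃₁)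
    (.fromBlocks h₂₂ h₂₃ h₃₂ h₃₃)) (.fromRows h₁₄ (.fromRows h₂₄ h₃₄))
    (.fromCols h₄₁ (.fromCols h₄₂ h₄₃)) h₄₄

end DiagChan

section Systems

variable {k pC mC : ℕ} {m p : Fin k → ℕ} {S : TF (Fin pC ⊕ Idx m) (Fin mC ⊕ Idx p)}
  {Sig SigR : ∀ j, TF (Fin (p j)) (Fin (m j))}

lemma scalarBlocks_conjTranspose (n : Fin k → ℕ) (ε : Fin k → ℝ) (j : Fin k) :
    (scalarBlocks n ε j)ᴴ = scalarBlocks n ε j := by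
  simp [scalarBlocks]

lemma constTF_scalarBlocks_mul {n : Fin k → ℕ} {ε : Fin k → ℝ} {j : Fin k}
    {V : TF (Fin (n j)) (Fin (n j))} : constTF (scalarBlocks n ε j) * V = scaleTF (ε j) V :=
  scaleTF_eq_mul.symm

/-- Certification of the reduced interconnected system from the scaled matrix inequality for a
plant `N` with repeated uncertainty `ΔA` and unrepeated uncertainty `ΔF`. -/
theorem certified_of_scaledLMI {A A' F F' : Type} [Fintype A] [Fintype A'] [Fintype F] [Fintype F']
    [DecidableEq A] [DecidableEq A'] [DecidableEq F] [DecidableEq F']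
    (hS : StandingAssumption S Sig) {VC : TF (Fin pC) (Fin pC)} {WC : TF (Fin mC) (Fin mC)}
    (hVC : Bistable VC) (hWC : Bistable WC)
    {N : TF (Chan A F (Fin pC)) (Chan A' F' (Fin mC))} {ΔA : TF A' A} {ΔF : TF F' F}
    {B : TF (A ⊕ (F ⊕ A)) (Idx m)} {C : TF (Idx p) (A' ⊕ (F' ⊕ A'))}
    (hN22 : N.toBlocks₂₂ = 0)
    (hN12 : N.toBlocks₁₂ = B * S.toBlocks₂₁) (hN21 : N.toBlocks₂₁ = S.toBlocks₁₂ * C)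
    (hN : EntriesIn rhSubring N) (hΔA : EntriesIn rhSubring ΔA) (hΔF : EntriesIn rhSubring ΔF)
    (hB : EntriesIn rhSubring B) (hC : EntriesIn rhSubring C)
    {Xε : Matrix A A ℂ} {Yε : Matrix F F ℂ} (hXε : Xεᴴ = Xε) (hYε : Yεᴴ = Yε)
    {Xv Xs Xi : TF A A} {Yv Ys Yi : TF F F} {Xw Xj : TF A' A'} {Yw Yj : TF F' F'}
    (hXs : constTF Xε * Xv = Xs) (hYs : constTF Yε * Yv = Ys)
    (hXi : EntriesIn stableProper Xs ∧ EntriesIn stableProper Xi ∧ Xs * Xi = 1)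
    (hYi : EntriesIn stableProper Ys ∧ EntriesIn stableProper Yi ∧ Ys * Yi = 1)
    (hXv : EntriesIn stableProper Xv) (hYv : EntriesIn stableProper Yv)
    (hXj : EntriesIn stableProper Xw ∧ EntriesIn stableProper Xj ∧ Xw * Xj = 1)
    (hYj : EntriesIn stableProper Yw ∧ EntriesIn stableProper Yj ∧ Yw * Yj = 1)
    {Ql : Matrix (A ⊕ (F ⊕ A)) (A ⊕ (F ⊕ A)) ℂ} {Qr : Matrix (A' ⊕ (F' ⊕ A')) (A' ⊕ (F' ⊕ A')) ℂ}
    (hQl : IsUnit Ql.det) (hQr : IsUnit Qr.det) {η d : ℝ} (hη : 0 ≤ η) (hηd : √(1 - η) * d < 1)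
    (hlmi : ScaledLMI η (diagChan Xε Yε 1) (diagChan Xv Yv VC * N * diagChan Xw Yw WC)
      (fromBlocks (Ql * Qlᴴ) 0 0 1, fromBlocks (Qr * Qrᴴ) 0 0 1))
    (hcomm : ∀ ω, Qr * errDiag (freqResp (Xj * ΔA * Xi) ω) (freqResp (Yj * ΔF * Yi) ω) =
      errDiag (freqResp (Xj * ΔA * Xi) ω) (freqResp (Yj * ΔF * Yi) ω) * Ql)
    (hdA : ∀ ω, ‖freqResp (Xj * ΔA * Xi) ω‖ ≤ d) (hdF : ∀ ω, ‖freqResp (Yj * ΔF * Yi) ω‖ ≤ d)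
    (hsol : ∀ T, T = N.toBlocks₁₁ * (errDiag ΔA ΔF * T) + B →
      ∃ ζ : TF (Idx p) (Idx m), ζ = plantM S Sig + C * (errDiag ΔA ΔF * T) ∧
        IsUnit (1 - S.toBlocks₂₂ * parB SigR).det ∧
        (1 - S.toBlocks₂₂ * parB SigR)⁻¹ = 1 + S.toBlocks₂₂ * ζ ∧
        parB SigR * (1 - S.toBlocks₂₂ * parB SigR)⁻¹ = ζ) :
    ReducedModelCertified S Sig SigR VC WC := by
  have hNs := hN.mono rhSubring_le_stableProper
  have hD : EntriesIn rhSubring (errDiag ΔA ΔF) := hΔA.errDiag hΔF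
  have hV := (bistable_entriesIn hVC).1
  have hW := (bistable_entriesIn hWC).1
  have hP : EntriesIn stableProper (diagChan Xv Yv VC * N * diagChan Xw Yw WC) :=
    ((hXv.diagChan hYv hV).mul hNs).mul (hXj.1.diagChan hYj.1 hW)
  have hDe : errDiag Xj Yj * errDiag ΔA ΔF * errDiag Xi Yi =
      errDiag (Xj * ΔA * Xi) (Yj * ΔF * Yi) := by
    rw [errDiag_mul, errDiag_mul]
  have hfr : ∀ ω, freqResp (errDiag (Xj * ΔA * Xi) (Yj * ΔF * Yi)) ω =
      errDiag (freqResp (Xj * ΔA * Xi) ω) (freqResp (Yj * ΔF * Yi) ω) := fun ω => evalMat_errDiag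
  refine certified_of_plant hS hN12 hN21 hN hD hB hC ?_ hηd hsol
  refine smallGain_scaled (Vs := errDiag Xs Ys) (Vi := errDiag Xi Yi) (Ws := errDiag Xw Yw)
    (Wi := errDiag Xj Yj) hNs hN22 (hD.mono rhSubring_le_stableProper) (hXi.1.errDiag hYi.1)
    (hXi.2.1.errDiag hYi.2.1) ?_ (hXj.1.errDiag hYj.1) (hXj.2.1.errDiag hYj.2.1) ?_ hV hW hQl hQr
    ?_ ?_ ?_ hη hηd
  · rw [errDiag_mul, hXi.2.2, hYi.2.2, errDiag_one]
  · rw [errDiag_mul, hXj.2.2, hYj.2.2, errDiag_one]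
  · intro ω
    have h := hlmi.posSemidef
      (by rw [diagChan_conjTranspose, hXε, hYε, conjTranspose_one]) hP ω
    -- The diagonal `ε` merges with the unscaled weights `Xv`, `Yv` into the scaled weights `Xs`,
    -- `Ys`.
    rw [← Matrix.mul_assoc, ← Matrix.mul_assoc, constTF_diagChan_mul, hXs, hYs] at h
    exact h
  · intro ω
    rw [hDe, hfr]
    exact hcomm ω
  · intro ω
    rw [hDe, hfr]
    exact opNorm_errDiag_le (hdA ω) (hdF ω)

end Systems

/-! ### Environment abstraction -/

section EnvironmentAbstraction

variable {k pC mC : ℕ} {m p : Fin k → ℕ} {S : TF (Fin pC ⊕ Idx m) (Fin mC ⊕ Idx p)}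
  {Sig SigR : ∀ j, TF (Fin (p j)) (Fin (m j))}

/-- The sorting of the error channels for environment abstraction. -/
def sortErrEnv {n q : Fin k → ℕ} :
    Idx n ⊕ (Idx q ⊕ Idx n) → ((j : Fin k) × (Fin 2 × Fin (n j))) ⊕ Idx q :=
  Sum.elim (fun x => Sum.inl ⟨x.1, (0, x.2)⟩)
    (Sum.elim Sum.inr fun x => Sum.inl ⟨x.1, (1, x.2)⟩)

lemma sortErrEnv_bijective {n q : Fin k → ℕ} :
    (sortErrEnv : Idx n ⊕ (Idx q ⊕ Idx n) → _).Bijective := by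
  refine Function.bijective_iff_has_inverse.2 ⟨Sum.elim
    (fun y => if y.2.1 = 0 then Sum.inl ⟨y.1, y.2.2⟩ else Sum.inr (Sum.inr ⟨y.1, y.2.2⟩))
    fun y => Sum.inr (Sum.inl y), ?_, ?_⟩
  · rintro (x | y | x) <;> rfl
  · rintro (⟨j, t, x⟩ | y)
    · fin_cases t <;> rfl
    · rfl

/-- The identity factor in `I ⊗ X` means that the copies do not interact, so unsorting recovers
`diag(X, Y, X)`. -/
lemma repeatedUnc_sortErrEnv {n n' q q' : Fin k → ℕ} (X : ∀ j, Matrix (Fin (n j)) (Fin (n' j)) ℂ)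
    (Y : ∀ j, Matrix (Fin (q j)) (Fin (q' j)) ℂ) :
    (repeatedUnc (fun _ => Fin 2) X Y).submatrix sortErrEnv sortErrEnv =
      errDiag (blockDiagonal' X) (blockDiagonal' Y) := by
  ext (⟨i, x⟩ | ⟨i, x⟩ | ⟨i, x⟩) (⟨j, x'⟩ | ⟨j, x'⟩ | ⟨j, x'⟩) <;>
    rcases eq_or_ne i j with rfl | h <;>
    simp [sortErrEnv, repeatedUnc, errDiag, blockDiagonal'_apply_ne, *]

lemma StandingAssumption.entriesIn_env (hS : StandingAssumption S Sig) (j : Fin k) :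
    EntriesIn rhSubring (env S Sig j) := by
  have h1 : EntriesIn rhSubring (permS S j) := (rhInf_iff.1 hS.2.1).submatrix _ _
  have h2 := rhInf_iff.1 (hS.2.2.1 j).2
  rw [env, llft, Matrix.mul_assoc _ (parOff Sig j)]
  exact ((h1.toBlocks₁₂.mul h2).mul h1.toBlocks₂₁).add h1.toBlocks₁₁

/-- Environment abstraction, for any trade-off of the margins in the matrix inequality and in the
low-level specifications. -/
theorem certified_of_environment_abstraction (hS : StandingAssumption S Sig)
    {VC : TF (Fin pC) (Fin pC)} {WC : TF (Fin mC) (Fin mC)} (hVC : Bistable VC) (hWC : Bistable WC)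
    {WF : ∀ j, TF (Fin (p j)) (Fin (p j))} {VcF : ∀ j, TF (Fin (m j)) (Fin (m j))}
    (hWF : ∀ j, Bistable (WF j)) (hVcF : ∀ j, Bistable (VcF j))
    {WE : ∀ j, TF (Fin (m j)) (Fin (m j))} {VcE : ∀ j, TF (Fin (p j)) (Fin (p j))}
    {εE εF : Fin k → ℝ} {Eh ΔE : ∀ j, TF (Fin (m j)) (Fin (p j))}
    {ΔF : ∀ j, TF (Fin (p j)) (Fin (m j))}
    (hΔE : ∀ j, ΔE j = Eh j - (env S Sig j).toBlocks₂₂)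
    (h2 : ∀ j, IsUnit (1 - Eh j * Sig j).det) (h3 : ∀ j, IsUnit (1 - Eh j * SigR j).det)
    (hΔF : ∀ j, ΔF j = SigR j * (1 - Eh j * SigR j)⁻¹ - Sig j * (1 - Eh j * Sig j)⁻¹)
    (hWE : ∀ j, Bistable (WE j)) (hVcE : ∀ j, Bistable (VcE j))
    (hRE : ∀ j, RHinf (ΔE j)) (hRF : ∀ j, RHinf (ΔF j))
    (hεE : ∀ j, 0 < εE j) (hεF : ∀ j, 0 < εF j) {η d : ℝ} (hη : 0 ≤ η) (hd : 0 ≤ d)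
    (hηd : √(1 - η) * d < 1)
    (hlmi : ∃ D ∈ scalEnv k pC mC m p, ScaledLMI η
      (boldEnv (scalarBlocks p εE) (scalarBlocks m εF) 1)
      (weightedPlantEnv S Sig VcE VcF VC WE WF WC) D)
    (hE : ∀ j, weightedNorm (WE j) (scaleTF (εE j) (VcE j)) (ΔE j) ≤ ENNReal.ofReal d)
    (hF : ∀ j, weightedNorm (WF j) (scaleTF (εF j) (VcF j)) (ΔF j) ≤ ENNReal.ofReal d) :
    ReducedModelCertified S Sig SigR VC WC := by
  obtain ⟨⟨Dl, Dr⟩, ⟨T, δ, hT, hδ, rfl, rfl⟩, hlmi⟩ := hlmi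
  obtain ⟨Ql, Qr, hQl, hQr, hl, hr, hcomm⟩ := exists_scaling_factors hT hδ
    (sortErrEnv_bijective (n := p) (q := m)) (sortErrEnv_bijective (n := m) (q := p))
  set M := plantM S Sig with hM
  set Z := S.toBlocks₂₂ - blockDiagonal' fun j => (env S Sig j).toBlocks₂₂ with hZ
  have hSr := rhInf_iff.1 hS.2.1
  have hMr : EntriesIn rhSubring M := hS.entriesIn_plantM
  have hZr : EntriesIn rhSubring Z :=
    hSr.toBlocks₂₂.sub (.blockDiagonal' fun j => (hS.entriesIn_env j).toBlocks₂₂)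
  have hMZ : EntriesIn rhSubring (1 + M * Z) := EntriesIn.one.add (hMr.mul hZr)
  have hZM : EntriesIn rhSubring (1 + Z * M) := EntriesIn.one.add (hZr.mul hMr)
  have sE := fun j => scaleTF_spec (hεE j) (hVcE j)
  have sF := fun j => scaleTF_spec (hεF j) (hVcF j)
  have wE := fun j => bistable_entriesIn (hWE j)
  have wF := fun j => bistable_entriesIn (hWF j)
  have nE := fun j => freqResp_le_of_weightedNorm hd (hE j)
  have nF := fun j => freqResp_le_of_weightedNorm hd (hF j)
  -- `B` is the external column of `N` without its factor `S₂₁`, and `C` the external row without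
  -- `S₁₂`.
  refine certified_of_scaledLMI (N := plantEnv S Sig) (ΔA := blockDiagonal' ΔE)
    (ΔF := blockDiagonal' ΔF) (B := fromRows M (fromRows (1 + Z * M) M))
    (C := fromCols (-M) (fromCols (1 + M * Z) M))
    (Xε := blockDiagonal' (scalarBlocks p εE)) (Yε := blockDiagonal' (scalarBlocks m εF))
    (Xv := blockDiagonal' VcE) (Yv := blockDiagonal' VcF)
    (Xw := blockDiagonal' WE) (Yw := blockDiagonal' WF)
    (Xs := blockDiagonal' fun j => scaleTF (εE j) (VcE j))
    (Ys := blockDiagonal' fun j => scaleTF (εF j) (VcF j))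
    (Xi := blockDiagonal' fun j => (scaleTF (εE j) (VcE j))⁻¹)
    (Yi := blockDiagonal' fun j => (scaleTF (εF j) (VcF j))⁻¹)
    (Xj := blockDiagonal' fun j => (WE j)⁻¹) (Yj := blockDiagonal' fun j => (WF j)⁻¹)
    (Ql := Ql) (Qr := Qr) (η := η) (d := d)
    hS hVC hWC rfl ?_ ?_ ?_ (.blockDiagonal' fun j => rhInf_iff.1 (hRE j))
    (.blockDiagonal' fun j => rhInf_iff.1 (hRF j)) (.fromRows hMr (.fromRows hZM hMr))
    (.fromCols hMr.neg (.fromCols hMZ hMr)) ?_ ?_ ?_ ?_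
    ⟨.blockDiagonal' fun j => (sE j).1, .blockDiagonal' fun j => (sE j).2.1,
      blockDiagonal'_mul_eq_one fun j => (sE j).2.2⟩
    ⟨.blockDiagonal' fun j => (sF j).1, .blockDiagonal' fun j => (sF j).2.1,
      blockDiagonal'_mul_eq_one fun j => (sF j).2.2⟩
    (.blockDiagonal' fun j => (bistable_entriesIn (hVcE j)).1)
    (.blockDiagonal' fun j => (bistable_entriesIn (hVcF j)).1)
    ⟨.blockDiagonal' fun j => (wE j).1, .blockDiagonal' fun j => (wE j).2,
      blockDiagonal'_mul_eq_one fun j => mul_nonsing_inv _ (hWE j).2.1⟩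
    ⟨.blockDiagonal' fun j => (wF j).1, .blockDiagonal' fun j => (wF j).2,
      blockDiagonal'_mul_eq_one fun j => mul_nonsing_inv _ (hWF j).2.1⟩
    hQl hQr hη hηd ?_ ?_ ?_ ?_ ?_
  · simp [plantEnv, blocksChan, fromRows_mul, ← hM, ← hZ]
  · simp [plantEnv, blocksChan, mul_fromCols, ← hM, ← hZ]
  · exact .blocksChan hMr.neg hMZ hMr (hMr.mul hSr.toBlocks₂₁)
      ((hZr.mul hMr).neg.sub .one) (hZr.mul hMZ) (hZr.mul hMr) (hZM.mul hSr.toBlocks₂₁)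
      hMr.neg (hMr.mul hZr) hMr (hMr.mul hSr.toBlocks₂₁)
      (hSr.toBlocks₁₂.mul hMr).neg (hSr.toBlocks₁₂.mul hMZ) (hSr.toBlocks₁₂.mul hMr) .zero
  · rw [blockDiagonal'_conjTranspose]
    simp only [scalarBlocks_conjTranspose]
  · rw [blockDiagonal'_conjTranspose]
    simp only [scalarBlocks_conjTranspose]
  · rw [constTF_blockDiagonal', ← blockDiagonal'_mul]
    simp only [constTF_scalarBlocks_mul]
  · rw [constTF_blockDiagonal', ← blockDiagonal'_mul]
    simp only [constTF_scalarBlocks_mul]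
  · rw [← hl, ← hr, ← sortedScaling_submatrix, ← sortedScaling_submatrix]
    exact hlmi
  · intro ω
    rw [← blockDiagonal'_mul, ← blockDiagonal'_mul, ← blockDiagonal'_mul, ← blockDiagonal'_mul]
    simp only [freqResp_eq_evalMat, evalMat_blockDiagonal']
    rw [← repeatedUnc_sortErrEnv]
    exact hcomm _ _
  · intro ω
    rw [← blockDiagonal'_mul, ← blockDiagonal'_mul, freqResp_eq_evalMat, evalMat_blockDiagonal']
    exact opNorm_blockDiagonal'_le hd fun j => nE j ω
  · intro ω
    rw [← blockDiagonal'_mul, ← blockDiagonal'_mul, freqResp_eq_evalMat, evalMat_blockDiagonal']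
    exact opNorm_blockDiagonal'_le hd fun j => nF j ω
  · intro T hTeq
    obtain ⟨T₁, T₂, T₃, rfl⟩ : ∃ T₁ T₂ T₃, T = fromRows T₁ (fromRows T₂ T₃) :=
      ⟨T.toRows₁, T.toRows₂.toRows₁, T.toRows₂.toRows₂, by simp⟩
    have hb := loop_blocks (N₁₁ := -M) (N₁₂ := 1 + M * Z) (N₁₃ := M) (N₂₁ := -(Z * M) - 1)
      (N₂₂ := Z * (1 + M * Z)) (N₂₃ := Z * M) (N₃₁ := -M) (N₃₂ := M * Z) (N₃₃ := M) hTeq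
    obtain ⟨g2, g3, gF⟩ := blockDiagonal'_errF h2 h3 hΔF
    obtain ⟨e1, e2, e3⟩ := hb
    have hr1 : T₁ = -(M * (blockDiagonal' ΔE * T₁)) + (1 + M * Z) * (blockDiagonal' ΔF * T₂) +
        M * (blockDiagonal' ΔE * T₃) + M := by
      rw [← Matrix.neg_mul]
      exact e1
    -- `C` coincides with the first row of the plant, so `ζ` is the first loop signal itself.
    refine ⟨T₁, ?_, reduced_loop_of_solution (E := blockDiagonal' fun j =>
      (env S Sig j).toBlocks₂₂) hS.2.2.2.1.1 g2 g3 hM hZ ?_ gF hr1 e2 ?_⟩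
    · rw [errDiag_mul_fromRows, fromCols_mul_fromRows, fromCols_mul_fromRows]
      refine e1.trans ?_
      abel
    · rw [← blockDiagonal'_sub]
      congr 1
      exact funext hΔE
    · rw [← Matrix.neg_mul]
      exact e3

end EnvironmentAbstraction

/-! ### Subsystem abstraction -/

section SubsystemAbstraction

variable {k pC mC : ℕ} {m p : Fin k → ℕ} {S : TF (Fin pC ⊕ Idx m) (Fin mC ⊕ Idx p)}
  {Sig SigR : ∀ j, TF (Fin (p j)) (Fin (m j))}

/-- The sorting of the error channels for subsystem abstraction. -/
def sortErrSys {n q : Fin k → ℕ} : IdxOffs n ⊕ (Idx q ⊕ IdxOffs n) →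
    ((l : Fin k) × ((Fin 2 × {j : Fin k // j ≠ l}) × Fin (n l))) ⊕ Idx q :=
  Sum.elim (fun x => Sum.inl ⟨x.2.1.1, ((0, ⟨x.1, x.2.1.2.symm⟩), x.2.2)⟩)
    (Sum.elim Sum.inr fun x => Sum.inl ⟨x.2.1.1, ((1, ⟨x.1, x.2.1.2.symm⟩), x.2.2)⟩)

/-- Sorting exchanges the roles in the pair (environment `j`, subsystem `l ≠ j`): grouped by `j`
before, by `l` after. -/
lemma sortErrSys_bijective {n q : Fin k → ℕ} :
    (sortErrSys : IdxOffs n ⊕ (Idx q ⊕ IdxOffs n) → _).Bijective := by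
  refine Function.bijective_iff_has_inverse.2 ⟨Sum.elim
    (fun y => if y.2.1.1 = 0 then Sum.inl ⟨y.2.1.2.1, ⟨⟨y.1, y.2.1.2.2.symm⟩, y.2.2⟩⟩
      else Sum.inr (Sum.inr ⟨y.2.1.2.1, ⟨⟨y.1, y.2.1.2.2.symm⟩, y.2.2⟩⟩))
    fun y => Sum.inr (Sum.inl y), ?_, ?_⟩
  · rintro (x | y | x) <;> rfl
  · rintro (⟨j, ⟨t, i⟩, x⟩ | y)
    · fin_cases t <;> rfl
    · rfl

/-- For every `j`, the block diagonal matrix of all `X l` with `l ≠ j`. -/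
def offDiag {R : Type} [Zero R] {n n' : Fin k → ℕ} (X : ∀ j, Matrix (Fin (n j)) (Fin (n' j)) R) :
    Matrix (IdxOffs n) (IdxOffs n') R :=
  blockDiagonal' fun j => blockDiagonal' fun l : {l : Fin k // l ≠ j} => X l

/-- Flattening the nested block structure turns comparison of entries into a case split on the outer
and inner indices. -/
lemma offDiag_apply {R : Type} [Zero R] {n n' : Fin k → ℕ}
    (X : ∀ j, Matrix (Fin (n j)) (Fin (n' j)) R) (x : IdxOffs n) (y : IdxOffs n') :
    offDiag X x y = if x.1 = y.1 then blockDiagonal' X ⟨x.2.1, x.2.2⟩ ⟨y.2.1, y.2.2⟩ else 0 := by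
  obtain ⟨i, ⟨l, hl⟩, x⟩ := x
  obtain ⟨j, ⟨l', hl'⟩, y⟩ := y
  rcases eq_or_ne i j with rfl | h
  · rcases eq_or_ne l l' with rfl | h'
    · simp [offDiag]
    · simp [offDiag, blockDiagonal'_apply_ne, h']
  · simp [offDiag, blockDiagonal'_apply_ne, h]

lemma repeatedUnc_sortErrSys {n n' q q' : Fin k → ℕ} (X : ∀ j, Matrix (Fin (n j)) (Fin (n' j)) ℂ)
    (Y : ∀ j, Matrix (Fin (q j)) (Fin (q' j)) ℂ) :
    (repeatedUnc (fun l : Fin k => Fin 2 × {j : Fin k // j ≠ l}) X Y).submatrix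
      sortErrSys sortErrSys = errDiag (offDiag X) (blockDiagonal' Y) := by
  ext (⟨i, ⟨l, hl⟩, x⟩ | ⟨l, x⟩ | ⟨i, ⟨l, hl⟩, x⟩) (⟨j, ⟨l', hl'⟩, x'⟩ | ⟨l', x'⟩ | ⟨j, ⟨l', hl'⟩, x'⟩) <;>
    rcases eq_or_ne l l' with rfl | h <;>
    simp [sortErrSys, repeatedUnc, errDiag, offDiag_apply, blockDiagonal'_apply_ne,
      Matrix.one_apply, *]

section OffDiag

variable {R : Type} [CommRing R] {n n' n'' : Fin k → ℕ}

lemma offDiag_mul (X : ∀ j, Matrix (Fin (n j)) (Fin (n' j)) R)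
    (Y : ∀ j, Matrix (Fin (n' j)) (Fin (n'' j)) R) :
    offDiag X * offDiag Y = offDiag fun j => X j * Y j := by
  simp only [offDiag, ← blockDiagonal'_mul]

lemma offDiag_mul_eq_one {X Y : ∀ j, Matrix (Fin (n j)) (Fin (n j)) R} (h : ∀ j, X j * Y j = 1) :
    offDiag X * offDiag Y = 1 :=
  blockDiagonal'_mul_eq_one fun _ => blockDiagonal'_mul_eq_one fun l => h l

end OffDiag

lemma EntriesIn.offDiag {R : Subring (RatFunc ℂ)} {n n' : Fin k → ℕ}
    {X : ∀ j, TF (Fin (n j)) (Fin (n' j))} (hX : ∀ j, EntriesIn R (X j)) :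
    EntriesIn R (offDiag X) :=
  .blockDiagonal' fun _ => .blockDiagonal' fun l => hX l

lemma evalMat_offDiag {n n' : Fin k → ℕ} {z : ℂ} {X : ∀ j, TF (Fin (n j)) (Fin (n' j))} :
    evalMat z (offDiag X) = offDiag fun j => evalMat z (X j) := by
  simp only [offDiag, evalMat_blockDiagonal']

lemma constTF_offDiag {n n' : Fin k → ℕ} {X : ∀ j, Matrix (Fin (n j)) (Fin (n' j)) ℂ} :
    constTF (offDiag X) = offDiag fun j => constTF (X j) := by
  simp only [offDiag, constTF_blockDiagonal']

lemma offDiag_conjTranspose {n n' : Fin k → ℕ} {X : ∀ j, Matrix (Fin (n j)) (Fin (n' j)) ℂ} :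
    (offDiag X)ᴴ = offDiag fun j => (X j)ᴴ := by
  simp only [offDiag, blockDiagonal'_conjTranspose]

lemma opNorm_offDiag_le {n n' : Fin k → ℕ} {X : ∀ j, Matrix (Fin (n j)) (Fin (n' j)) ℂ} {d : ℝ}
    (hd : 0 ≤ d) (h : ∀ j, ‖X j‖ ≤ d) : ‖offDiag X‖ ≤ d :=
  opNorm_blockDiagonal'_le hd fun _ => opNorm_blockDiagonal'_le hd fun l => h l

lemma StandingAssumption.entriesIn_extEnv (hS : StandingAssumption S Sig) (j : Fin k) :
    EntriesIn rhSubring (extEnv S Sig j) := by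
  have h1 : EntriesIn rhSubring (permS S j) := (rhInf_iff.1 hS.2.1).submatrix _ _
  have hjj : EntriesIn rhSubring (permS S j).toBlocks₁₁.toBlocks₂₂ := h1.toBlocks₁₁.toBlocks₂₂
  have hjl : EntriesIn rhSubring (permS S j).toBlocks₁₂.toRows₂ := fun _ _ => h1 _ _
  have hlj : EntriesIn rhSubring (permS S j).toBlocks₂₁.toCols₂ := fun _ _ => h1 _ _
  have hll : EntriesIn rhSubring (permS S j).toBlocks₂₂ := h1.toBlocks₂₂
  have hQ : EntriesIn rhSubring
      (parOff Sig j * (1 - (permS S j).toBlocks₂₂ * parOff Sig j)⁻¹) :=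
    rhInf_iff.1 (hS.2.2.1 j).2
  have hL : EntriesIn rhSubring (1 - (permS S j).toBlocks₂₂ * parOff Sig j)⁻¹ := by
    -- Internal stability controls `Σ̄ L` rather than `L`, but `L = 1 + S^{ll} (Σ̄ L)`.
    have h : (1 - (permS S j).toBlocks₂₂ * parOff Sig j)⁻¹ = 1 + (permS S j).toBlocks₂₂ *
        (parOff Sig j * (1 - (permS S j).toBlocks₂₂ * parOff Sig j)⁻¹) := by
      have e := mul_nonsing_inv _ (hS.2.2.1 j).1.1
      rw [Matrix.sub_mul, Matrix.one_mul, sub_eq_iff_eq_add, Matrix.mul_assoc] at e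
      exact e
    rw [h]
    exact EntriesIn.one.add (hll.mul hQ)
  refine .fromBlocks (hjj.add ?_) (hjl.mul (EntriesIn.one.add (hQ.mul hll))) (hL.mul hlj)
    (hL.mul hll)
  rw [Matrix.mul_assoc _ (parOff Sig j)]
  exact (hjl.mul hQ).mul hlj

lemma env_toBlocks₂₂ (Sg : ∀ j, TF (Fin (p j)) (Fin (m j))) (j : Fin k) :
    (env S Sg j).toBlocks₂₂ = (permS S j).toBlocks₁₁.toBlocks₂₂ +
      (permS S j).toBlocks₁₂.toRows₂ * parOff Sg j *
        (1 - (permS S j).toBlocks₂₂ * parOff Sg j)⁻¹ * (permS S j).toBlocks₂₁.toCols₂ := by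
  rw [add_comm]
  ext i l
  simp only [env, llft, toBlocks₂₂, Matrix.of_apply, Matrix.add_apply]
  rfl

/-- Hence `Y` of the subsystem plant is the same matrix as `Z` of the environment plant. -/
lemma env_eq_extEnv (j : Fin k) :
    (env S Sig j).toBlocks₂₂ = (extEnv S Sig j).toBlocks₁₁ := env_toBlocks₂₂ Sig j

/-- The abstraction error of an environment in terms of the abstraction errors of the other
subsystems. -/
lemma env_sub_env {SigA ΔA : ∀ j, TF (Fin (p j)) (Fin (m j))} (j : Fin k)
    (hΔ : ∀ j, ΔA j = SigA j - Sig j)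
    (h : IsUnit (1 - (permS S j).toBlocks₂₂ * parOff Sig j).det)
    (ha : IsUnit (1 - (permS S j).toBlocks₂₂ * parOff SigA j).det) :
    IsUnit (1 - (extEnv S Sig j).toBlocks₂₂ * parOff ΔA j).det ∧
    (env S SigA j).toBlocks₂₂ - (extEnv S Sig j).toBlocks₁₁ =
      (extEnv S Sig j).toBlocks₁₂ * parOff ΔA j *
        (1 - (extEnv S Sig j).toBlocks₂₂ * parOff ΔA j)⁻¹ * (extEnv S Sig j).toBlocks₂₁ := by
  have hd : parOff ΔA j = parOff SigA j - parOff Sig j := by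
    rw [parOff, parOff, parOff, ← blockDiagonal'_sub]
    congr 1
    exact funext fun l => hΔ l
  obtain ⟨h1, h2⟩ := lft_perturbation (Sjl := (permS S j).toBlocks₁₂.toRows₂)
    (Slj := (permS S j).toBlocks₂₁.toCols₂) h ha
  rw [hd]
  refine ⟨h1, ?_⟩
  rw [← env_eq_extEnv, env_toBlocks₂₂, env_toBlocks₂₂, add_sub_add_left_eq_sub]
  exact h2

/-- Subsystem abstraction, for any trade-off of the margins in the matrix inequality and in the
low-level specifications. -/
theorem certified_of_subsystem_abstraction (hS : StandingAssumption S Sig)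
    {VC : TF (Fin pC) (Fin pC)} {WC : TF (Fin mC) (Fin mC)} (hVC : Bistable VC) (hWC : Bistable WC)
    {WF : ∀ j, TF (Fin (p j)) (Fin (p j))} {VcF : ∀ j, TF (Fin (m j)) (Fin (m j))}
    (hWF : ∀ j, Bistable (WF j)) (hVcF : ∀ j, Bistable (VcF j))
    {WA : ∀ j, TF (Fin (p j)) (Fin (p j))} {VcA : ∀ j, TF (Fin (m j)) (Fin (m j))}
    {εA εF : Fin k → ℝ} {SigA ΔA ΔF : ∀ j, TF (Fin (p j)) (Fin (m j))}
    (hΔA : ∀ j, ΔA j = SigA j - Sig j)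
    (h1 : ∀ j, IsUnit (1 - (permS S j).toBlocks₂₂ * parOff SigA j).det)
    (h2 : ∀ j, IsUnit (1 - (env S SigA j).toBlocks₂₂ * Sig j).det)
    (h3 : ∀ j, IsUnit (1 - (env S SigA j).toBlocks₂₂ * SigR j).det)
    (hΔF : ∀ j, ΔF j = SigR j * (1 - (env S SigA j).toBlocks₂₂ * SigR j)⁻¹ -
      Sig j * (1 - (env S SigA j).toBlocks₂₂ * Sig j)⁻¹)
    (hWA : ∀ j, Bistable (WA j)) (hVcA : ∀ j, Bistable (VcA j))
    (hRA : ∀ j, RHinf (ΔA j)) (hRF : ∀ j, RHinf (ΔF j))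
    (hεA : ∀ j, 0 < εA j) (hεF : ∀ j, 0 < εF j) {η d : ℝ} (hη : 0 ≤ η) (hd : 0 ≤ d)
    (hηd : √(1 - η) * d < 1)
    (hlmi : ∃ D ∈ scalSys k pC mC m p, ScaledLMI η
      (boldSys (scalarBlocks m εA) (scalarBlocks m εF) 1)
      (weightedPlantSys S Sig VcA VcF VC WA WF WC) D)
    (hA : ∀ j, weightedNorm (WA j) (scaleTF (εA j) (VcA j)) (ΔA j) ≤ ENNReal.ofReal d)
    (hF : ∀ j, weightedNorm (WF j) (scaleTF (εF j) (VcF j)) (ΔF j) ≤ ENNReal.ofReal d) :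
    ReducedModelCertified S Sig SigR VC WC := by
  obtain ⟨⟨Dl, Dr⟩, ⟨T, δ, hT, hδ, rfl, rfl⟩, hlmi⟩ := hlmi
  obtain ⟨Ql, Qr, hQl, hQr, hl, hr, hcomm⟩ := exists_scaling_factors hT hδ
    (sortErrSys_bijective (n := m) (q := m)) (sortErrSys_bijective (n := p) (q := p))
  set M := plantM S Sig with hM
  set E₁₁ : TF (Idx m) (Idx p) := blockDiagonal' fun j => (extEnv S Sig j).toBlocks₁₁ with hE₁₁
  set E₁₂ : TF (Idx m) (IdxOffs p) := blockDiagonal' fun j => (extEnv S Sig j).toBlocks₁₂ with hE₁₂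
  set E₂₁ : TF (IdxOffs m) (Idx p) := blockDiagonal' fun j => (extEnv S Sig j).toBlocks₂₁ with hE₂₁
  set E₂₂ : TF (IdxOffs m) (IdxOffs p) := blockDiagonal' fun j => (extEnv S Sig j).toBlocks₂₂
    with hE₂₂
  set Y := S.toBlocks₂₂ - E₁₁ with hY
  have hN : plantSys S Sig = blocksChan
      (E₂₂ - E₂₁ * M * E₁₂) (E₂₁ * (1 + M * Y)) (E₂₁ * M * E₁₂) (E₂₁ * M * S.toBlocks₂₁)
      (-(Y * M * E₁₂) - E₁₂) (Y * (1 + M * Y)) (Y * M * E₁₂) ((1 + Y * M) * S.toBlocks₂₁)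
      (-(E₂₁ * M * E₁₂)) (E₂₁ * M * Y) (E₂₂ + E₂₁ * M * E₁₂) (E₂₁ * M * S.toBlocks₂₁)
      (-(S.toBlocks₁₂ * M * E₁₂)) (S.toBlocks₁₂ * (1 + M * Y)) (S.toBlocks₁₂ * M * E₁₂) 0 := rfl
  have hSr := rhInf_iff.1 hS.2.1
  have hMr : EntriesIn rhSubring M := hS.entriesIn_plantM
  have r₁₁ : EntriesIn rhSubring E₁₁ := .blockDiagonal' fun j => (hS.entriesIn_extEnv j).toBlocks₁₁
  have r₁₂ : EntriesIn rhSubring E₁₂ := .blockDiagonal' fun j => (hS.entriesIn_extEnv j).toBlocks₁₂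
  have r₂₁ : EntriesIn rhSubring E₂₁ := .blockDiagonal' fun j => (hS.entriesIn_extEnv j).toBlocks₂₁
  have r₂₂ : EntriesIn rhSubring E₂₂ := .blockDiagonal' fun j => (hS.entriesIn_extEnv j).toBlocks₂₂
  have hYr : EntriesIn rhSubring Y := hSr.toBlocks₂₂.sub r₁₁
  have hMY : EntriesIn rhSubring (1 + M * Y) := EntriesIn.one.add (hMr.mul hYr)
  have hYM : EntriesIn rhSubring (1 + Y * M) := EntriesIn.one.add (hYr.mul hMr)
  have h2M := r₂₁.mul hMr
  have h2M1 := h2M.mul r₁₂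
  have hYM1 := (hYr.mul hMr).mul r₁₂
  have hSM1 := (hSr.toBlocks₁₂.mul hMr).mul r₁₂
  have sA := fun j => scaleTF_spec (hεA j) (hVcA j)
  have sF := fun j => scaleTF_spec (hεF j) (hVcF j)
  have wA := fun j => bistable_entriesIn (hWA j)
  have wF := fun j => bistable_entriesIn (hWF j)
  have nA := fun j => freqResp_le_of_weightedNorm hd (hA j)
  have nF := fun j => freqResp_le_of_weightedNorm hd (hF j)
  refine certified_of_scaledLMI (N := plantSys S Sig) (ΔA := offDiag ΔA)
    (ΔF := blockDiagonal' ΔF) (B := fromRows (E₂₁ * M) (fromRows (1 + Y * M) (E₂₁ * M)))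
    (C := fromCols (-(M * E₁₂)) (fromCols (1 + M * Y) (M * E₁₂)))
    (Xε := offDiag (scalarBlocks m εA)) (Yε := blockDiagonal' (scalarBlocks m εF))
    (Xv := offDiag VcA) (Yv := blockDiagonal' VcF)
    (Xw := offDiag WA) (Yw := blockDiagonal' WF)
    (Xs := offDiag fun j => scaleTF (εA j) (VcA j))
    (Ys := blockDiagonal' fun j => scaleTF (εF j) (VcF j))
    (Xi := offDiag fun j => (scaleTF (εA j) (VcA j))⁻¹)
    (Yi := blockDiagonal' fun j => (scaleTF (εF j) (VcF j))⁻¹)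
    (Xj := offDiag fun j => (WA j)⁻¹) (Yj := blockDiagonal' fun j => (WF j)⁻¹)
    (Ql := Ql) (Qr := Qr) (η := η) (d := d)
    hS hVC hWC rfl ?_ ?_ ?_ (.offDiag fun j => rhInf_iff.1 (hRA j))
    (.blockDiagonal' fun j => rhInf_iff.1 (hRF j)) (.fromRows h2M (.fromRows hYM h2M))
    (.fromCols (hMr.mul r₁₂).neg (.fromCols hMY (hMr.mul r₁₂))) ?_ ?_ ?_ ?_
    ⟨.offDiag fun j => (sA j).1, .offDiag fun j => (sA j).2.1,
      offDiag_mul_eq_one fun j => (sA j).2.2⟩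
    ⟨.blockDiagonal' fun j => (sF j).1, .blockDiagonal' fun j => (sF j).2.1,
      blockDiagonal'_mul_eq_one fun j => (sF j).2.2⟩
    (.offDiag fun j => (bistable_entriesIn (hVcA j)).1)
    (.blockDiagonal' fun j => (bistable_entriesIn (hVcF j)).1)
    ⟨.offDiag fun j => (wA j).1, .offDiag fun j => (wA j).2,
      offDiag_mul_eq_one fun j => mul_nonsing_inv _ (hWA j).2.1⟩
    ⟨.blockDiagonal' fun j => (wF j).1, .blockDiagonal' fun j => (wF j).2,
      blockDiagonal'_mul_eq_one fun j => mul_nonsing_inv _ (hWF j).2.1⟩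
    hQl hQr hη hηd ?_ ?_ ?_ ?_ ?_
  · rw [hN]
    simp [blocksChan, fromRows_mul]
  · rw [hN]
    simp [blocksChan, mul_fromCols, Matrix.mul_assoc]
  · rw [hN]
    exact .blocksChan (r₂₂.sub h2M1) (r₂₁.mul hMY) h2M1 (h2M.mul hSr.toBlocks₂₁)
      (hYM1.neg.sub r₁₂) (hYr.mul hMY) hYM1 (hYM.mul hSr.toBlocks₂₁)
      h2M1.neg (h2M.mul hYr) (r₂₂.add h2M1) (h2M.mul hSr.toBlocks₂₁)
      hSM1.neg (hSr.toBlocks₁₂.mul hMY) hSM1 .zero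
  · rw [offDiag_conjTranspose]
    simp only [scalarBlocks_conjTranspose]
  · rw [blockDiagonal'_conjTranspose]
    simp only [scalarBlocks_conjTranspose]
  · rw [constTF_offDiag, offDiag_mul]
    simp only [constTF_scalarBlocks_mul]
  · rw [constTF_blockDiagonal', ← blockDiagonal'_mul]
    simp only [constTF_scalarBlocks_mul]
  · rw [← hl, ← hr, ← sortedScaling_submatrix, ← sortedScaling_submatrix]
    exact hlmi
  · intro ω
    rw [offDiag_mul, offDiag_mul, ← blockDiagonal'_mul, ← blockDiagonal'_mul]
    simp only [freqResp_eq_evalMat, evalMat_blockDiagonal', evalMat_offDiag]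
    rw [← repeatedUnc_sortErrSys]
    exact hcomm _ _
  · intro ω
    rw [offDiag_mul, offDiag_mul, freqResp_eq_evalMat, evalMat_offDiag]
    exact opNorm_offDiag_le hd fun j => nA j ω
  · intro ω
    rw [← blockDiagonal'_mul, ← blockDiagonal'_mul, freqResp_eq_evalMat, evalMat_blockDiagonal']
    exact opNorm_blockDiagonal'_le hd fun j => nF j ω
  · intro T hTeq
    obtain ⟨T₁, T₂, T₃, rfl⟩ : ∃ T₁ T₂ T₃, T = fromRows T₁ (fromRows T₂ T₃) :=
      ⟨T.toRows₁, T.toRows₂.toRows₁, T.toRows₂.toRows₂, by simp⟩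
    rw [hN] at hTeq
    obtain ⟨e1, e2, e3⟩ := loop_blocks hTeq
    obtain ⟨g2, g3, gF⟩ := blockDiagonal'_errF h2 h3 hΔF
    have hloc := fun j => env_sub_env j hΔA (hS.2.2.1 j).1.1 (h1 j)
    have hinv := blockDiagonal'_inv_eq fun j => (hloc j).1
    -- The inner loops decouple over `j`, so the local perturbation formulas assemble into one block
    -- diagonal formula for the environment error.
    have hprod : 1 - E₂₂ * offDiag ΔA =
        blockDiagonal' fun j => 1 - (extEnv S Sig j).toBlocks₂₂ * parOff ΔA j :=
      one_sub_blockDiagonal'_mul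
    have hDE : (blockDiagonal' fun j => (env S SigA j).toBlocks₂₂) - E₁₁ =
        E₁₂ * offDiag ΔA * (1 - E₂₂ * offDiag ΔA)⁻¹ * E₂₁ := by
      rw [hprod, hinv.2]
      change _ = E₁₂ * (blockDiagonal' fun j => parOff ΔA j) * _ * _
      rw [hE₁₁, hE₁₂, hE₂₁, ← blockDiagonal'_sub, ← blockDiagonal'_mul, ← blockDiagonal'_mul,
        ← blockDiagonal'_mul]
      congr 1
      exact funext fun j => (hloc j).2
    -- The reduction output `ΔF * T₂` is carried along as an opaque `W`, since only the abstraction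
    -- channels are being eliminated.
    obtain ⟨ζ, ζ₃, hζ, f1, f2, f3⟩ := solution_of_extended_solution
      (W := blockDiagonal' ΔF * T₂) (by rw [hprod]; exact hinv.1) hDE e1 e2 e3
    refine ⟨ζ, ?_, reduced_loop_of_solution hS.2.2.2.1.1 g2 g3 hM hY rfl gF f1 f2 f3⟩
    rw [errDiag_mul_fromRows, fromCols_mul_fromRows, fromCols_mul_fromRows, ← add_assoc (-_ * _)]
    exact hζ

end SubsystemAbstraction

end

/-! ### Distribution of the margin and proof of the theorem -/

/-- A margin in the property `Q` or in all the bounds leaves a margin in the product of the two. -/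
lemma exists_margin {k : ℕ} {x y : Fin k → ENNReal} {Q : ℝ → Prop} (hx : ∀ j, x j ≤ 1)
    (hy : ∀ j, y j ≤ 1) (h0 : Q 0)
    (h : (∃ η > 0, Q η) ∨ (∀ j, x j < 1) ∧ ∀ j, y j < 1) :
    ∃ η d : ℝ, 0 ≤ η ∧ 0 ≤ d ∧ √(1 - η) * d < 1 ∧ Q η ∧ (∀ j, x j ≤ ENNReal.ofReal d) ∧
      ∀ j, y j ≤ ENNReal.ofReal d := by
  rcases h with ⟨η, hη, hQ⟩ | ⟨hx', hy'⟩
  -- Margin in the inequality: the low-level bounds are used with `d = 1`. For `η > 1` the real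
  -- square root is `0`, which is harmless.
  · refine ⟨η, 1, hη.le, zero_le_one, ?_, hQ, by simpa using hx, by simpa using hy⟩
    rw [mul_one, Real.sqrt_lt' one_pos]
    linarith
  · obtain ⟨d, hd0, hd1, hxd, hyd⟩ := exists_common_bound hx' hy'
    -- Margin in the low-level norms: the inequality is used without slack, `η = 0`.
    exact ⟨0, d, le_rfl, hd0, by simpa using hd1, h0, hxd, hyd⟩

theorem theorem4 {k pC mC : ℕ} {m p : Fin k → ℕ}
    -- interconnection dynamics, subsystems and reduced subsystems
    (S : TF (Fin pC ⊕ Idx m) (Fin mC ⊕ Idx p))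
    (Sig SigR : ∀ j, TF (Fin (p j)) (Fin (m j)))
    (hS : StandingAssumption S Sig) (hSigR : ∀ j, ProperRR (SigR j))
    -- nonsingular augmentation weights
    (Gy : ∀ j, Matrix (Fin (p j)) (Fin (p j)) ℂ) (Gu : ∀ j, Matrix (Fin (m j)) (Fin (m j)) ℂ)
    (hGy : ∀ j, IsUnit (Gy j).det) (hGu : ∀ j, IsUnit (Gu j).det)
    -- weights of the high-level specification and of the reduction errors
    (VC : TF (Fin pC) (Fin pC)) (WC : TF (Fin mC) (Fin mC)) (hVC : Bistable VC) (hWC : Bistable WC)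
    (WF : ∀ j, TF (Fin (p j)) (Fin (p j))) (VcF : ∀ j, TF (Fin (m j)) (Fin (m j)))
    (hWF : ∀ j, Bistable (WF j)) (hVcF : ∀ j, Bistable (VcF j)) :
    -- environment abstraction
    (∀ (WE : ∀ j, TF (Fin (m j)) (Fin (m j))) (VcE : ∀ j, TF (Fin (p j)) (Fin (p j)))
        (εE εF : Fin k → ℝ) (EA : ∀ j, TF (Fin pC ⊕ Fin (m j)) (Fin mC ⊕ Fin (p j)))
        (ΔE : ∀ j, TF (Fin (m j)) (Fin (p j))) (ΔF : ∀ j, TF (Fin (p j)) (Fin (m j))),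
      (∀ j, ΔE j = (EA j - env S Sig j).toBlocks₂₂) →
      (∀ j, ΔF j = errFtilde (EA j) (Gy j) (Gu j) (Sig j) (SigR j)) →
      (∀ j, Bistable (WE j)) → (∀ j, Bistable (VcE j)) →
      FeasibleEnv (weightedPlantEnv S Sig VcE VcF VC WE WF WC) εE εF →
      (∀ j, ProperRR (EA j)) →
      (∀ j, LftWellPosed (augEnv (EA j) (Gy j) (Gu j)) (Sig j)) →
      (∀ j, LftWellPosed (augEnv (EA j) (Gy j) (Gu j)) (SigR j)) →
      (∀ j, RHinf (ΔE j)) → (∀ j, RHinf (ΔF j)) →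
      (∀ j, weightedNorm (WE j) (scaleTF (εE j) (VcE j)) (ΔE j) ≤ 1) →
      (∀ j, weightedNorm (WF j) (scaleTF (εF j) (VcF j)) (ΔF j) ≤ 1) →
      -- not both the matrix inequality and the low-level specifications are tight
      (StrictlyFeasibleEnv (weightedPlantEnv S Sig VcE VcF VC WE WF WC) εE εF ∨
        (∀ j, weightedNorm (WE j) (scaleTF (εE j) (VcE j)) (ΔE j) < 1) ∧
        (∀ j, weightedNorm (WF j) (scaleTF (εF j) (VcF j)) (ΔF j) < 1)) →
      ReducedModelCertified S Sig SigR VC WC) ∧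
    -- subsystem abstraction
    (∀ (WA : ∀ j, TF (Fin (p j)) (Fin (p j))) (VcA : ∀ j, TF (Fin (m j)) (Fin (m j)))
        (εA εF : Fin k → ℝ) (SigA : ∀ j, TF (Fin (p j)) (Fin (m j)))
        (ΔA ΔF : ∀ j, TF (Fin (p j)) (Fin (m j))),
      (∀ j, ΔA j = SigA j - Sig j) →
      (∀ j, ΔF j = errFtilde (env S SigA j) (Gy j) (Gu j) (Sig j) (SigR j)) →
      (∀ j, Bistable (WA j)) → (∀ j, Bistable (VcA j)) →
      FeasibleSys (weightedPlantSys S Sig VcA VcF VC WA WF WC) εA εF →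
      (∀ j, LftWellPosed (permS S j) (parOff SigA j)) →
      (∀ j, LftWellPosed (augEnv (env S SigA j) (Gy j) (Gu j)) (Sig j)) →
      (∀ j, LftWellPosed (augEnv (env S SigA j) (Gy j) (Gu j)) (SigR j)) →
      (∀ j, RHinf (ΔA j)) → (∀ j, RHinf (ΔF j)) →
      (∀ j, weightedNorm (WA j) (scaleTF (εA j) (VcA j)) (ΔA j) ≤ 1) →
      (∀ j, weightedNorm (WF j) (scaleTF (εF j) (VcF j)) (ΔF j) ≤ 1) →
      -- not both the matrix inequality and the low-level specifications are tight
      (StrictlyFeasibleSys (weightedPlantSys S Sig VcA VcF VC WA WF WC) εA εF ∨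
        (∀ j, weightedNorm (WA j) (scaleTF (εA j) (VcA j)) (ΔA j) < 1) ∧
        (∀ j, weightedNorm (WF j) (scaleTF (εF j) (VcF j)) (ΔF j) < 1)) →
      ReducedModelCertified S Sig SigR VC WC) := by
  refine ⟨?_, ?_⟩
  · intro WE VcE εE εF EA ΔE ΔF hΔE hΔF hWE hVcE hfeas _ hwp hwpR hRE hRF hE hF hstrict
    obtain ⟨η, d, hη, hd, hηd, hlmi, hE', hF'⟩ := exists_margin (Q := fun η =>
      ∃ D ∈ scalEnv k pC mC m p, ScaledLMI η (boldEnv (scalarBlocks p εE) (scalarBlocks m εF) 1)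
        (weightedPlantEnv S Sig VcE VcF VC WE WF WC) D) hE hF hfeas.2.2 (by
      refine hstrict.imp_left fun ⟨_, _, D, hD, η, hη, h⟩ => ⟨η, hη, D, hD, h⟩)
    exact certified_of_environment_abstraction (Eh := fun j => (EA j).toBlocks₂₂) hS hVC hWC hWF
      hVcF hΔE (fun j => lftWellPosed_augEnv (hwp j)) (fun j => lftWellPosed_augEnv (hwpR j))
      (fun j => (hΔF j).trans (errFtilde_eq (hGy j) (hGu j) _ _)) hWE hVcE hRE hRF hfeas.1
      hfeas.2.1 hη hd hηd hlmi hE' hF'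
  · intro WA VcA εA εF SigA ΔA ΔF hΔA hΔF hWA hVcA hfeas hwpA hwp hwpR hRA hRF hA hF hstrict
    obtain ⟨η, d, hη, hd, hηd, hlmi, hA', hF'⟩ := exists_margin (Q := fun η =>
      ∃ D ∈ scalSys k pC mC m p, ScaledLMI η (boldSys (scalarBlocks m εA) (scalarBlocks m εF) 1)
        (weightedPlantSys S Sig VcA VcF VC WA WF WC) D) hA hF hfeas.2.2 (by
      refine hstrict.imp_left fun ⟨_, _, D, hD, η, hη, h⟩ => ⟨η, hη, D, hD, h⟩)
    exact certified_of_subsystem_abstraction hS hVC hWC hWF hVcF hΔA (fun j => (hwpA j).1)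
      (fun j => lftWellPosed_augEnv (hwp j)) (fun j => lftWellPosed_augEnv (hwpR j))
      (fun j => (hΔF j).trans (errFtilde_eq (hGy j) (hGu j) _ _)) hWA hVcA hRA hRF hfeas.1
      hfeas.2.1 hη hd hηd hlmi hA' hF'
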